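/- Let $\phi$ and $\overline\phi$ be real algebraic integers such that $\phi+\overline\phi$ and $\phi\overline\phi$ are non-zero coprime rational integers and $\phi>|\overline\phi|$. For $n\ge 1$ let $$v_n=\frac{\phi^n-\overline\phi^n}{\phi-\overline\phi};$$ these are positive integers. A prime number $p$ is called a primitive divisor of $v_n$ if $p$ divides $v_n$ but does not divide $v_1\cdots v_{n-1}$. Let $\mathcal F$ be the set of all $v_n$ ($n\ge 1$) that have a primitive divisor, let $\mathcal F_0$ be the set of all $v_n$ with $1\le n\le 12$ that have a primitive divisor, and let $\mathcal M(\mathcal F)=\{m_1\cdots m_k\mid k\ge 0,\ m_j\in\mathcal F\}$ be the multiplicative monoid generated by $\mathcal F$. Then there is a constant $k_0>0$, depending only on $\phi$ and $\overline\phi$, such that, as $x\to\infty$, $$|\mathcal M(\mathcal F)\cap[1,x]| = k_0(\log x)^{k_1}\exp\biggl(\pi\sqrt{\frac{2\log x}{3\log\phi}}\biggr)\Bigl(1+O\Bigl(\frac{1}{(\log x)^{1/10}}\Bigr)\Bigr),$$ where $$k_1=\frac{|\mathcal F_0|-13}{2}+\frac{\log(\phi-\overline\phi)}{2\log\phi},$$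 and the implied constant depends only on $\phi$ and $\overline\phi$. -/

import Mathlib

namespace LucasMonoid

/-- The Lucas numbers `v_n = (φ ^ n - φ' ^ n) / (φ - φ')` associated with the pair `(φ, φ')`,
where `φ'` is the conjugate of `φ`, as real numbers. -/
noncomputable def lucas (φ φ' : ℝ) (n : ℕ) : ℝ := (φ ^ n - φ' ^ n) / (φ - φ')

/-- The positive integer `p` divides the real number `x` in `ℤ`, that is, `x` is an integer
multiple of `p`. It is used for the Lucas numbers and their products, which are integers. -/
def IntDvd (p : ℕ) (x : ℝ) : Prop := ∃ k : ℤ, x = (p : ℝ) * (k : ℝ)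

/-- The prime number `p` is a primitive divisor of `v_n`:
it divides `v_n` but not `v_1 ⋯ v_{n-1}`. -/
def IsPrimitiveDivisor (φ φ' : ℝ) (n p : ℕ) : Prop :=
  p.Prime ∧ IntDvd p (lucas φ φ' n) ∧ ¬ IntDvd p (∏ i ∈ Finset.Ico 1 n, lucas φ φ' i)

/-- The set of all `v_n`, `n ≥ 1`, that have a primitive divisor. -/
def lucasSet (φ φ' : ℝ) : Set ℕ :=
  {m | ∃ n : ℕ, 1 ≤ n ∧ (m : ℝ) = lucas φ φ' n ∧ ∃ p : ℕ, IsPrimitiveDivisor φ φ' n p}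

/-- The set of all `v_n`, `1 ≤ n ≤ 12`, that have a primitive divisor. -/
def lucasSet₀ (φ φ' : ℝ) : Set ℕ :=
  {m | ∃ n : ℕ, 1 ≤ n ∧ n ≤ 12 ∧ (m : ℝ) = lucas φ φ' n ∧
    ∃ p : ℕ, IsPrimitiveDivisor φ φ' n p}

/-- The multiplicative monoid of all finite products of elements of `lucasSet φ φ'`. -/
def lucasMonoid (φ φ' : ℝ) : Submonoid ℕ := Submonoid.closure (lucasSet φ φ')

/-- The number of elements of the monoid in the interval `[1, x]`. -/
noncomputable def count (φ φ' x : ℝ) : ℕ :=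
  {m : ℕ | m ∈ lucasMonoid φ φ' ∧ 1 ≤ m ∧ (m : ℝ) ≤ x}.ncard

end LucasMonoid

open Filter Topology MeasureTheory

namespace LucasMonoid

/-! Listed by increasing index, each Lucas number in `lucasSet` has a prime factor dividing no
earlier one, so these generators are multiplicatively independent (`eq_of_prod_pow_eq`) and the
monoid is free. Taking logarithms, `count` becomes the number of weighted partitions of size at most
X = log x into parts ν_j, the logarithms of the generators. By Carmichael's theorem
(`exists_isPrimitiveDivisor`) no index n ≥ 13 is missing, so ν_j = jL + b up to a summable error,
with L = log φ and b = (13 - |F₀|) log φ - log(φ - φ') (`exists_weights`). The exponent k₁ is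
-b/(2L).

The partitions are counted by the saddle point method (`weightCount_asymptotic`). Their Dirichlet
series is the exponential of `logZeta`, and in a sector around the positive axis log ζ(s) = A/s -
(1/2 - b/L) log s + c₀ + O(|s|) with A = π²/(6L) (`exists_norm_logZeta_sub_le`): the derivative is
-1/s times a sum of Bose functions over the ν_j, evaluated by the midpoint rule. Perron's formula is
taken on the line Re s = σ through the saddle point σ = √(A/X) of A/s + sX. Inside the sector the
integrand is nearly a Gaussian of width of order σ^(3/2), which gives the main term; outside it,
`exists_norm_exp_logZeta_le` makes it negligible. Smoothing at scale h = ±σ^(-4/5) bounds the count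
from both sides and costs a relative error of order σ|h| = σ^(1/5), hence X^(-1/10).

Carmichael's theorem rests on the integer H = Φ_n(φ, φ'), the homogeneous cyclotomic value. If v_n
had no primitive divisor, each prime q dividing H would satisfy n = r q^j with r ≤ q + 1 the rank of
q. This forces H to be squarefree with a single prime factor, and q - 1 divides the totient of n, so
|H| is at most that totient plus 1. Comparison with the golden ratio shows that |H| is larger
(`totient_add_one_lt_abs_homCyclotomic`). -/

/-! ### Euler product for a free commutative monoid. -/

/-- The value at `e` of the multiplicative function `e ↦ ∏ x_j ^ e_j`. -/
noncomputable def monomialValue {𝕜 : Type*} [NormedField 𝕜] (x : ℕ → 𝕜) (e : ℕ →₀ ℕ) : 𝕜 :=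
  e.prod fun j k => x j ^ k

theorem norm_monomialValue {𝕜 : Type*} [NormedField 𝕜] (x : ℕ → 𝕜) (e : ℕ →₀ ℕ) :
    ‖monomialValue x e‖ = monomialValue (fun j => ‖x j‖) e := by
  simp [monomialValue, Finsupp.prod, norm_prod]

theorem summable_norm_and_hasSum_fin {𝕜 : Type*} [NormedField 𝕜] [CompleteSpace 𝕜]
    {J : ℕ} (x : Fin J → 𝕜) (hx : ∀ i, ‖x i‖ < 1) :
    Summable (fun e : Fin J → ℕ => ‖∏ i, x i ^ e i‖) ∧
      HasSum (fun e : Fin J → ℕ => ∏ i, x i ^ e i) (∏ i, (1 - x i)⁻¹) := by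
  induction J with
  | zero => exact ⟨Summable.of_finite, by simp⟩
  | succ J ih =>
    obtain ⟨ih1, ih2⟩ := ih (fun i => x i.succ) (fun i => hx _)
    have g1 : Summable (fun k : ℕ => ‖x 0 ^ k‖) := by
      simpa using summable_geometric_of_lt_one (norm_nonneg _) (hx 0)
    have g2 := hasSum_geometric_of_norm_lt_one (hx 0)
    have h1 : Summable fun p : ℕ × (Fin J → ℕ) => ‖x 0 ^ p.1 * ∏ i : Fin J, x i.succ ^ p.2 i‖ :=
      Summable.mul_norm (f := fun k : ℕ => x 0 ^ k)
        (g := fun e : Fin J → ℕ => ∏ i : Fin J, x i.succ ^ e i) g1 ih1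
    have h2 := g2.mul ih2 h1.of_norm
    have key : ∀ p : ℕ × (Fin J → ℕ),
        ∏ i, x i ^ Fin.consEquiv (fun _ : Fin (J + 1) => ℕ) p i
          = x 0 ^ p.1 * ∏ i : Fin J, x i.succ ^ p.2 i := fun p => by
      simp [Fin.prod_univ_succ, Fin.consEquiv]
    constructor
    · refine (Fin.consEquiv (fun _ : Fin (J + 1) => ℕ)).summable_iff.1 (h1.congr fun p => ?_)
      exact congrArg _ (key p).symm
    · rw [Fin.prod_univ_succ]
      refine (Fin.consEquiv (fun _ : Fin (J + 1) => ℕ)).hasSum_iff.1 ?_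
      exact h2.congr_fun fun p => (key p)

/-- Exponent vectors supported in `{0, …, J - 1}` as finitely supported functions on `ℕ`. -/
noncomputable def extendFin (J : ℕ) (e : Fin J → ℕ) : ℕ →₀ ℕ :=
  (Finsupp.equivFunOnFinite.symm e).embDomain Fin.valEmbedding

theorem extendFin_injective (J : ℕ) : Function.Injective (extendFin J) := fun _ _ h =>
  Finsupp.equivFunOnFinite.symm.injective (Finsupp.embDomain_injective _ h)

theorem mem_range_extendFin {J : ℕ} {e : ℕ →₀ ℕ} :
    e ∈ Set.range (extendFin J) ↔ e.support ⊆ Finset.range J := by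
  constructor
  · rintro ⟨e, rfl⟩ j hj
    rw [extendFin, Finsupp.support_embDomain, Finset.mem_map] at hj
    obtain ⟨i, -, rfl⟩ := hj
    simp
  · intro h
    refine ⟨fun i => e i, ?_⟩
    ext j
    by_cases hj : j < J
    · exact Finsupp.embDomain_apply_self Fin.valEmbedding _ (⟨j, hj⟩ : Fin J)
    · rw [extendFin, Finsupp.embDomain_of_notMem_range]
      · by_contra h0
        exact hj (Finset.mem_range.1 (h (Finsupp.mem_support_iff.2 (Ne.symm h0))))
      · rintro ⟨i, rfl⟩
        exact hj i.2

theorem monomialValue_extendFin {𝕜 : Type*} [NormedField 𝕜] (x : ℕ → 𝕜) {J : ℕ} (e : Fin J → ℕ) :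
    monomialValue x (extendFin J e) = ∏ i : Fin J, x i ^ e i := by
  rw [monomialValue, extendFin, Finsupp.prod_embDomain, Finsupp.prod_fintype _ _ (by simp)]
  rfl

theorem hasSum_indicator_monomialValue {𝕜 : Type*} [NormedField 𝕜] [CompleteSpace 𝕜]
    (x : ℕ → 𝕜) (hx : ∀ i, ‖x i‖ < 1) (J : ℕ) :
    HasSum (fun e : ℕ →₀ ℕ => if e.support ⊆ Finset.range J then monomialValue x e else 0)
      (∏ i ∈ Finset.range J, (1 - x i)⁻¹) := by
  rw [← (extendFin_injective J).hasSum_iff, ← Fin.prod_univ_eq_prod_range (fun i => (1 - x i)⁻¹)]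
  · convert (summable_norm_and_hasSum_fin (fun i : Fin J => x i) (fun i => hx i)).2 using 2 with e
    rw [Function.comp_apply, if_pos (mem_range_extendFin.1 ⟨e, rfl⟩), monomialValue_extendFin]
  · intro e he
    rw [mem_range_extendFin] at he
    simp [he]

/-- A finite set of exponent vectors involves only finitely many generators, so every partial sum is
bounded by a finite Euler product, and these are bounded uniformly because -log(1 - x_j) is
summable. -/
theorem summable_monomialValue_of_nonneg (x : ℕ → ℝ) (h0 : ∀ i, 0 ≤ x i) (hx : ∀ i, x i < 1)
    (hs : Summable x) : Summable (monomialValue x) := by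
  have hlog : Summable (fun j => -Real.log (1 - x j)) := by
    have := (Real.summable_log_one_add_of_summable (f := fun j => -x j) hs.neg).neg
    simpa [sub_eq_add_neg] using this
  have hnn : ∀ e, 0 ≤ monomialValue x e := fun e => Finset.prod_nonneg fun j _ => pow_nonneg (h0 j) _
  refine summable_of_sum_le (c := Real.exp (∑' j, -Real.log (1 - x j))) hnn fun u => ?_
  obtain ⟨J, hJ⟩ : ∃ J, ∀ e ∈ u, e.support ⊆ Finset.range J := by
    refine ⟨u.sup (fun e => e.support.sup (· + 1)), fun e he j hj => ?_⟩
    rw [Finset.mem_range]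
    exact lt_of_lt_of_le (Nat.lt_succ_self j)
      ((Finset.le_sup (f := (· + 1)) hj).trans (Finset.le_sup (f := fun e : ℕ →₀ ℕ => e.support.sup (· + 1)) he))
  have h1 := hasSum_indicator_monomialValue x (fun i => by rw [Real.norm_of_nonneg (h0 i)]; exact hx i) J
  calc ∑ e ∈ u, monomialValue x e
      = ∑ e ∈ u, (if e.support ⊆ Finset.range J then monomialValue x e else 0) :=
        Finset.sum_congr rfl fun e he => by rw [if_pos (hJ e he)]
    _ ≤ ∏ i ∈ Finset.range J, (1 - x i)⁻¹ := by
        refine sum_le_hasSum u (fun e _ => ?_) h1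
        split_ifs
        exacts [hnn e, le_rfl]
    _ = Real.exp (∑ j ∈ Finset.range J, -Real.log (1 - x j)) := by
        rw [Real.exp_sum]
        refine Finset.prod_congr rfl fun j _ => ?_
        rw [Real.exp_neg, Real.exp_log (by linarith [hx j])]
    _ ≤ _ := by
        rw [Real.exp_le_exp]
        refine hlog.sum_le_tsum _ fun j _ => ?_
        have := Real.log_nonpos (by linarith [hx j]) (by linarith [h0 j] : 1 - x j ≤ 1)
        linarith

theorem summable_norm_monomialValue (x : ℕ → ℂ) (hx : ∀ i, ‖x i‖ < 1) (hs : Summable fun i => ‖x i‖) :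
    Summable fun e => ‖monomialValue x e‖ := by
  simp_rw [norm_monomialValue]
  exact summable_monomialValue_of_nonneg _ (fun _ => norm_nonneg _) hx hs

theorem summable_log_one_sub (x : ℕ → ℂ) (hs : Summable fun i => ‖x i‖) :
    Summable fun j => -Complex.log (1 - x j) := by
  have := (Complex.summable_log_one_add_of_summable (f := fun j => -x j) hs.of_norm.neg).neg
  simpa [sub_eq_add_neg] using this

/-- The Euler product for the free commutative monoid on countably many generators. -/
theorem hasSum_monomialValue (x : ℕ → ℂ) (hx : ∀ i, ‖x i‖ < 1) (hs : Summable fun i => ‖x i‖) :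
    HasSum (monomialValue x) (Complex.exp (∑' j, -Complex.log (1 - x j))) := by
  have hsum := summable_norm_monomialValue x hx hs
  have hlim : Tendsto (fun J => ∏ i ∈ Finset.range J, (1 - x i)⁻¹) atTop
      (𝓝 (Complex.exp (∑' j, -Complex.log (1 - x j)))) := by
    have := (Complex.continuous_exp.tendsto _).comp
      (summable_log_one_sub x hs).hasSum.tendsto_sum_nat
    refine this.congr fun J => ?_
    rw [Function.comp_apply, Complex.exp_sum]
    refine Finset.prod_congr rfl fun j _ => ?_
    rw [Complex.exp_neg, Complex.exp_log]
    intro h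
    have := hx j
    rw [← sub_eq_zero.1 h] at this
    simp at this
  -- Truncating to the first J generators gives the finite Euler products; dominated convergence
  -- identifies their limit with the full sum.
  have h2 : Tendsto (fun J => ∑' e : ℕ →₀ ℕ,
      if e.support ⊆ Finset.range J then monomialValue x e else 0) atTop
      (𝓝 (∑' e, monomialValue x e)) := by
    refine tendsto_tsum_of_dominated_convergence hsum (fun e => ?_) (Eventually.of_forall fun J e => ?_)
    · refine tendsto_const_nhds.congr' ?_
      filter_upwards [eventually_ge_atTop (e.support.sup (· + 1))] with J hJ
      rw [if_pos]
      intro j hj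
      rw [Finset.mem_range]
      exact lt_of_lt_of_le (Nat.lt_succ_self j) ((Finset.le_sup (f := (· + 1)) hj).trans hJ)
    · split_ifs
      · exact le_rfl
      · simp
  have h3 := tendsto_nhds_unique h2 (hlim.congr fun J =>
    ((hasSum_indicator_monomialValue x hx J).tsum_eq).symm)
  rw [← h3]
  exact hsum.of_norm.hasSum

/-! ### The Laplace transform of the ramp and its inversion. -/

theorem integrableOn_mul_exp_neg_Ioi {σ : ℝ} (hσ : 0 < σ) :
    IntegrableOn (fun t : ℝ => t * Real.exp (-σ * t)) (Set.Ioi 0) := by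
  have h := integrableOn_rpow_mul_exp_neg_mul_rpow (s := 1) (p := 1) (b := σ) (by norm_num) one_pos hσ
  simpa only [Real.rpow_one] using h

theorem integral_mul_exp_neg_Ioi {r : ℂ} (hr : 0 < r.re) :
    ∫ t in Set.Ioi (0 : ℝ), (t : ℂ) * Complex.exp (-(r * t)) = 1 / r ^ 2 := by
  have hr0 : r ≠ 0 := fun h => by simp [h] at hr
  have hnorm : ∀ t : ℝ, ‖Complex.exp (-(r * t))‖ = Real.exp (-r.re * t) := fun t => by
    rw [Complex.norm_exp]; simp
  have hderiv : ∀ t : ℝ, HasDerivAt (fun t : ℝ => -((t : ℂ) / r + 1 / r ^ 2) * Complex.exp (-(r * t)))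
      ((t : ℂ) * Complex.exp (-(r * t))) t := by
    intro t
    have h1 : HasDerivAt (fun t : ℝ => (t : ℂ)) 1 t := Complex.ofRealCLM.hasDerivAt
    have h2 : HasDerivAt (fun t : ℝ => -(r * (t : ℂ))) (-(r * 1)) t := (h1.const_mul r).neg
    have h3 := (((h1.div_const r).add_const (1 / r ^ 2)).neg).mul h2.cexp
    refine h3.congr_deriv ?_
    have h5 : (t : ℂ) / r * r = t := by field_simp
    have h6 : (1 : ℂ) / r ^ 2 * r = 1 / r := by field_simp
    simp only [Pi.neg_apply]
    linear_combination Complex.exp (-(r * t)) * h5 + Complex.exp (-(r * t)) * h6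
  have hint : IntegrableOn (fun t : ℝ => (t : ℂ) * Complex.exp (-(r * t))) (Set.Ioi 0) := by
    refine (integrableOn_mul_exp_neg_Ioi hr).mono' (Continuous.aestronglyMeasurable (by fun_prop)) ?_
    refine (ae_restrict_mem measurableSet_Ioi).mono fun t ht => ?_
    rw [norm_mul, hnorm, Complex.norm_real, Real.norm_of_nonneg (le_of_lt ht)]
  have hlim : Tendsto (fun t : ℝ => -((t : ℂ) / r + 1 / r ^ 2) * Complex.exp (-(r * t))) atTop (𝓝 0) := by
    have hA : Tendsto (fun t : ℝ => (t : ℂ) * Complex.exp (-(r * t))) atTop (𝓝 0) := by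
      rw [tendsto_zero_iff_norm_tendsto_zero]
      have := tendsto_rpow_mul_exp_neg_mul_atTop_nhds_zero 1 r.re hr
      refine this.congr' ?_
      filter_upwards [eventually_ge_atTop 0] with t ht
      rw [norm_mul, hnorm, Complex.norm_real, Real.norm_of_nonneg ht, Real.rpow_one]
    have hB : Tendsto (fun t : ℝ => Complex.exp (-(r * t))) atTop (𝓝 0) := by
      rw [tendsto_zero_iff_norm_tendsto_zero]
      have := tendsto_rpow_mul_exp_neg_mul_atTop_nhds_zero 0 r.re hr
      refine this.congr fun t => ?_
      rw [hnorm, Real.rpow_zero, one_mul]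
    have := (hA.const_mul (-(1 / r))).add (hB.const_mul (-(1 / r ^ 2)))
    rw [mul_zero, mul_zero, add_zero] at this
    refine this.congr fun t => ?_
    ring
  rw [integral_Ioi_of_hasDerivAt_of_tendsto' (fun t _ => hderiv t) hint hlim]
  simp

theorem re_line (σ t : ℝ) : ((σ : ℂ) + t * Complex.I).re = σ := by simp

theorem line_ne_zero {σ : ℝ} (hσ : 0 < σ) (t : ℝ) : (σ : ℂ) + t * Complex.I ≠ 0 := fun h => by
  have := congrArg Complex.re h
  rw [re_line] at this
  simp at this
  exact hσ.ne' this

theorem norm_sq_line (σ t : ℝ) : ‖(σ : ℂ) + t * Complex.I‖ ^ 2 = σ ^ 2 + t ^ 2 := by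
  rw [Complex.sq_norm, Complex.normSq_add_mul_I]

theorem continuous_line (σ : ℝ) : Continuous fun t : ℝ => (σ : ℂ) + t * Complex.I := by fun_prop

theorem integrable_inv_sq_add_sq {σ : ℝ} (hσ : 0 < σ) :
    Integrable fun t : ℝ => (σ ^ 2 + t ^ 2)⁻¹ := by
  have h := (integrable_inv_one_add_sq.comp_mul_left' (inv_ne_zero hσ.ne')).const_mul (σ ^ 2)⁻¹
  refine h.congr (Eventually.of_forall fun t => ?_)
  have : σ ≠ 0 := hσ.ne'
  simp only
  rw [← mul_inv]
  congr 1
  field_simp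

theorem integrable_inv_line_sq {σ : ℝ} (hσ : 0 < σ) :
    Integrable fun t : ℝ => 1 / ((σ : ℂ) + t * Complex.I) ^ 2 := by
  refine (integrable_inv_sq_add_sq hσ).mono' ?_ (Eventually.of_forall fun t => ?_)
  · refine Continuous.aestronglyMeasurable ?_
    refine continuous_const.div ((continuous_line σ).pow 2) fun t => pow_ne_zero 2 (line_ne_zero hσ t)
  · rw [norm_div, norm_pow, norm_sq_line]
    simp

theorem fourier_ramp {σ : ℝ} (hσ : 0 < σ) (w : ℝ) :
    FourierTransform.fourier (fun y : ℝ => ((max y 0 * Real.exp (-σ * y) : ℝ) : ℂ)) w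
      = 1 / ((σ : ℂ) + (2 * Real.pi * w : ℝ) * Complex.I) ^ 2 := by
  rw [Real.fourier_real_eq_integral_exp_smul, ← integral_mul_exp_neg_Ioi
    (r := (σ : ℂ) + (2 * Real.pi * w : ℝ) * Complex.I) (by rw [re_line]; exact hσ),
    ← integral_indicator measurableSet_Ioi]
  congr 1
  ext v
  by_cases hv : 0 < v
  · rw [Set.indicator_of_mem (Set.mem_Ioi.2 hv), max_eq_left hv.le]
    push_cast
    rw [smul_eq_mul, mul_left_comm, ← Complex.exp_add]
    congr 2
    ring
  · rw [Set.indicator_of_notMem (by simpa using hv), max_eq_right (not_lt.1 hv)]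
    simp

theorem integrable_ramp {σ : ℝ} (hσ : 0 < σ) :
    Integrable (fun y : ℝ => ((max y 0 * Real.exp (-σ * y) : ℝ) : ℂ)) := by
  have h := integrableOn_mul_exp_neg_Ioi hσ
  rw [← integrable_indicator_iff measurableSet_Ioi] at h
  refine Integrable.ofReal (f := fun y : ℝ => max y 0 * Real.exp (-σ * y))
    (h.congr (Eventually.of_forall fun v => ?_))
  beta_reduce
  by_cases hv : 0 < v
  · rw [Set.indicator_of_mem (Set.mem_Ioi.2 hv), max_eq_left hv.le]
  · rw [Set.indicator_of_notMem (by simpa using hv), max_eq_right (not_lt.1 hv), zero_mul]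

/-- The inverse Laplace transform of `1 / s ^ 2` is the ramp function. -/
theorem integral_exp_div_line_sq {σ : ℝ} (hσ : 0 < σ) (y : ℝ) :
    ∫ t : ℝ, Complex.exp (((σ : ℂ) + t * Complex.I) * y) / ((σ : ℂ) + t * Complex.I) ^ 2
      = ((2 * Real.pi * max y 0 : ℝ) : ℂ) := by
  -- The factor e^(-σy) makes the ramp integrable. It stays continuous and its transform decays
  -- quadratically, so Fourier inversion holds at every point; this is the advantage of 1/s² over
  -- 1/s.
  set F : ℝ → ℂ := fun y : ℝ => ((max y 0 * Real.exp (-σ * y) : ℝ) : ℂ) with hF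
  have hFc : Continuous F := by fun_prop
  have hfour : FourierTransform.fourier F
      = fun w : ℝ => 1 / ((σ : ℂ) + (2 * Real.pi * w : ℝ) * Complex.I) ^ 2 :=
    funext fun w => fourier_ramp hσ w
  have hint : Integrable (FourierTransform.fourier F) := by
    rw [hfour]
    exact (integrable_inv_line_sq hσ).comp_mul_left' (by positivity)
  have hinv := congrFun (hFc.fourierInv_fourier_eq (integrable_ramp hσ) hint) y
  rw [Real.fourierInv_eq', hfour] at hinv
  have hsub := Measure.integral_comp_mul_left (fun t : ℝ => Complex.exp (t * Complex.I * y)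
    * (1 / ((σ : ℂ) + t * Complex.I) ^ 2)) (2 * Real.pi)
  have h1 : ∫ v : ℝ, Complex.exp ((2 * Real.pi * v : ℝ) * Complex.I * y)
      * (1 / ((σ : ℂ) + (2 * Real.pi * v : ℝ) * Complex.I) ^ 2) = F y := by
    rw [← hinv]
    congr 1
    ext v
    rw [smul_eq_mul]
    congr 2
    simp
    ring
  rw [h1, abs_of_pos (by positivity), Complex.real_smul] at hsub
  have h2 : ∀ t : ℝ, Complex.exp (((σ : ℂ) + t * Complex.I) * y) / ((σ : ℂ) + t * Complex.I) ^ 2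
      = Complex.exp (σ * y) * (Complex.exp (t * Complex.I * y) * (1 / ((σ : ℂ) + t * Complex.I) ^ 2)) := by
    intro t
    rw [add_mul, Complex.exp_add]
    ring
  simp_rw [h2]
  rw [integral_const_mul]
  have h3 : ∫ t : ℝ, Complex.exp (t * Complex.I * y) * (1 / ((σ : ℂ) + t * Complex.I) ^ 2)
      = 2 * Real.pi * F y := by
    rw [hsub]
    push_cast
    rw [← mul_assoc, mul_inv_cancel₀ (by simp [Real.pi_ne_zero]), one_mul]
  rw [h3, hF]
  push_cast
  have h4 : Complex.exp (σ * y) * Complex.exp (-σ * y) = 1 := by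
    rw [← Complex.exp_add]; simp
  linear_combination (2 * Real.pi * (max y 0 : ℝ) : ℂ) * h4

/-! ### Perron's formula and smoothed counting. -/

section Perron

variable {E : Type*} {Λ : E → ℝ} {σ : ℝ}

/-- On this set the terms of the convergent series are at least e^(-σX). -/
theorem finite_setOf_le (hσ : 0 < σ) (hs : Summable fun e => Real.exp (-σ * Λ e)) (X : ℝ) :
    {e | Λ e ≤ X}.Finite := by
  have h := hs.tendsto_cofinite_zero.eventually (gt_mem_nhds (Real.exp_pos (-σ * X)))
  rw [Filter.eventually_cofinite] at h
  refine h.subset fun e (he : Λ e ≤ X) => ?_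
  simp only [not_lt, Set.mem_ofPred_eq, Real.exp_le_exp]
  nlinarith

theorem summable_ramp (hσ : 0 < σ) (hs : Summable fun e => Real.exp (-σ * Λ e)) (X : ℝ) :
    Summable fun e => max (X - Λ e) 0 :=
  summable_of_hasFiniteSupport ((finite_setOf_le hσ hs X).subset fun e he => by
    by_contra h
    exact he (max_eq_right (by simp at h; linarith)))

theorem norm_exp_line (σ t y : ℝ) :
    ‖Complex.exp (((σ : ℂ) + t * Complex.I) * y)‖ = Real.exp (σ * y) := by
  rw [Complex.norm_exp]; simp

theorem hasSum_exp_line (hs : Summable fun e => Real.exp (-σ * Λ e)) (t X : ℝ) :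
    HasSum (fun e => Complex.exp (((σ : ℂ) + t * Complex.I) * ((X - Λ e : ℝ) : ℂ)))
      ((∑' e, Complex.exp (-((σ : ℂ) + t * Complex.I) * Λ e))
        * Complex.exp (((σ : ℂ) + t * Complex.I) * X)) := by
  have h1 : Summable (fun e => Complex.exp (-((σ : ℂ) + t * Complex.I) * Λ e)) := by
    refine Summable.of_norm (hs.congr fun e => ?_)
    rw [Complex.norm_exp]
    simp
  refine (h1.hasSum.mul_right _).congr_fun fun e => ?_
  rw [← Complex.exp_add]
  congr 1
  push_cast
  ring

/-- Perron's formula with the kernel `1 / s ^ 2`. -/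
theorem integral_dirichlet_div_line_sq [Countable E] (hσ : 0 < σ)
    (hs : Summable fun e => Real.exp (-σ * Λ e)) (X : ℝ) :
    Integrable (fun t : ℝ => (∑' e, Complex.exp (-((σ : ℂ) + t * Complex.I) * Λ e))
      * Complex.exp (((σ : ℂ) + t * Complex.I) * X) / ((σ : ℂ) + t * Complex.I) ^ 2) ∧
    ∫ t : ℝ, (∑' e, Complex.exp (-((σ : ℂ) + t * Complex.I) * Λ e))
      * Complex.exp (((σ : ℂ) + t * Complex.I) * X) / ((σ : ℂ) + t * Complex.I) ^ 2
      = ((2 * Real.pi * ∑' e, max (X - Λ e) 0 : ℝ) : ℂ) := by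
  set F : E → ℝ → ℂ := fun e t => Complex.exp (((σ : ℂ) + t * Complex.I) * ((X - Λ e : ℝ) : ℂ))
    / ((σ : ℂ) + t * Complex.I) ^ 2 with hF
  have hFn : ∀ e t, ‖F e t‖ = Real.exp (σ * X) * Real.exp (-σ * Λ e) * (σ ^ 2 + t ^ 2)⁻¹ := by
    intro e t
    rw [hF]
    simp only
    rw [norm_div, norm_exp_line, norm_pow, norm_sq_line, ← Real.exp_add, div_eq_mul_inv]
    congr 2
    ring
  have hFi : ∀ e, Integrable (F e) := by
    intro e
    refine ((integrable_inv_sq_add_sq hσ).const_mul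
      (Real.exp (σ * X) * Real.exp (-σ * Λ e))).mono' ?_ (Eventually.of_forall fun t => (hFn e t).le)
    refine Continuous.aestronglyMeasurable ?_
    exact Continuous.div (by fun_prop) ((continuous_line σ).pow 2)
      fun t => pow_ne_zero 2 (line_ne_zero hσ t)
  have hsn : Summable fun e => ∫ t, ‖F e t‖ := by
    simp_rw [hFn, integral_const_mul]
    exact (hs.mul_left _).mul_right _
  have hpt : ∀ t : ℝ, HasSum (fun e => F e t)
      ((∑' e, Complex.exp (-((σ : ℂ) + t * Complex.I) * Λ e))
      * Complex.exp (((σ : ℂ) + t * Complex.I) * X) / ((σ : ℂ) + t * Complex.I) ^ 2) :=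
    fun t => (hasSum_exp_line hs t X).div_const _
  have hmain := hasSum_integral_of_summable_integral_norm hFi hsn
  have hI : ∀ e, ∫ t, F e t = ((2 * Real.pi * max (X - Λ e) 0 : ℝ) : ℂ) :=
    fun e => integral_exp_div_line_sq hσ _
  simp_rw [hI, (hpt _).tsum_eq] at hmain
  constructor
  · have hc : Continuous fun t : ℝ => ∑' e, Complex.exp (-((σ : ℂ) + t * Complex.I) * Λ e) := by
      refine continuous_tsum (fun e => by fun_prop) hs fun e t => ?_
      rw [Complex.norm_exp]
      simp
    refine ((integrable_inv_sq_add_sq hσ).const_mul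
      (∑' e, Real.exp (σ * X) * Real.exp (-σ * Λ e))).mono' ?_ (Eventually.of_forall fun t => ?_)
    · exact Continuous.aestronglyMeasurable ((hc.mul (by fun_prop)).div ((continuous_line σ).pow 2)
        fun t => pow_ne_zero 2 (line_ne_zero hσ t))
    · rw [← (hpt t).tsum_eq, ← tsum_mul_right]
      refine tsum_of_norm_bounded ((hs.mul_left _).mul_right _).hasSum fun e => (hFn e t).le
  · refine hmain.unique ?_
    rw [Complex.hasSum_ofReal]
    exact (summable_ramp hσ hs X).hasSum.mul_left _

/-- Difference quotient of the previous formula between X and X + h. The sign of h is left free: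
positive h gives an upper bound for the count and negative h a lower bound. -/
theorem integral_dirichlet_mul_kernel [Countable E] (hσ : 0 < σ)
    (hs : Summable fun e => Real.exp (-σ * Λ e)) (X h : ℝ) :
    Integrable (fun t : ℝ => (∑' e, Complex.exp (-((σ : ℂ) + t * Complex.I) * Λ e))
      * Complex.exp (((σ : ℂ) + t * Complex.I) * X)
      * ((Complex.exp (((σ : ℂ) + t * Complex.I) * h) - 1) / (h * ((σ : ℂ) + t * Complex.I) ^ 2))) ∧
    ∫ t : ℝ, (∑' e, Complex.exp (-((σ : ℂ) + t * Complex.I) * Λ e))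
      * Complex.exp (((σ : ℂ) + t * Complex.I) * X)
      * ((Complex.exp (((σ : ℂ) + t * Complex.I) * h) - 1) / (h * ((σ : ℂ) + t * Complex.I) ^ 2))
      = ((2 * Real.pi * ((∑' e, (max (X + h - Λ e) 0 - max (X - Λ e) 0)) / h) : ℝ) : ℂ) := by
  obtain ⟨i1, e1⟩ := integral_dirichlet_div_line_sq hσ hs (X + h)
  obtain ⟨i2, e2⟩ := integral_dirichlet_div_line_sq hσ hs X
  have hpt : (fun t : ℝ => (∑' e, Complex.exp (-((σ : ℂ) + t * Complex.I) * Λ e))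
      * Complex.exp (((σ : ℂ) + t * Complex.I) * X)
      * ((Complex.exp (((σ : ℂ) + t * Complex.I) * h) - 1) / (h * ((σ : ℂ) + t * Complex.I) ^ 2)))
      = fun t : ℝ => (1 / h : ℂ) * ((∑' e, Complex.exp (-((σ : ℂ) + t * Complex.I) * Λ e))
        * Complex.exp (((σ : ℂ) + t * Complex.I) * (X + h : ℝ)) / ((σ : ℂ) + t * Complex.I) ^ 2
        - (∑' e, Complex.exp (-((σ : ℂ) + t * Complex.I) * Λ e))
        * Complex.exp (((σ : ℂ) + t * Complex.I) * X) / ((σ : ℂ) + t * Complex.I) ^ 2) := by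
    ext t
    have h5 : Complex.exp (((σ : ℂ) + t * Complex.I) * ((X + h : ℝ) : ℂ))
        = Complex.exp (((σ : ℂ) + t * Complex.I) * X) * Complex.exp (((σ : ℂ) + t * Complex.I) * h) := by
      rw [← Complex.exp_add]
      congr 1
      push_cast
      ring
    rw [h5]
    generalize ((σ : ℂ) + t * Complex.I) ^ 2 = q
    ring
  rw [hpt, (summable_ramp hσ hs (X + h)).tsum_sub (summable_ramp hσ hs X)]
  refine ⟨(i1.sub i2).const_mul _, ?_⟩
  rw [integral_const_mul, integral_sub i1 i2, e1, e2]
  push_cast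
  ring

theorem ncard_eq_tsum (hσ : 0 < σ) (hs : Summable fun e => Real.exp (-σ * Λ e)) (X : ℝ) :
    HasSum (fun e => if Λ e ≤ X then (1 : ℝ) else 0) ({e | Λ e ≤ X}.ncard : ℝ) := by
  have hf := finite_setOf_le hσ hs X
  have : HasSum (fun e => if Λ e ≤ X then (1 : ℝ) else 0)
      (∑ e ∈ hf.toFinset, if Λ e ≤ X then (1 : ℝ) else 0) :=
    hasSum_sum_of_ne_finset_zero fun e he => by simpa using he
  convert this using 1
  rw [Set.ncard_eq_toFinset_card _ hf, Finset.sum_congr rfl (g := fun _ => (1 : ℝ))]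
  · simp
  · intro e he
    simp only [Set.Finite.mem_toFinset, Set.mem_ofPred_eq] at he
    simp [he]

/-- For h > 0 the difference quotient of the ramp is 1 on [0, ∞) and nonnegative elsewhere, so it
majorizes the step function. -/
theorem ncard_le_tsum_div (hσ : 0 < σ) (hs : Summable fun e => Real.exp (-σ * Λ e)) (X : ℝ)
    {h : ℝ} (hh : 0 < h) :
    ({e | Λ e ≤ X}.ncard : ℝ) ≤ (∑' e, (max (X + h - Λ e) 0 - max (X - Λ e) 0)) / h := by
  rw [← tsum_div_const, ← (ncard_eq_tsum hσ hs X).tsum_eq]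
  refine Summable.tsum_le_tsum ?_ (ncard_eq_tsum hσ hs X).summable
    (((summable_ramp hσ hs (X + h)).sub (summable_ramp hσ hs X)).div_const _)
  · intro e
    rw [le_div_iff₀ hh]
    split_ifs with he
    · rw [max_eq_left (by linarith), max_eq_left (by linarith)]
      linarith
    · rw [max_eq_right (by linarith : X - Λ e ≤ 0)]
      simp

/-- For h < 0 the difference quotient of the ramp vanishes on (-∞, 0] and never exceeds 1, so it
minorizes the step function. -/
theorem tsum_div_le_ncard (hσ : 0 < σ) (hs : Summable fun e => Real.exp (-σ * Λ e)) (X : ℝ)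
    {h : ℝ} (hh : h < 0) :
    (∑' e, (max (X + h - Λ e) 0 - max (X - Λ e) 0)) / h ≤ ({e | Λ e ≤ X}.ncard : ℝ) := by
  rw [← tsum_div_const, ← (ncard_eq_tsum hσ hs X).tsum_eq]
  refine Summable.tsum_le_tsum ?_ ?_ (ncard_eq_tsum hσ hs X).summable
  · intro e
    rw [div_le_iff_of_neg hh]
    split_ifs with he
    · rw [max_eq_left (by linarith : 0 ≤ X - Λ e)]
      linarith [le_max_left (X + h - Λ e) 0]
    · rw [max_eq_right (by linarith), max_eq_right (by linarith)]
      simp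
  · exact ((summable_ramp hσ hs (X + h)).sub (summable_ramp hσ hs X)).div_const _

end Perron

/-! ### The sector and the Bose function. -/

/-- The closed convex cone `|Im z| ≤ Re z / 2` without its apex. -/
def sector : Set ℂ := {z | 0 < z.re ∧ |z.im| ≤ z.re / 2}

theorem mem_sector {z : ℂ} : z ∈ sector ↔ 0 < z.re ∧ |z.im| ≤ z.re / 2 := Iff.rfl

theorem smul_mem_sector {z : ℂ} (hz : z ∈ sector) {c : ℝ} (hc : 0 < c) : z * c ∈ sector := by
  rw [mem_sector] at *
  simp only [Complex.mul_re, Complex.ofReal_re, Complex.ofReal_im, mul_zero, sub_zero,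
    Complex.mul_im, zero_add, abs_mul, abs_of_pos hc]
  constructor
  · exact mul_pos hz.1 hc
  · nlinarith [hz.2]

theorem convex_sector : Convex ℝ sector := by
  intro z hz w hw a b ha hb hab
  rw [mem_sector] at *
  simp only [Complex.add_re, Complex.real_smul, Complex.mul_re, Complex.ofReal_re,
    Complex.ofReal_im, zero_mul, sub_zero, Complex.add_im, Complex.mul_im, add_zero]
  constructor
  · rcases eq_or_lt_of_le ha with h | h
    · rw [← h] at hab ⊢
      have : b = 1 := by linarith
      rw [this]
      linarith [hw.1]
    · have := mul_pos h hz.1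
      have := mul_nonneg hb hw.1.le
      linarith
  · have h1 := abs_le.1 hz.2
    have h2 := abs_le.1 hw.2
    rw [abs_le]
    constructor <;> nlinarith

theorem norm_le_of_mem_sector {z : ℂ} (hz : z ∈ sector) : ‖z‖ ≤ 3 / 2 * z.re := by
  have := Complex.norm_le_abs_re_add_abs_im z
  rw [abs_of_pos hz.1] at this
  linarith [hz.2]

theorem re_le_norm_exp_sub_one {z : ℂ} : Real.exp z.re - 1 ≤ ‖Complex.exp z - 1‖ := by
  have := norm_sub_norm_le (Complex.exp z) 1
  rwa [Complex.norm_exp, norm_one] at this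

theorem exp_sub_one_pos {x : ℝ} (hx : 0 < x) : 0 < Real.exp x - 1 := by
  linarith [Real.add_one_lt_exp hx.ne']

theorem exp_sub_one_ne_zero {z : ℂ} (hz : 0 < z.re) : Complex.exp z - 1 ≠ 0 := fun h => by
  have := re_le_norm_exp_sub_one (z := z)
  rw [h, norm_zero] at this
  linarith [exp_sub_one_pos hz]

/-- The Bose function `z / (e ^ z - 1)`. -/
noncomputable def bose (z : ℂ) : ℂ := z / (Complex.exp z - 1)

/-- Factoring out e^(x/2) keeps both the linear behaviour at 0 and exponential decay at infinity;
the bounds on `bose` and on its second derivative use both. -/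
theorem exp_half_mul_le {x : ℝ} (hx : 0 < x) :
    (x / 2 + x ^ 2 / 8) * Real.exp (x / 2) ≤ Real.exp x - 1 := by
  have h1 := Real.quadratic_le_exp_of_nonneg (x := x / 2) (by linarith)
  have h2 : Real.exp x = Real.exp (x / 2) * Real.exp (x / 2) := by
    rw [← Real.exp_add]; ring_nf
  rw [h2]
  nlinarith [Real.exp_pos (x / 2)]

theorem norm_bose_le_exp {z : ℂ} (hz : 0 < z.re) :
    ‖bose z‖ ≤ ‖z‖ / z.re * (2 * Real.exp (-(z.re / 2))) := by
  rw [bose, norm_div]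
  have h1 := exp_half_mul_le hz
  have h2 : z.re / 2 * Real.exp (z.re / 2) ≤ ‖Complex.exp z - 1‖ := by
    refine le_trans ?_ (h1.trans re_le_norm_exp_sub_one)
    have := Real.exp_pos (z.re / 2)
    nlinarith [sq_nonneg z.re]
  calc ‖z‖ / ‖Complex.exp z - 1‖ ≤ ‖z‖ / (z.re / 2 * Real.exp (z.re / 2)) := by gcongr
    _ = _ := by
      rw [Real.exp_neg]
      field_simp

theorem norm_bose_sub_one_le {z : ℂ} (hz : z ∈ sector) : ‖bose z - 1‖ ≤ 4 * ‖z‖ := by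
  have hx := hz.1
  have hn := norm_le_of_mem_sector hz
  have h0 := exp_sub_one_ne_zero hx
  have h1 : z.re ≤ ‖Complex.exp z - 1‖ :=
    le_trans (by linarith [Real.add_one_le_exp z.re]) re_le_norm_exp_sub_one
  rcases le_or_gt ‖z‖ 1 with h | h
  · have h2 : bose z - 1 = -(Complex.exp z - 1 - z) / (Complex.exp z - 1) := by
      rw [bose]
      field_simp
      ring
    rw [h2, norm_div, norm_neg, div_le_iff₀ (by linarith)]
    have h3 := Complex.norm_exp_sub_one_sub_id_le h
    nlinarith [norm_nonneg z]
  · have h2 : ‖bose z‖ ≤ 3 / 2 := by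
      rw [bose, norm_div, div_le_iff₀ (by linarith)]
      linarith
    have := norm_sub_le (bose z) 1
    rw [norm_one] at this
    linarith

/-- The derivative of the Bose function. -/
noncomputable def boseDeriv (z : ℂ) : ℂ :=
  -(z * Complex.exp z - Complex.exp z + 1) / (Complex.exp z - 1) ^ 2

/-- The second derivative of the Bose function. -/
noncomputable def boseDeriv₂ (z : ℂ) : ℂ :=
  Complex.exp z * (z * Complex.exp z - 2 * Complex.exp z + z + 2) / (Complex.exp z - 1) ^ 3

theorem hasDerivAt_bose {z : ℂ} (hz : 0 < z.re) : HasDerivAt bose (boseDeriv z) z := by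
  have h0 := exp_sub_one_ne_zero hz
  have h := (hasDerivAt_id z).div ((Complex.hasDerivAt_exp z).sub_const 1) h0
  refine h.congr_deriv ?_
  rw [boseDeriv]
  simp only [id]
  field_simp
  ring

theorem hasDerivAt_boseDeriv {z : ℂ} (hz : 0 < z.re) :
    HasDerivAt boseDeriv (boseDeriv₂ z) z := by
  have h0 := exp_sub_one_ne_zero hz
  have he := Complex.hasDerivAt_exp z
  have h := ((((hasDerivAt_id z).mul he).sub he).add_const 1).neg.div ((he.sub_const 1).pow 2)
    (pow_ne_zero 2 h0)
  refine h.congr_deriv ?_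
  rw [boseDeriv₂]
  simp only [id, Pi.neg_apply, Pi.mul_apply, Pi.sub_apply, Pi.pow_apply]
  field_simp
  ring

/-- The numerators of the derivatives of `bose` vanish at 0 to order two and three. As z^k times
integrals of this type (`sq_mul_integral`, `cube_mul_integral`) they can be bounded without losing
the cancellation. -/
theorem norm_integral_mul_exp_le {f : ℝ → ℝ} {c : ℝ} (hf : ∀ w ∈ Set.Icc (0 : ℝ) 1, |f w| ≤ c)
    {z : ℂ} (hz : 0 < z.re) :
    ‖∫ w in (0 : ℝ)..1, (f w : ℂ) * Complex.exp (z * w)‖ ≤ c * ((Real.exp z.re - 1) / z.re) := by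
  have hx := hz.ne'
  have hI : ∫ w in (0 : ℝ)..1, c * Real.exp (z.re * w) = c * ((Real.exp z.re - 1) / z.re) := by
    rw [intervalIntegral.integral_const_mul]
    congr 1
    rw [intervalIntegral.integral_comp_mul_left (fun y => Real.exp y) hx, integral_exp]
    simp
    ring
  rw [← hI]
  refine intervalIntegral.norm_integral_le_of_norm_le zero_le_one (Eventually.of_forall fun w hw => ?_)
    (Continuous.intervalIntegrable (by fun_prop) _ _)
  rw [norm_mul, Complex.norm_exp, Complex.norm_real, Real.norm_eq_abs]
  simp only [Complex.mul_re, Complex.ofReal_re, Complex.ofReal_im, mul_zero, sub_zero]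
  exact mul_le_mul_of_nonneg_right (hf w ⟨hw.1.le, hw.2⟩) (Real.exp_pos _).le

theorem sq_mul_integral (z : ℂ) (hz : z ≠ 0) :
    z ^ 2 * ∫ w in (0 : ℝ)..1, ((w : ℝ) : ℂ) * Complex.exp (z * w)
      = z * Complex.exp z - Complex.exp z + 1 := by
  have hd : ∀ w : ℝ, HasDerivAt (fun w : ℝ => ((w : ℂ) * z⁻¹ - z⁻¹ ^ 2) * Complex.exp (z * w))
      ((w : ℂ) * Complex.exp (z * w)) w := by
    intro w
    have h1 : HasDerivAt (fun t : ℝ => (t : ℂ)) 1 w := Complex.ofRealCLM.hasDerivAt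
    refine (((h1.mul_const z⁻¹).sub_const (z⁻¹ ^ 2)).mul (h1.const_mul z).cexp).congr_deriv ?_
    field_simp
    ring
  rw [intervalIntegral.integral_eq_sub_of_hasDerivAt (fun w _ => hd w)
    (Continuous.intervalIntegrable (by fun_prop) _ _)]
  simp
  field_simp

theorem cube_mul_integral (z : ℂ) (hz : z ≠ 0) :
    z ^ 3 * ∫ w in (0 : ℝ)..1, ((w * (1 - w) : ℝ) : ℂ) * Complex.exp (z * w)
      = z * Complex.exp z - 2 * Complex.exp z + z + 2 := by
  have hd : ∀ w : ℝ, HasDerivAt (fun w : ℝ => (((w : ℂ) - (w : ℂ) ^ 2) * z⁻¹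
      - (1 - 2 * (w : ℂ)) * z⁻¹ ^ 2 - 2 * z⁻¹ ^ 3) * Complex.exp (z * w))
      (((w * (1 - w) : ℝ) : ℂ) * Complex.exp (z * w)) w := by
    intro w
    have h1 : HasDerivAt (fun t : ℝ => (t : ℂ)) 1 w := Complex.ofRealCLM.hasDerivAt
    have h2 := (((h1.sub (h1.pow 2)).mul_const z⁻¹).sub
      (((h1.const_mul 2).const_sub 1).mul_const (z⁻¹ ^ 2))).sub_const (2 * z⁻¹ ^ 3)
    refine (h2.mul (h1.const_mul z).cexp).congr_deriv ?_
    simp only [Pi.sub_apply, Pi.pow_apply]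
    push_cast
    field_simp
    ring
  rw [intervalIntegral.integral_eq_sub_of_hasDerivAt (fun w _ => hd w)
    (Continuous.intervalIntegrable (by fun_prop) _ _)]
  simp
  field_simp
  ring

theorem norm_boseDeriv_le {z : ℂ} (hz : z ∈ sector) : ‖boseDeriv z‖ ≤ 3 := by
  have hx := hz.1
  have hn := norm_le_of_mem_sector hz
  have hz0 : z ≠ 0 := fun h => by simp [h] at hx
  have hp := exp_sub_one_pos hx
  have h1 : z.re ≤ Real.exp z.re - 1 := by linarith [Real.add_one_le_exp z.re]
  have h2 := norm_integral_mul_exp_le (f := fun w => w) (c := 1)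
    (fun w hw => by rw [abs_of_nonneg hw.1]; exact hw.2) hx
  rw [boseDeriv, ← sq_mul_integral z hz0, norm_div, norm_neg, norm_mul, norm_pow, norm_pow]
  calc _ ≤ (3 / 2 * z.re) ^ 2 * (1 * ((Real.exp z.re - 1) / z.re)) / (Real.exp z.re - 1) ^ 2 := by
        gcongr
        exact re_le_norm_exp_sub_one
    _ = 9 / 4 * (z.re / (Real.exp z.re - 1)) := by
        field_simp
        ring
    _ ≤ 9 / 4 * 1 := by
        gcongr
        rwa [div_le_one hp]
    _ ≤ 3 := by norm_num

/-- The decay in Re z matters: it makes the midpoint errors summable along a progression. -/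
theorem norm_boseDeriv₂_le {z : ℂ} (hz : z ∈ sector) : ‖boseDeriv₂ z‖ ≤ 64 / (1 + z.re ^ 2) := by
  have hx := hz.1
  have hn := norm_le_of_mem_sector hz
  have hz0 : z ≠ 0 := fun h => by simp [h] at hx
  have hp := exp_sub_one_pos hx
  have h2 := norm_integral_mul_exp_le (f := fun w => w * (1 - w)) (c := 1 / 4)
    (fun w hw => by
      rw [abs_of_nonneg (mul_nonneg hw.1 (by linarith [hw.2]))]
      nlinarith [sq_nonneg (w - 1 / 2)]) hx
  rw [boseDeriv₂, ← cube_mul_integral z hz0, norm_div, norm_mul, norm_mul, norm_pow, norm_pow,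
    Complex.norm_exp]
  set x := z.re
  have h3 := exp_half_mul_le hx
  have he : Real.exp x = Real.exp (x / 2) ^ 2 := by rw [← Real.exp_nat_mul]; congr 1; push_cast; ring
  calc _ ≤ Real.exp x * ((3 / 2 * x) ^ 3 * (1 / 4 * ((Real.exp x - 1) / x))) / (Real.exp x - 1) ^ 3 := by
        gcongr
        exact re_le_norm_exp_sub_one
    _ = 27 / 32 * x ^ 2 * Real.exp x / (Real.exp x - 1) ^ 2 := by
        field_simp
        ring
    _ ≤ 27 / 32 * x ^ 2 * Real.exp x / ((x / 2 + x ^ 2 / 8) * Real.exp (x / 2)) ^ 2 := by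
        gcongr
    _ = 27 / 8 / (1 + x / 4) ^ 2 := by
        rw [he]
        have := Real.exp_pos (x / 2)
        field_simp
        ring
    _ ≤ _ := by
        rw [div_le_div_iff₀ (by positivity) (by positivity)]
        nlinarith [sq_nonneg x]

theorem norm_bose_sub_le {z w : ℂ} (hz : z ∈ sector) (hw : w ∈ sector) :
    ‖bose z - bose w‖ ≤ 3 * ‖z - w‖ :=
  convex_sector.norm_image_sub_le_of_norm_hasDerivWithin_le
    (fun _ hu => (hasDerivAt_bose hu.1).hasDerivWithinAt) (fun _ hu => norm_boseDeriv_le hu) hw hz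

/-! ### The primitive of the Bose function and the midpoint rule. -/

/-- The primitive of `-bose` on the right half plane that vanishes at infinity. -/
noncomputable def bosePrim (z : ℂ) : ℂ :=
  ∑' k : ℕ, (z / (k + 1) + 1 / (k + 1) ^ 2) * Complex.exp (-((k + 1) * z))

theorem norm_exp_neg_succ_mul (k : ℕ) (z : ℂ) :
    ‖Complex.exp (-(((k : ℂ) + 1) * z))‖ = Real.exp (-z.re) * Real.exp (-z.re) ^ k := by
  rw [Complex.norm_exp, ← Real.exp_nat_mul, ← Real.exp_add]
  congr 1
  simp
  ring

theorem norm_succ (k : ℕ) : ‖((k : ℂ) + 1)‖ = (k : ℝ) + 1 := by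
  have : ((k : ℂ) + 1) = (((k : ℝ) + 1 : ℝ) : ℂ) := by push_cast; ring
  rw [this, Complex.norm_real, Real.norm_of_nonneg (by positivity)]

theorem norm_bosePrim_term_le (k : ℕ) (z : ℂ) :
    ‖(z / (k + 1) + 1 / (k + 1) ^ 2) * Complex.exp (-((k + 1) * z))‖
      ≤ (‖z‖ + 1) * (Real.exp (-z.re) * Real.exp (-z.re) ^ k) := by
  rw [norm_mul, norm_exp_neg_succ_mul]
  gcongr
  refine (norm_add_le _ _).trans ?_
  rw [norm_div, norm_div, norm_pow, norm_succ, norm_one]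
  have h1 : (1 : ℝ) ≤ (k : ℝ) + 1 := by linarith [(Nat.cast_nonneg k : (0 : ℝ) ≤ k)]
  gcongr
  · exact div_le_self (norm_nonneg _) h1
  · rw [div_le_one (by positivity)]
    nlinarith

theorem summable_bosePrim_bound {x : ℝ} (hx : 0 < x) (c : ℝ) :
    HasSum (fun k : ℕ => c * (Real.exp (-x) * Real.exp (-x) ^ k)) (c / (Real.exp x - 1)) := by
  have h := (((hasSum_geometric_of_lt_one (Real.exp_pos (-x)).le
    (Real.exp_lt_one_iff.2 (by linarith))).mul_left (Real.exp (-x))).mul_left c)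
  have h1 := exp_sub_one_pos hx
  have h2 : 1 - Real.exp (-x) ≠ 0 := by
    have := Real.exp_lt_one_iff.2 (by linarith : -x < 0)
    linarith
  have h3 : Real.exp (-x) * (Real.exp x - 1) = 1 - Real.exp (-x) := by
    rw [mul_sub, ← Real.exp_add]
    simp
  have h4 : c / (Real.exp x - 1) = c * (Real.exp (-x) * (1 - Real.exp (-x))⁻¹) := by
    rw [← h3] at h2 ⊢
    have := (Real.exp_pos (-x)).ne'
    field_simp
  rw [h4]
  exact h

theorem norm_bosePrim_le {z : ℂ} (hz : 0 < z.re) :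
    ‖bosePrim z‖ ≤ (‖z‖ + 1) / (Real.exp z.re - 1) :=
  tsum_of_norm_bounded (summable_bosePrim_bound hz _) fun k => norm_bosePrim_term_le k z

theorem hasDerivAt_bosePrim {z : ℂ} (hz : 0 < z.re) : HasDerivAt bosePrim (-bose z) z := by
  set a := z.re / 2 with ha
  have hapos : 0 < a := by positivity
  set S : Set ℂ := Metric.ball z 1 ∩ {w | a < w.re} with hS
  have hopen : IsOpen S := Metric.isOpen_ball.inter (isOpen_lt continuous_const Complex.continuous_re)
  have hconv : Convex ℝ S := (convex_ball z 1).inter (convex_halfSpace_re_gt a)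
  have hzS : z ∈ S := ⟨Metric.mem_ball_self one_pos, by simp [ha]; linarith⟩
  have h := hasDerivAt_tsum_of_isPreconnected
    (g := fun (k : ℕ) (w : ℂ) => (w / (k + 1) + 1 / (k + 1) ^ 2) * Complex.exp (-((k + 1) * w)))
    (g' := fun (k : ℕ) (w : ℂ) => -w * Complex.exp (-((k + 1) * w)))
    (u := fun k : ℕ => (‖z‖ + 1) * (Real.exp (-a) * Real.exp (-a) ^ k))
    (summable_bosePrim_bound hapos _).summable hopen hconv.isPreconnected ?_ ?_ hzS ?_ hzS
  · refine h.congr_deriv ?_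
    have h1 : ‖Complex.exp (-z)‖ < 1 := by
      rw [Complex.norm_exp]
      exact Real.exp_lt_one_iff.2 (by simpa using hz)
    have h2 : ∀ k : ℕ, -z * Complex.exp (-((k + 1) * z)) = (-z * Complex.exp (-z)) * Complex.exp (-z) ^ k := by
      intro k
      rw [← Complex.exp_nat_mul, mul_assoc, ← Complex.exp_add]
      congr 2
      ring
    simp_rw [h2]
    rw [tsum_mul_left, tsum_geometric_of_norm_lt_one h1, bose]
    have h0 := exp_sub_one_ne_zero hz
    have h3 : 1 - Complex.exp (-z) ≠ 0 := by
      intro h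
      rw [← sub_eq_zero.1 h, norm_one] at h1
      exact lt_irrefl _ h1
    rw [Complex.exp_neg] at *
    have := Complex.exp_ne_zero z
    field_simp
  · intro k w _
    have hk : (k : ℂ) + 1 ≠ 0 := Nat.cast_add_one_ne_zero k
    have h1 := hasDerivAt_id w
    refine (((h1.div_const ((k : ℂ) + 1)).add_const (1 / ((k : ℂ) + 1) ^ 2)).mul
      ((h1.const_mul ((k : ℂ) + 1)).neg.cexp)).congr_deriv ?_
    simp only [id, Pi.neg_apply]
    field_simp
    ring
  · intro k w hw
    rw [norm_mul, norm_exp_neg_succ_mul, norm_neg]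
    have h1 : ‖w‖ ≤ ‖z‖ + 1 := by
      have := norm_sub_norm_le w z
      have h2 : ‖w - z‖ < 1 := by simpa [dist_eq_norm] using hw.1
      linarith
    have h2 : Real.exp (-w.re) ≤ Real.exp (-a) := Real.exp_le_exp.2 (by linarith [hw.2.out])
    gcongr
  · exact Summable.of_norm_bounded (summable_bosePrim_bound hz _).summable fun k => norm_bosePrim_term_le k z

/-- The midpoint rule for the Bose function. -/
theorem norm_bosePrim_midpoint_le {z δ : ℂ} (hδ : δ ∈ sector) (hz : z - δ ∈ sector) :
    ‖bosePrim (z - δ) - bosePrim (z + δ) - 2 * δ * bose z‖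
      ≤ 128 * ‖δ‖ ^ 3 / (1 + (z.re - δ.re) ^ 2) := by
  set B := 64 / (1 + (z.re - δ.re) ^ 2) with hB
  have hB0 : 0 ≤ B := by positivity
  set S : Set ℂ := sector ∩ {w | z.re - δ.re ≤ w.re} with hS
  have hconv : Convex ℝ S := convex_sector.inter (convex_halfSpace_re_ge _)
  have hpos : 0 < z.re - δ.re := by simpa using hz.1
  have h0S : z - δ ∈ S := ⟨hz, by simp⟩
  have h1S : z + δ ∈ S := by
    refine ⟨?_, by simp; linarith [hδ.1]⟩
    have h2 : z + δ = z - δ + δ + δ := by ring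
    have hadd : ∀ u ∈ sector, ∀ v ∈ sector, u + v ∈ sector := by
      intro u hu v hv
      rw [mem_sector] at *
      simp only [Complex.add_re, Complex.add_im]
      exact ⟨by linarith [hu.1, hv.1], (abs_add_le _ _).trans (by linarith [hu.2, hv.2])⟩
    rw [h2]
    exact hadd _ (hadd _ hz _ hδ) _ hδ
  have hseg : ∀ τ ∈ Set.Icc (-1 : ℝ) 1, z + τ * δ ∈ S := by
    intro τ hτ
    have h3 := hconv h0S h1S (a := (1 - τ) / 2) (b := (1 + τ) / 2) (by linarith [hτ.2])
      (by linarith [hτ.1]) (by ring)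
    convert h3 using 1
    simp only [Complex.real_smul]
    push_cast
    ring
  have hseg' : ∀ τ ∈ Set.Icc (0 : ℝ) 1, z - τ * δ ∈ S := by
    intro τ hτ
    have := hseg (-τ) ⟨by linarith [hτ.2], by linarith [hτ.1]⟩
    convert this using 1
    push_cast
    ring
  have hseg0 : ∀ τ ∈ Set.Icc (0 : ℝ) 1, z + τ * δ ∈ S := fun τ hτ => hseg τ ⟨by linarith [hτ.1], hτ.2⟩
  have hlip : ∀ u ∈ S, ∀ v ∈ S, ‖boseDeriv v - boseDeriv u‖ ≤ B * ‖v - u‖ := fun u hu v hv =>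
    hconv.norm_image_sub_le_of_norm_hasDerivWithin_le
      (fun w hw => (hasDerivAt_boseDeriv hw.1.1).hasDerivWithinAt)
      (fun w hw => (norm_boseDeriv₂_le hw.1).trans (by
        have : z.re - δ.re ≤ w.re := hw.2
        rw [hB]
        gcongr)) hu hv
  have hd1 : ∀ τ : ℝ, HasDerivAt (fun τ : ℝ => z + τ * δ) δ τ := fun τ => by
    have h1 : HasDerivAt (fun t : ℝ => (t : ℂ)) 1 τ := Complex.ofRealCLM.hasDerivAt
    simpa using (h1.mul_const δ).const_add z
  have hd2 : ∀ τ : ℝ, HasDerivAt (fun τ : ℝ => z - τ * δ) (-δ) τ := fun τ => by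
    have h1 : HasDerivAt (fun t : ℝ => (t : ℂ)) 1 τ := Complex.ofRealCLM.hasDerivAt
    simpa using (h1.mul_const δ).const_sub z
  -- The symmetric second difference of `bose` is of order |δ|², by the Lipschitz bound for its
  -- derivative. Integrating it once more in τ gives the cubic midpoint error.
  have hψ : ∀ τ ∈ Set.Icc (0 : ℝ) 1, ‖bose (z + τ * δ) + bose (z - τ * δ) - 2 * bose z‖ ≤ 2 * B * ‖δ‖ ^ 2 := by
    intro τ hτ
    have h := norm_image_sub_le_of_norm_deriv_le_segment'
      (f := fun τ : ℝ => bose (z + τ * δ) + bose (z - τ * δ))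
      (f' := fun τ : ℝ => boseDeriv (z + τ * δ) * δ + boseDeriv (z - τ * δ) * (-δ))
      (a := 0) (b := 1) (C := 2 * B * ‖δ‖ ^ 2)
      (fun t ht => by
        have := (((hasDerivAt_bose (hseg0 t ht).1.1).comp t (hd1 t)).add
          ((hasDerivAt_bose (hseg' t ht).1.1).comp t (hd2 t)))
        exact this.hasDerivWithinAt)
      (fun t ht => by
        have ht' : t ∈ Set.Icc (0 : ℝ) 1 := ⟨ht.1, ht.2.le⟩
        have h1 := hlip _ (hseg' t ht') _ (hseg0 t ht')
        have h2 : boseDeriv (z + t * δ) * δ + boseDeriv (z - t * δ) * (-δ)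
          = (boseDeriv (z + t * δ) - boseDeriv (z - t * δ)) * δ := by ring
        have h3 : z + t * δ - (z - t * δ) = 2 * t * δ := by ring
        rw [h3, norm_mul, norm_mul, Complex.norm_real, Real.norm_of_nonneg ht.1] at h1
        rw [h2, norm_mul]
        norm_num at h1
        calc _ ≤ B * (2 * t * ‖δ‖) * ‖δ‖ := by gcongr
          _ ≤ B * (2 * 1 * ‖δ‖) * ‖δ‖ := by gcongr; exact ht'.2
          _ = _ := by ring) τ hτ
    simp only [Complex.ofReal_zero, zero_mul, add_zero, sub_zero] at h
    rw [two_mul]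
    refine h.trans ?_
    have := mul_nonneg (mul_nonneg zero_le_two hB0) (sq_nonneg ‖δ‖)
    nlinarith [hτ.2]
  have h := norm_image_sub_le_of_norm_deriv_le_segment_01'
    (f := fun τ : ℝ => bosePrim (z - τ * δ) - bosePrim (z + τ * δ) - τ * (2 * δ * bose z))
    (f' := fun τ : ℝ => (-bose (z - τ * δ)) * (-δ) - (-bose (z + τ * δ)) * δ - 1 * (2 * δ * bose z))
    (C := 2 * B * ‖δ‖ ^ 3)
    (fun t ht => by
      have h1 : HasDerivAt (fun t : ℝ => (t : ℂ)) 1 t := Complex.ofRealCLM.hasDerivAt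
      have := (((hasDerivAt_bosePrim (hseg' t ht).1.1).comp t (hd2 t)).sub
        ((hasDerivAt_bosePrim (hseg0 t ht).1.1).comp t (hd1 t))).sub
        (h1.mul_const (2 * δ * bose z))
      exact this.hasDerivWithinAt)
    (fun t ht => by
      have ht' : t ∈ Set.Icc (0 : ℝ) 1 := ⟨ht.1, ht.2.le⟩
      have h2 : (-bose (z - t * δ)) * (-δ) - (-bose (z + t * δ)) * δ - 1 * (2 * δ * bose z)
        = (bose (z + t * δ) + bose (z - t * δ) - 2 * bose z) * δ := by ring
      rw [h2, norm_mul]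
      calc _ ≤ 2 * B * ‖δ‖ ^ 2 * ‖δ‖ := by gcongr; exact hψ t ht'
        _ = _ := by ring)
  simp only [Complex.ofReal_zero, zero_mul, add_zero, sub_zero, Complex.ofReal_one, one_mul, sub_self] at h
  refine h.trans (le_of_eq ?_)
  rw [hB]
  ring

theorem hasSum_inv_succ_sq : HasSum (fun k : ℕ => 1 / ((k : ℝ) + 1) ^ 2) (Real.pi ^ 2 / 6) := by
  have h := hasSum_zeta_two
  rw [← hasSum_nat_add_iff' 1] at h
  simpa using h

/-- Term by term the series tends to that of ζ(2). In the sector |z| is comparable to Re z, so y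
e^(-y) ≤ 1 supplies the dominating series. -/
theorem tendsto_bosePrim_zero {z : ℂ} (hz : z ∈ sector) :
    Tendsto (fun τ : ℝ => bosePrim (τ * z)) (𝓝[>] 0) (𝓝 ((Real.pi ^ 2 / 6 : ℝ) : ℂ)) := by
  have hlim : ((Real.pi ^ 2 / 6 : ℝ) : ℂ) = ∑' k : ℕ, (1 / ((k : ℂ) + 1) ^ 2) := by
    rw [← hasSum_inv_succ_sq.tsum_eq, Complex.ofReal_tsum]
    push_cast
    rfl
  rw [hlim]
  unfold bosePrim
  refine tendsto_tsum_of_dominated_convergence (bound := fun k : ℕ => 5 / 2 * (1 / ((k : ℝ) + 1) ^ 2))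
    (hasSum_inv_succ_sq.summable.mul_left _) (fun k => ?_) ?_
  · have hc : Continuous fun τ : ℝ => (τ * z / ((k : ℂ) + 1) + 1 / ((k : ℂ) + 1) ^ 2)
        * Complex.exp (-((k + 1) * (τ * z))) := by fun_prop
    have := hc.tendsto 0
    simp only [Complex.ofReal_zero, zero_mul, zero_div, zero_add, mul_zero, neg_zero,
      Complex.exp_zero, mul_one] at this
    exact this.mono_left nhdsWithin_le_nhds
  · filter_upwards [self_mem_nhdsWithin] with τ hτ k
    have hτ : 0 < τ := hτ
    have hk : (0 : ℝ) < (k : ℝ) + 1 := by positivity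
    have hy : 0 < τ * z.re := mul_pos hτ hz.1
    have hexp : ‖Complex.exp (-(((k : ℂ) + 1) * (τ * z)))‖ = Real.exp (-((k + 1) * (τ * z.re))) := by
      rw [Complex.norm_exp]
      simp
    have h1 : (k + 1) * (τ * z.re) * Real.exp (-((k + 1) * (τ * z.re))) ≤ 1 := by
      rw [Real.exp_neg, ← div_eq_mul_inv, div_le_one (Real.exp_pos _)]
      linarith [Real.add_one_le_exp ((k + 1) * (τ * z.re))]
    have h2 : Real.exp (-((k + 1) * (τ * z.re))) ≤ 1 :=
      Real.exp_le_one_iff.2 (by have := mul_pos hk hy; linarith)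
    rw [norm_mul, hexp]
    have h3 : ‖(τ * z / ((k : ℂ) + 1) + 1 / ((k : ℂ) + 1) ^ 2)‖
        ≤ τ * (3 / 2 * z.re) / (k + 1) + 1 / ((k : ℝ) + 1) ^ 2 := by
      refine (norm_add_le _ _).trans ?_
      rw [norm_div, norm_div, norm_pow, norm_succ, norm_one, norm_mul, Complex.norm_real,
        Real.norm_of_nonneg hτ.le]
      gcongr
      exact norm_le_of_mem_sector hz
    calc _ ≤ (τ * (3 / 2 * z.re) / (k + 1) + 1 / ((k : ℝ) + 1) ^ 2) * Real.exp (-((k + 1) * (τ * z.re))) := by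
          gcongr
      _ = (3 / 2 * ((k + 1) * (τ * z.re) * Real.exp (-((k + 1) * (τ * z.re))))
            + Real.exp (-((k + 1) * (τ * z.re)))) * (1 / ((k : ℝ) + 1) ^ 2) := by
          field_simp
      _ ≤ (3 / 2 * 1 + 1) * (1 / ((k : ℝ) + 1) ^ 2) := by gcongr
      _ = _ := by norm_num

/-- The function `bosePrim z + z` has derivative 1 - `bose z`, which is O(|z|). Integrate along the
ray from τz to z and let τ tend to 0. -/
theorem norm_bosePrim_sub_le {z : ℂ} (hz : z ∈ sector) :
    ‖bosePrim z - ((Real.pi ^ 2 / 6 : ℝ) - z)‖ ≤ 4 * ‖z‖ ^ 2 := by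
  have key : ∀ τ ∈ Set.Ioc (0 : ℝ) 1, ‖(bosePrim z + z) - (bosePrim (τ * z) + τ * z)‖ ≤ 4 * ‖z‖ ^ 2 := by
    intro τ hτ
    have hmem : ∀ t ∈ Set.Icc τ 1, (t : ℂ) * z ∈ sector := fun t ht => by
      rw [mul_comm]
      exact smul_mem_sector hz (hτ.1.trans_le ht.1)
    have hd : ∀ t ∈ Set.Icc τ 1, HasDerivWithinAt (fun t : ℝ => bosePrim (t * z) + t * z)
        (-bose (t * z) * z + z) (Set.Icc τ 1) t := fun t ht => by
      have h1 : HasDerivAt (fun t : ℝ => (t : ℂ)) 1 t := Complex.ofRealCLM.hasDerivAt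
      have h2 : HasDerivAt (fun t : ℝ => (t : ℂ) * z) z t := by simpa using h1.mul_const z
      have h3 := ((hasDerivAt_bosePrim (hmem t ht).1).comp t h2).add h2
      exact h3.hasDerivWithinAt
    have h := norm_image_sub_le_of_norm_deriv_le_segment' (C := 4 * ‖z‖ ^ 2) hd (fun t ht => by
      have h4 := norm_bose_sub_one_le (hmem t ⟨ht.1, ht.2.le⟩)
      have h5 : -bose (t * z) * z + z = -((bose (t * z) - 1) * z) := by ring
      rw [h5, norm_neg, norm_mul]
      rw [norm_mul, Complex.norm_real, Real.norm_of_nonneg (hτ.1.le.trans ht.1)] at h4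
      calc _ ≤ 4 * (1 * ‖z‖) * ‖z‖ := by
            refine mul_le_mul_of_nonneg_right (h4.trans ?_) (norm_nonneg _)
            gcongr
            exact ht.2.le
        _ = _ := by ring) 1 ⟨hτ.2, le_rfl⟩
    simp only [Complex.ofReal_one, one_mul] at h
    refine h.trans ?_
    have := mul_nonneg zero_le_four (sq_nonneg ‖z‖) 
    nlinarith [hτ.1]
  have hlim : Tendsto (fun τ : ℝ => ‖(bosePrim z + z) - (bosePrim (τ * z) + τ * z)‖) (𝓝[>] 0)
      (𝓝 ‖(bosePrim z + z) - (((Real.pi ^ 2 / 6 : ℝ) : ℂ) + 0)‖) := by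
    refine (tendsto_const_nhds.sub ((tendsto_bosePrim_zero hz).add ?_)).norm
    have hc : Continuous fun τ : ℝ => (τ : ℂ) * z := by fun_prop
    have := hc.tendsto 0
    simp only [Complex.ofReal_zero, zero_mul] at this
    exact this.mono_left nhdsWithin_le_nhds
  have h := le_of_tendsto hlim (by
    filter_upwards [Ioc_mem_nhdsGT (zero_lt_one' ℝ)] with τ hτ using key τ hτ)
  have h6 : bosePrim z - (((Real.pi ^ 2 / 6 : ℝ) : ℂ) - z)
      = (bosePrim z + z) - (((Real.pi ^ 2 / 6 : ℝ) : ℂ) + 0) := by ring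
  rw [h6]
  exact h

theorem tendsto_bosePrim_atTop {z δ : ℂ} (hz : z ∈ sector) (hδ : δ ∈ sector) :
    Tendsto (fun n : ℕ => bosePrim (z + n * δ)) atTop (𝓝 0) := by
  have hmem : ∀ n : ℕ, z + n * δ ∈ sector := fun n => by
    rw [mem_sector] at *
    have hn : (0 : ℝ) ≤ n := Nat.cast_nonneg n
    simp only [Complex.add_re, Complex.add_im, Complex.mul_re, Complex.mul_im, Complex.natCast_re,
      Complex.natCast_im, zero_mul, sub_zero, add_zero]
    refine ⟨by have := mul_nonneg hn hδ.1.le; linarith [hz.1], (abs_add_le _ _).trans ?_⟩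
    rw [abs_mul, abs_of_nonneg hn]
    nlinarith [hz.2, hδ.2]
  have hre : Tendsto (fun n : ℕ => (z + n * δ).re) atTop atTop := by
    simp only [Complex.add_re, Complex.mul_re, Complex.natCast_re, Complex.natCast_im, zero_mul, sub_zero]
    exact tendsto_atTop_add_const_left _ _ (tendsto_natCast_atTop_atTop.atTop_mul_const hδ.1)
  have hreal : Tendsto (fun x : ℝ => (3 / 2 * x + 1) * Real.exp (-x) * 2) atTop (𝓝 0) := by
    have h1 := tendsto_rpow_mul_exp_neg_mul_atTop_nhds_zero 1 1 one_pos
    have h0 := tendsto_rpow_mul_exp_neg_mul_atTop_nhds_zero 0 1 one_pos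
    have := ((h1.const_mul (3 / 2)).add h0).mul_const 2
    simp only [mul_zero, add_zero, zero_mul] at this
    refine this.congr fun x => ?_
    rw [Real.rpow_one, Real.rpow_zero, neg_one_mul]
    ring
  refine squeeze_zero_norm' ?_ (hreal.comp hre)
  filter_upwards [hre.eventually_ge_atTop 1] with n hn
  refine (norm_bosePrim_le (hmem n).1).trans ?_
  have h1 := norm_le_of_mem_sector (hmem n)
  have h2 := exp_sub_one_pos (hmem n).1
  have h3 : 2 ≤ Real.exp (z + n * δ).re := by linarith [Real.add_one_le_exp (z + n * δ).re]
  rw [Function.comp_apply, div_le_iff₀ h2]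
  set x := (z + n * δ).re
  have h4 : Real.exp (-x) * Real.exp x = 1 := by rw [← Real.exp_add]; simp
  have h5 : 0 < Real.exp (-x) := Real.exp_pos _
  have h6 : 1 ≤ Real.exp (-x) * 2 * (Real.exp x - 1) := by nlinarith
  nlinarith

/-- Telescoping bound for a Riemann sum of `1 / (1 + y ^ 2)`. -/
theorem sum_inv_one_add_sq_le {a : ℝ} (ha : 0 < a) (n : ℕ) :
    ∑ i ∈ Finset.range n, 1 / (1 + (a * i) ^ 2) ≤ 2 * (1 + a) / a := by
  have hpos : ∀ i : ℕ, (0 : ℝ) < 1 + a * i := fun i => by positivity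
  have h : ∀ i ∈ Finset.range n, 1 / (1 + (a * i) ^ 2)
      -- The right side equals 2(1 + a) / ((1 + ai)(1 + a(i + 1))), comparable to the term on the
      -- left.
      ≤ 2 * (1 + a) / a * (1 / (1 + a * i)) - 2 * (1 + a) / a * (1 / (1 + a * (i + 1 : ℕ))) := by
    intro i _
    have h1 := hpos i
    have h2 := hpos (i + 1)
    have h3 : 2 * (1 + a) / a * (1 / (1 + a * i)) - 2 * (1 + a) / a * (1 / (1 + a * (i + 1 : ℕ)))
        = 2 * (1 + a) / ((1 + a * i) * (1 + a * (i + 1 : ℕ))) := by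
      push_cast at *
      field_simp
      ring
    rw [h3, div_le_div_iff₀ (by positivity) (by positivity)]
    push_cast
    have hi : 0 ≤ a * i := by positivity
    nlinarith [sq_nonneg (1 - a * i), mul_nonneg ha.le hi, mul_nonneg ha.le (sq_nonneg (1 - a * i)),
      mul_nonneg ha.le (sq_nonneg (a * i))]
  refine (Finset.sum_le_sum h).trans ?_
  rw [Finset.sum_range_sub' (fun i : ℕ => 2 * (1 + a) / a * (1 / (1 + a * i)))]
  have := hpos n
  simp only [Nat.cast_zero, mul_zero, add_zero, div_one, mul_one]
  have : 0 ≤ 2 * (1 + a) / a * (1 / (1 + a * n)) := by positivity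
  linarith

/-! ### Sums of the Bose function along an almost arithmetic progression. -/

section AlmostArithmetic

variable {ν : ℕ → ℝ} {L b : ℝ}

theorem summable_exp_neg_mul (hL : 0 < L) (hs : Summable fun j : ℕ => |ν j - (j * L + b)|)
    {a : ℝ} (ha : 0 < a) : Summable fun j => Real.exp (-a * ν j) := by
  set M := ∑' j : ℕ, |ν j - (j * L + b)| with hM
  have hle : ∀ j : ℕ, j * L + b - M ≤ ν j := fun j => by
    have h1 : |ν j - (j * L + b)| ≤ M := hs.le_tsum j fun _ _ => abs_nonneg _
    linarith [(abs_le.1 h1).1]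
  have hr : Real.exp (-a * L) < 1 := Real.exp_lt_one_iff.2 (by have := mul_pos ha hL; linarith)
  refine Summable.of_nonneg_of_le (fun _ => (Real.exp_pos _).le) (fun j => ?_)
    ((summable_geometric_of_lt_one (Real.exp_pos _).le hr).mul_left (Real.exp (-a * (b - M))))
  rw [← Real.exp_nat_mul, ← Real.exp_add, Real.exp_le_exp]
  have := mul_le_mul_of_nonneg_left (hle j) ha.le
  linarith

theorem summable_norm_bose (hpos : ∀ j, 0 < ν j) (hL : 0 < L)
    (hs : Summable fun j : ℕ => |ν j - (j * L + b)|) {s : ℂ} (h0 : 0 < s.re) :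
    Summable fun j => ‖bose (s * ν j)‖ := by
  refine Summable.of_nonneg_of_le (fun _ => norm_nonneg _) (fun j => ?_)
    ((summable_exp_neg_mul hL hs (half_pos h0)).mul_left (‖s‖ / s.re * 2))
  have hre : (s * ν j).re = s.re * ν j := by simp
  have hp := mul_pos h0 (hpos j)
  refine (norm_bose_le_exp (by rw [hre]; exact hp)).trans (le_of_eq ?_)
  rw [hre, norm_mul, Complex.norm_real, Real.norm_of_nonneg (hpos j).le]
  have := (hpos j).ne'
  have : -(s.re * ν j / 2) = -(s.re / 2) * ν j := by ring
  rw [this]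
  field_simp

/-- The points y + L/2 + iL are midpoints of consecutive cells of width L starting at y, so the sum
telescopes up to midpoint errors. Each error carries |s|³, and the decay in i leaves a total of
order |s|³ / Re s, that is |s|². -/
theorem norm_bosePrim_sub_tsum_le (hL : 0 < L) {y : ℝ} (hy : 0 < y) {s : ℂ} (hs : s ∈ sector)
    (hre : s.re ≤ 1) (hsum : Summable fun i : ℕ => bose (s * (y + L / 2 + i * L : ℝ))) :
    ‖bosePrim (s * y) - s * L * ∑' i : ℕ, bose (s * (y + L / 2 + i * L : ℝ))‖
      ≤ 48 * L ^ 2 * (1 + L) * ‖s‖ ^ 2 := by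
  have hσ := hs.1
  have hn := norm_le_of_mem_sector hs
  have hδ : s * (L / 2 : ℝ) ∈ sector := smul_mem_sector hs (half_pos hL)
  have hyi : ∀ i : ℕ, 0 < y + i * L := fun i => by positivity
  have hpart : ∀ n : ℕ, ‖bosePrim (s * y) - bosePrim (s * y + n * (s * L))
      - s * L * ∑ i ∈ Finset.range n, bose (s * (y + L / 2 + i * L : ℝ))‖
      ≤ 48 * L ^ 2 * (1 + L) * ‖s‖ ^ 2 := by
    intro n
    have htel : bosePrim (s * y) - bosePrim (s * y + n * (s * L))
        = ∑ i ∈ Finset.range n, (bosePrim (s * (y + i * L : ℝ)) - bosePrim (s * (y + (i + 1 : ℕ) * L : ℝ))) := by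
      rw [Finset.sum_range_sub' (fun i : ℕ => bosePrim (s * (y + i * L : ℝ)))]
      congr 2
      · simp
      · push_cast; ring
    rw [htel, Finset.mul_sum, ← Finset.sum_sub_distrib]
    have hterm : ∀ i ∈ Finset.range n, ‖bosePrim (s * (y + i * L : ℝ)) - bosePrim (s * (y + (i + 1 : ℕ) * L : ℝ))
        - s * L * bose (s * (y + L / 2 + i * L : ℝ))‖
        ≤ 128 * (‖s‖ * (L / 2)) ^ 3 * (1 / (1 + (s.re * L * i) ^ 2)) := by
      intro i _
      have h1 : s * (y + i * L : ℝ) = s * (y + L / 2 + i * L : ℝ) - s * (L / 2 : ℝ) := by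
        push_cast; ring
      have h2 : s * (y + (i + 1 : ℕ) * L : ℝ) = s * (y + L / 2 + i * L : ℝ) + s * (L / 2 : ℝ) := by
        push_cast; ring
      have h3 : s * L = 2 * (s * (L / 2 : ℝ)) := by push_cast; ring
      have hm : s * (y + L / 2 + i * L : ℝ) - s * (L / 2 : ℝ) ∈ sector := by
        rw [← h1]
        exact smul_mem_sector hs (hyi i)
      rw [h1, h2, h3]
      refine (norm_bosePrim_midpoint_le hδ hm).trans ?_
      rw [norm_mul, Complex.norm_real, Real.norm_of_nonneg (half_pos hL).le, mul_one_div]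
      have h4 : (s * (y + L / 2 + i * L : ℝ)).re - (s * (L / 2 : ℝ)).re = s.re * y + s.re * L * i := by
        rw [Complex.re_mul_ofReal, Complex.re_mul_ofReal]
        ring
      rw [h4]
      have h5 : 0 ≤ s.re * L * i := by positivity
      have h6 : 0 ≤ s.re * y := by positivity
      gcongr
      linarith
    refine (norm_sum_le_of_le _ hterm).trans ?_
    rw [← Finset.mul_sum]
    calc _ ≤ 128 * (‖s‖ * (L / 2)) ^ 3 * (2 * (1 + s.re * L) / (s.re * L)) := by
          gcongr
          exact sum_inv_one_add_sq_le (mul_pos hσ hL) n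
      _ ≤ 128 * (‖s‖ * (L / 2)) ^ 3 * (2 * (1 + 1 * L) / (2 / 3 * ‖s‖ * L)) := by
          have : 0 < ‖s‖ := norm_pos_iff.2 fun h => by simp [h] at hσ
          gcongr
          linarith
      _ = _ := by
          have : 0 < ‖s‖ := norm_pos_iff.2 fun h => by simp [h] at hσ
          field_simp
          ring
  have hlim : Tendsto (fun n : ℕ => ‖bosePrim (s * y) - bosePrim (s * y + n * (s * L))
      - s * L * ∑ i ∈ Finset.range n, bose (s * (y + L / 2 + i * L : ℝ))‖) atTop
      (𝓝 ‖bosePrim (s * y) - 0 - s * L * ∑' i : ℕ, bose (s * (y + L / 2 + i * L : ℝ))‖) :=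
    ((tendsto_const_nhds.sub (tendsto_bosePrim_atTop (smul_mem_sector hs hy) (smul_mem_sector hs hL))).sub
      (hsum.hasSum.tendsto_sum_nat.const_mul _)).norm
  have := le_of_tendsto hlim (Eventually.of_forall hpart)
  rwa [sub_zero] at this

/-- Euler-Maclaurin asymptotics for `∑ bose (s ν_j)` along an almost arithmetic progression. -/
theorem exists_norm_tsum_bose_sub_le (hpos : ∀ j, 0 < ν j) (hL : 0 < L)
    (hs : Summable fun j : ℕ => |ν j - (j * L + b)|) :
    ∃ C : ℝ, ∀ s ∈ sector, s.re ≤ 1 →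
      ‖∑' j, bose (s * ν j) - ((Real.pi ^ 2 / (6 * L) : ℝ) / s + (1 / 2 - b / L : ℝ))‖ ≤ C * ‖s‖ := by
  -- Drop enough initial terms for the left end y of the first cell to be positive. Each dropped
  -- term is 1 + O(|s|), so together they contribute j₀, and j₀ - y/L = 1/2 - b/L.
  obtain ⟨j₀, hj₀⟩ := exists_nat_gt ((L / 2 - b) / L)
  rw [div_lt_iff₀ hL] at hj₀
  set y := j₀ * L + b - L / 2 with hy
  have hy0 : 0 < y := by rw [hy]; linarith
  have hx : ∀ i : ℕ, ((i + j₀ : ℕ) * L + b : ℝ) = y + L / 2 + i * L := fun i => by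
    rw [hy]; push_cast; ring
  have hsj := (summable_nat_add_iff j₀).2 hs
  set M := ∑' i : ℕ, |ν (i + j₀) - ((i + j₀ : ℕ) * L + b)| with hM
  refine ⟨∑ j ∈ Finset.range j₀, 4 * ν j + 3 * M + (4 * y ^ 2 / L + 48 * L * (1 + L)), ?_⟩
  intro s hsec hre
  have hs0 : s ≠ 0 := fun h => by have := hsec.1; simp [h] at this
  have hsn : 0 < ‖s‖ := norm_pos_iff.2 hs0
  have hsum : Summable fun j => bose (s * ν j) := (summable_norm_bose hpos hL hs hsec.1).of_norm
  have hsum2 : Summable fun i => bose (s * ν (i + j₀)) := (summable_nat_add_iff j₀).2 hsum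
  -- The Lipschitz bound for `bose` turns the summable deviation of ν from the progression into an
  -- error O(|s|).
  have hdiff : ∀ i : ℕ, ‖bose (s * ν (i + j₀)) - bose (s * (y + L / 2 + i * L : ℝ))‖
      ≤ 3 * ‖s‖ * |ν (i + j₀) - ((i + j₀ : ℕ) * L + b)| := by
    intro i
    have hp : 0 < y + L / 2 + i * L := by positivity
    refine (norm_bose_sub_le (smul_mem_sector hsec (hpos _)) (smul_mem_sector hsec hp)).trans ?_
    rw [← mul_sub, norm_mul, ← Complex.ofReal_sub, Complex.norm_real, Real.norm_eq_abs, hx, mul_assoc]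
  have hsumd : Summable fun i : ℕ => bose (s * ν (i + j₀)) - bose (s * (y + L / 2 + i * L : ℝ)) :=
    Summable.of_norm_bounded (hsj.mul_left _) hdiff
  have hsum3 : Summable fun i : ℕ => bose (s * (y + L / 2 + i * L : ℝ)) := by
    refine (hsum2.sub hsumd).congr fun i => ?_
    ring
  have e1 : ‖∑ j ∈ Finset.range j₀, bose (s * ν j) - j₀‖ ≤ (∑ j ∈ Finset.range j₀, 4 * ν j) * ‖s‖ := by
    have h1 : ∑ j ∈ Finset.range j₀, bose (s * ν j) - j₀ = ∑ j ∈ Finset.range j₀, (bose (s * ν j) - 1) := by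
      rw [Finset.sum_sub_distrib]; simp
    rw [h1, Finset.sum_mul]
    refine norm_sum_le_of_le _ fun j _ => ?_
    refine (norm_bose_sub_one_le (smul_mem_sector hsec (hpos j))).trans (le_of_eq ?_)
    rw [norm_mul, Complex.norm_real, Real.norm_of_nonneg (hpos j).le]
    ring
  have e2 : ‖∑' i, bose (s * ν (i + j₀)) - ∑' i : ℕ, bose (s * (y + L / 2 + i * L : ℝ))‖ ≤ 3 * M * ‖s‖ := by
    rw [← hsum2.tsum_sub hsum3]
    have := tsum_of_norm_bounded (hsj.hasSum.mul_left (3 * ‖s‖)) hdiff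
    refine this.trans (le_of_eq ?_)
    ring
  have e3 := norm_bosePrim_sub_tsum_le hL hy0 hsec hre hsum3
  have e4 := norm_bosePrim_sub_le (smul_mem_sector hsec hy0)
  set T := ∑' i : ℕ, bose (s * (y + L / 2 + i * L : ℝ)) with hT
  have e5 : ‖T - ((Real.pi ^ 2 / (6 * L) : ℝ) / s - (y / L : ℝ))‖
      ≤ (4 * y ^ 2 / L + 48 * L * (1 + L)) * ‖s‖ := by
    have hLc : (L : ℂ) ≠ 0 := by exact_mod_cast hL.ne'
    have h1 : T - ((Real.pi ^ 2 / (6 * L) : ℝ) / s - (y / L : ℝ))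
        = ((bosePrim (s * y) - ((Real.pi ^ 2 / 6 : ℝ) - s * y)) - (bosePrim (s * y) - s * L * T)) / (s * L) := by
      push_cast
      field_simp
      ring
    rw [h1, norm_div, norm_mul, Complex.norm_real, Real.norm_of_nonneg hL.le, div_le_iff₀ (by positivity)]
    refine (norm_sub_le _ _).trans ((add_le_add e4 e3).trans (le_of_eq ?_))
    rw [norm_mul, Complex.norm_real, Real.norm_of_nonneg hy0.le]
    field_simp
  have hsplit := hsum.sum_add_tsum_nat_add j₀
  have hβ : ((1 / 2 - b / L : ℝ) : ℂ) = j₀ - (y / L : ℝ) := by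
    have : (1 / 2 - b / L : ℝ) = j₀ - y / L := by
      rw [hy]; field_simp; ring
    rw [this]; push_cast; ring
  rw [← hsplit, hβ]
  have hfin : ∑ j ∈ Finset.range j₀, bose (s * ν j) + ∑' i, bose (s * ν (i + j₀))
      - ((Real.pi ^ 2 / (6 * L) : ℝ) / s + ((j₀ : ℂ) - (y / L : ℝ)))
      = (∑ j ∈ Finset.range j₀, bose (s * ν j) - j₀) + (∑' i, bose (s * ν (i + j₀)) - T)
        + (T - ((Real.pi ^ 2 / (6 * L) : ℝ) / s - (y / L : ℝ))) := by ring
  rw [hfin]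
  refine (norm_add₃_le).trans ?_
  linarith

end AlmostArithmetic

/-! ### The logarithm of the zeta function near the origin. -/

section LogZeta

variable {ν : ℕ → ℝ} {L b : ℝ}

/-- The logarithm of the zeta function `∏ (1 - e ^ (-s ν_j))⁻¹`. -/
noncomputable def logZeta (ν : ℕ → ℝ) (s : ℂ) : ℂ :=
  ∑' j, -Complex.log (1 - Complex.exp (-s * ν j))

theorem norm_exp_neg_mul (s : ℂ) (x : ℝ) : ‖Complex.exp (-s * x)‖ = Real.exp (-s.re * x) := by
  rw [Complex.norm_exp]
  simp

theorem norm_exp_neg_mul_lt_one {s : ℂ} (hs : 0 < s.re) {x : ℝ} (hx : 0 < x) :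
    ‖Complex.exp (-s * x)‖ < 1 := by
  rw [norm_exp_neg_mul, Real.exp_lt_one_iff]
  have := mul_pos hs hx
  linarith

/-- This is where the Bose function enters: x / (e^(sx) - 1) = `bose (s * x) / s`. -/
theorem hasDerivAt_logZeta_term {s : ℂ} (hs : 0 < s.re) {x : ℝ} (hx : 0 < x) :
    HasDerivAt (fun s : ℂ => -Complex.log (1 - Complex.exp (-s * x))) (-(bose (s * x) / s)) s := by
  have h1 : HasDerivAt (fun s : ℂ => 1 - Complex.exp (-s * x)) (-(Complex.exp (-s * x) * (-1 * x))) s :=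
    (((hasDerivAt_id s).neg.mul_const (x : ℂ)).cexp).const_sub 1
  have hmem : 1 - Complex.exp (-s * x) ∈ Complex.slitPlane := by
    rw [sub_eq_add_neg]
    exact Complex.mem_slitPlane_of_norm_lt_one (by rw [norm_neg]; exact norm_exp_neg_mul_lt_one hs hx)
  refine (h1.clog hmem).neg.congr_deriv ?_
  have hs0 : s ≠ 0 := fun h => by simp [h] at hs
  have h2 : Complex.exp (s * x) - 1 ≠ 0 := exp_sub_one_ne_zero (by simpa using mul_pos hs hx)
  have h3 := Complex.slitPlane_ne_zero hmem
  have h4 : Complex.exp (-s * x) * (Complex.exp (s * x) - 1) = 1 - Complex.exp (-s * x) := by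
    rw [mul_sub, ← Complex.exp_add]
    simp
  have h5 := Complex.exp_ne_zero (-s * x)
  rw [bose, ← h4]
  field_simp

theorem hasDerivAt_logZeta (hpos : ∀ j, 0 < ν j) (hL : 0 < L)
    (hs : Summable fun j : ℕ => |ν j - (j * L + b)|) {s : ℂ} (h0 : 0 < s.re) :
    HasDerivAt (logZeta ν) (-((∑' j, bose (s * ν j)) / s)) s := by
  set a := s.re / 2 with ha
  have hapos : 0 < a := half_pos h0
  have hz : s ∈ {w : ℂ | a < w.re} := by
    change a < s.re
    rw [ha]; linarith
  have hsum : Summable fun j => ‖Complex.exp (-s * ν j)‖ := by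
    simp_rw [norm_exp_neg_mul]
    exact summable_exp_neg_mul hL hs h0
  have h := hasDerivAt_tsum_of_isPreconnected
    (g := fun (j : ℕ) (w : ℂ) => -Complex.log (1 - Complex.exp (-w * ν j)))
    (g' := fun (j : ℕ) (w : ℂ) => -(bose (w * ν j) / w))
    (u := fun j : ℕ => 2 / a * Real.exp (-(a / 2) * ν j))
    ((summable_exp_neg_mul hL hs (half_pos hapos)).mul_left _)
    (isOpen_lt continuous_const Complex.continuous_re) (convex_halfSpace_re_gt a).isPreconnected
    (fun j w hw => hasDerivAt_logZeta_term (hapos.trans hw) (hpos j)) ?_ hz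
    (summable_log_one_sub _ hsum) hz
  · refine h.congr_deriv ?_
    rw [tsum_neg, tsum_div_const]
  · intro j w hw
    have hw : a < w.re := hw
    have hw0 : 0 < w.re := hapos.trans hw
    have hre : (w * ν j).re = w.re * ν j := by simp
    have hwn : 0 < ‖w‖ := norm_pos_iff.2 fun h => by simp [h] at hw0
    have hb := norm_bose_le_exp (z := w * ν j) (by rw [hre]; exact mul_pos hw0 (hpos j))
    rw [hre, norm_mul, Complex.norm_real, Real.norm_of_nonneg (hpos j).le] at hb
    rw [norm_neg, norm_div, div_le_iff₀ hwn]
    refine hb.trans ?_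
    have hν := hpos j
    calc ‖w‖ * ν j / (w.re * ν j) * (2 * Real.exp (-(w.re * ν j / 2)))
        = 2 / w.re * Real.exp (-(w.re * ν j / 2)) * ‖w‖ := by field_simp
      _ ≤ 2 / a * Real.exp (-(a / 2) * ν j) * ‖w‖ := by
          gcongr
          nlinarith

/-- The behaviour of the logarithm of the zeta function near the origin. -/
theorem exists_norm_logZeta_sub_le (hpos : ∀ j, 0 < ν j) (hL : 0 < L)
    (hs : Summable fun j : ℕ => |ν j - (j * L + b)|) :
    ∃ (c₀ : ℂ) (C : ℝ), 0 ≤ C ∧ ∀ s ∈ sector, s.re ≤ 1 →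
      ‖logZeta ν s - ((Real.pi ^ 2 / (6 * L) : ℝ) / s - (1 / 2 - b / L : ℝ) * Complex.log s + c₀)‖
        ≤ C * ‖s‖ := by
  obtain ⟨C, hC⟩ := exists_norm_tsum_bose_sub_le hpos hL hs
  set A : ℝ := Real.pi ^ 2 / (6 * L)
  set β : ℝ := 1 / 2 - b / L
  set r : ℂ → ℂ := fun s => logZeta ν s - (A / s - β * Complex.log s) with hr
  set S : Set ℂ := sector ∩ {z | z.re ≤ 1} with hS
  have hconv : Convex ℝ S := convex_sector.inter (convex_halfSpace_re_le 1)
  -- The logarithmic derivative is known up to O(1), so the remainder `r` is Lipschitz on a convex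
  -- set whose closure contains 0. Its limit at 0 is the constant c₀, and the Lipschitz bound
  -- against that limit gives O(|s|).
  have hlip : ∀ s ∈ S, ∀ w ∈ S, ‖r w - r s‖ ≤ C * ‖w - s‖ := by
    intro s hs' w hw
    refine hconv.norm_image_sub_le_of_norm_hasDerivWithin_le
      (f' := fun s => -((∑' j, bose (s * ν j) - (A / s + β)) / s)) (fun z hz => ?_) (fun z hz => ?_) hs' hw
    · have hz0 : z ≠ 0 := fun h => by have := hz.1.1; simp [h] at this
      have hslit : z ∈ Complex.slitPlane := Or.inl hz.1.1
      have h1 := (hasDerivAt_logZeta hpos hL hs hz.1.1).sub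
        (((hasDerivAt_inv hz0).const_mul (A : ℂ)).sub ((Complex.hasDerivAt_log hslit).const_mul (β : ℂ)))
      refine HasDerivAt.hasDerivWithinAt ?_
      refine h1.congr_deriv ?_
      field_simp
      ring
    · have hzn : 0 < ‖z‖ := norm_pos_iff.2 fun h => by have := hz.1.1; simp [h] at this
      rw [norm_neg, norm_div, div_le_iff₀ hzn]
      exact hC z hz.1 hz.2
  have hC0 : 0 ≤ C := by
    have h1 : (1 : ℂ) ∈ sector := by simp [mem_sector]
    have := (norm_nonneg _).trans (hC 1 h1 (by simp))
    simpa using this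
  set u : ℕ → ℂ := fun n => ((1 / ((n : ℝ) + 1) : ℝ) : ℂ) with hu
  have huS : ∀ n, u n ∈ S := fun n => by
    refine ⟨?_, ?_⟩
    · rw [mem_sector, hu]
      simp only [Complex.ofReal_re, Complex.ofReal_im, abs_zero]
      constructor <;> positivity
    · change (u n).re ≤ 1
      rw [hu]
      simp only [Complex.ofReal_re]
      rw [div_le_one (by positivity)]
      linarith [(Nat.cast_nonneg n : (0 : ℝ) ≤ n)]
  have hu0 : Tendsto u atTop (𝓝 0) := by
    have := (Complex.continuous_ofReal.tendsto 0).comp (tendsto_one_div_add_atTop_nhds_zero_nat (𝕜 := ℝ))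
    rwa [Complex.ofReal_zero] at this
  have hcau : CauchySeq fun n => r (u n) := by
    have h1 := hu0.cauchySeq
    rw [Metric.cauchySeq_iff] at h1 ⊢
    intro ε hε
    obtain ⟨N, hN⟩ := h1 (ε / (C + 1)) (by positivity)
    refine ⟨N, fun m hm n hn => ?_⟩
    have h2 := hN m hm n hn
    rw [dist_eq_norm] at h2 ⊢
    rw [lt_div_iff₀ (by positivity)] at h2
    refine (hlip _ (huS n) _ (huS m)).trans_lt ?_
    nlinarith [norm_nonneg (u m - u n)]
  obtain ⟨c₀, hc₀⟩ := cauchySeq_tendsto_of_complete hcau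
  refine ⟨c₀, C, hC0, fun s hsec hre => ?_⟩
  have hlim : Tendsto (fun n => ‖r s - r (u n)‖) atTop (𝓝 ‖r s - c₀‖) :=
    (tendsto_const_nhds.sub hc₀).norm
  have hlim2 : Tendsto (fun n => C * ‖s - u n‖) atTop (𝓝 (C * ‖s - 0‖)) :=
    ((tendsto_const_nhds.sub hu0).norm).const_mul C
  have := le_of_tendsto_of_tendsto' hlim hlim2 fun n => hlip _ (huS n) s ⟨hsec, hre⟩
  rw [sub_zero] at this
  refine le_trans (le_of_eq ?_) this
  congr 1
  simp only [hr]
  ring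

/-- The Dirichlet series of the free monoid as an Euler product. -/
theorem hasSum_exp_neg_weight (hpos : ∀ j, 0 < ν j) (hL : 0 < L)
    (hs : Summable fun j : ℕ => |ν j - (j * L + b)|) {s : ℂ} (h0 : 0 < s.re) :
    HasSum (fun e : ℕ →₀ ℕ => Complex.exp (-s * (e.sum fun j k => k * ν j : ℝ)))
      (Complex.exp (logZeta ν s)) := by
  have hsum : Summable fun j => ‖Complex.exp (-s * ν j)‖ := by
    simp_rw [norm_exp_neg_mul]
    exact summable_exp_neg_mul hL hs h0
  refine (hasSum_monomialValue _ (fun j => norm_exp_neg_mul_lt_one h0 (hpos j)) hsum).congr_fun fun e => ?_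
  rw [monomialValue, Finsupp.prod, Finsupp.sum, Complex.ofReal_sum, Finset.mul_sum, Complex.exp_sum]
  refine Finset.prod_congr rfl fun j _ => ?_
  rw [← Complex.exp_nat_mul]
  congr 1
  push_cast
  ring

/-- Since |1 - w|² = (1 - q)² + 2(q - Re w), moving w off the positive real axis enlarges |1 - w| by
a factor controlled by q - Re w. It is put in exponential form so that factors multiply in an Euler
product. -/
theorem exp_div_four_le_norm_one_sub {w : ℂ} {q : ℝ} (hw : ‖w‖ = q) (hq : q < 1) :
    (1 - q) * Real.exp ((q - w.re) / 4) ≤ ‖1 - w‖ := by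
  have hq0 : 0 ≤ q := hw ▸ norm_nonneg w
  have hre : w.re ≤ q := hw ▸ Complex.re_le_norm w
  have hre' : -q ≤ w.re := by
    have := Complex.abs_re_le_norm w
    rw [hw] at this
    exact (abs_le.1 this).1
  set d := q - w.re with hd
  have hd0 : 0 ≤ d := by rw [hd]; linarith
  have hd2 : d ≤ 2 := by rw [hd]; linarith
  have hn : ‖1 - w‖ ^ 2 = (1 - q) ^ 2 + 2 * d := by
    rw [Complex.sq_norm, Complex.normSq_sub, ← Complex.sq_norm w, hw, hd]
    simp
    ring
  have hexp : Real.exp (d / 2) ≤ 1 + 2 * d := by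
    have h1 := convexOn_exp.2 (Set.mem_univ 0) (Set.mem_univ 1)
      (by linarith : 0 ≤ 1 - d / 2) (by linarith : 0 ≤ d / 2) (by ring)
    simp only [smul_eq_mul, mul_zero, mul_one, zero_add, Real.exp_zero] at h1
    have := Real.exp_one_lt_d9
    nlinarith
  have h4 : Real.exp (d / 4) ^ 2 = Real.exp (d / 2) := by
    rw [← Real.exp_nat_mul]; congr 1; push_cast; ring
  refine le_of_sq_le_sq ?_ (norm_nonneg _)
  rw [mul_pow, h4, hn]
  have h5 : (1 - q) ^ 2 ≤ 1 := by nlinarith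
  nlinarith [sq_nonneg (1 - q), mul_le_mul_of_nonneg_left hexp (sq_nonneg (1 - q))]

/-- Comparison of the zeta function with its value on the real axis. -/
theorem re_logZeta_le (hpos : ∀ j, 0 < ν j) (hL : 0 < L)
    (hs : Summable fun j : ℕ => |ν j - (j * L + b)|) {σ : ℝ} (h0 : 0 < σ) (t : ℝ) (J : Finset ℕ) :
    (logZeta ν (σ + t * Complex.I)).re ≤ (logZeta ν σ).re
      - ∑ j ∈ J, Real.exp (-σ * ν j) * (1 - Real.cos (t * ν j)) / 4 := by
  set s : ℂ := σ + t * Complex.I with hsdef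
  have hsre : s.re = σ := by simp [hsdef]
  have hsum : ∀ z : ℂ, z.re = σ → Summable fun j => -Complex.log (1 - Complex.exp (-z * ν j)) := by
    intro z hz
    refine summable_log_one_sub _ ?_
    simp_rw [norm_exp_neg_mul, hz]
    exact summable_exp_neg_mul hL hs h0
  have h1 := Complex.hasSum_re (hsum s hsre).hasSum
  have h2 := Complex.hasSum_re (hsum σ (by simp)).hasSum
  set d : ℕ → ℝ := fun j => Real.exp (-σ * ν j) * (1 - Real.cos (t * ν j)) / 4 with hd
  have hd0 : ∀ j, 0 ≤ d j := fun j => by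
    have := Real.cos_le_one (t * ν j)
    have := Real.exp_pos (-σ * ν j)
    simp only [hd]
    have : 0 ≤ 1 - Real.cos (t * ν j) := by linarith
    positivity
  have hterm : ∀ j, d j ≤ (-Complex.log (1 - Complex.exp (-(σ : ℂ) * ν j))).re
      - (-Complex.log (1 - Complex.exp (-s * ν j))).re := by
    intro j
    have hq1 : Real.exp (-σ * ν j) < 1 := by
      have := norm_exp_neg_mul_lt_one (s := (σ : ℂ)) (by simpa using h0) (hpos j)
      rwa [norm_exp_neg_mul, Complex.ofReal_re] at this
    have hqn : ‖Complex.exp (-s * ν j)‖ = Real.exp (-σ * ν j) := by rw [norm_exp_neg_mul, hsre]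
    have h3 := exp_div_four_le_norm_one_sub hqn hq1
    have hre : (Complex.exp (-s * ν j)).re = Real.exp (-σ * ν j) * Real.cos (t * ν j) := by
      rw [Complex.exp_re]
      simp [hsdef, Real.cos_neg]
    have h4 : ‖1 - Complex.exp (-(σ : ℂ) * ν j)‖ = 1 - Real.exp (-σ * ν j) := by
      have : 1 - Complex.exp (-(σ : ℂ) * ν j) = ((1 - Real.exp (-σ * ν j) : ℝ) : ℂ) := by push_cast; rfl
      rw [this, Complex.norm_real, Real.norm_of_nonneg (by linarith)]
    rw [Complex.neg_re, Complex.neg_re, Complex.log_re, Complex.log_re, h4]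
    rw [hre] at h3
    have hq : 0 < 1 - Real.exp (-σ * ν j) := by linarith
    have h5 := Real.log_le_log (mul_pos hq (Real.exp_pos _)) h3
    rw [Real.log_mul hq.ne' (Real.exp_pos _).ne', Real.log_exp] at h5
    simp only [hd]
    linarith
  have h6 := h2.sub h1
  have h7 := sum_le_hasSum J (fun j _ => (hd0 j).trans (hterm j)) h6
  have h8 := Finset.sum_le_sum fun j (_ : j ∈ J) => hterm j
  have h9 := h8.trans h7
  change _ ≤ (logZeta ν σ).re - (logZeta ν s).re at h9
  linarith

end LogZeta

/-! ### Decay of the zeta function off the real axis. -/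

section Tail

variable {ν : ℕ → ℝ} {L b : ℝ}

theorem exp_neg_le_two_div_sq {y : ℝ} (hy : 0 < y) : Real.exp (-y) ≤ 2 / y ^ 2 := by
  rw [Real.exp_neg, ← one_div, div_le_div_iff₀ (Real.exp_pos _) (by positivity)]
  have := Real.quadratic_le_exp_of_nonneg hy.le
  nlinarith

/-- For small `|t| ≥ σ / 2`, linearly many (in `1 / |t|`) of the `ν_j` contribute. -/
theorem exists_sum_one_sub_cos_ge (hL : 0 < L) (hs : Summable fun j : ℕ => |ν j - (j * L + b)|) :
    ∃ t₀ > 0, ∃ κ > 0, ∀ σ t : ℝ, 0 < σ → σ / 2 ≤ |t| → |t| ≤ t₀ → ∃ J : Finset ℕ,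
      κ / |t| ≤ ∑ j ∈ J, Real.exp (-σ * ν j) * (1 - Real.cos (t * ν j)) / 4 := by
  set M := ∑' j : ℕ, |ν j - (j * L + b)| with hM
  have hM0 : 0 ≤ M := tsum_nonneg fun _ => abs_nonneg _
  set K := |b| + M with hK
  have hK0 : 0 ≤ K := by positivity
  have hclose : ∀ j : ℕ, |ν j - j * L| ≤ K := fun j => by
    have h1 : |ν j - (j * L + b)| ≤ M := hs.le_tsum j fun _ _ => abs_nonneg _
    have h2 : ν j - j * L = (ν j - (j * L + b)) + b := by ring
    rw [h2, hK]
    linarith [abs_add_le (ν j - (j * L + b)) b]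
  set κ₀ : ℝ := Real.exp (-2) * (2 / Real.pi ^ 2 * (1 / 16) ^ 2) / 4 with hκ₀
  have hκ₀pos : 0 < κ₀ := by have := Real.pi_pos; positivity
  refine ⟨min (1 / (8 * L)) (1 / (16 * (K + 1))), by positivity, κ₀ / (8 * L), by positivity, ?_⟩
  intro σ t hσ hσt ht
  have htpos : 0 < |t| := by linarith
  have ht1 : |t| * (8 * L) ≤ 1 := by
    have := ht.trans (min_le_left _ _)
    rwa [le_div_iff₀ (by positivity)] at this
  have ht2 : |t| * (16 * (K + 1)) ≤ 1 := by
    have := ht.trans (min_le_right _ _)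
    rwa [le_div_iff₀ (by positivity)] at this
  -- For m ≤ j < 2m one has 1/16 ≤ |t| ν_j ≤ 1, so the cosine stays away from 1; and σ ≤ 2|t| gives
  -- σν_j ≤ 2. Each of these m terms is at least `κ₀`.
  set m := ⌊1 / (4 * L * |t|)⌋₊ with hm
  have hm1 : (m : ℝ) * (4 * L * |t|) ≤ 1 := by
    have := Nat.floor_le (a := 1 / (4 * L * |t|)) (by positivity)
    rwa [le_div_iff₀ (by positivity)] at this
  have hm2 : 1 < ((m : ℝ) + 1) * (4 * L * |t|) := by
    have := Nat.lt_floor_add_one (1 / (4 * L * |t|))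
    rwa [div_lt_iff₀ (by positivity)] at this
  have hm3 : 1 / 2 ≤ (m : ℝ) * (4 * L * |t|) := by linarith
  refine ⟨Finset.Ico m (2 * m), ?_⟩
  have hterm : ∀ j ∈ Finset.Ico m (2 * m), κ₀ ≤ Real.exp (-σ * ν j) * (1 - Real.cos (t * ν j)) / 4 := by
    intro j hj
    rw [Finset.mem_Ico] at hj
    have hj1 : (m : ℝ) ≤ j := by exact_mod_cast hj.1
    have hj2 : (j : ℝ) ≤ 2 * m := by exact_mod_cast hj.2.le
    have hc := abs_le.1 (hclose j)
    have hlo : 1 / 16 ≤ |t| * ν j := by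
      have h1 : |t| * (m * L - K) ≤ |t| * ν j := by
        refine mul_le_mul_of_nonneg_left ?_ htpos.le
        nlinarith
      linarith
    have hhi : |t| * ν j ≤ 1 := by
      have h1 : |t| * ν j ≤ |t| * (2 * m * L + K) := by
        refine mul_le_mul_of_nonneg_left ?_ htpos.le
        nlinarith
      linarith
    have hcos : Real.cos (t * ν j) ≤ 1 - 2 / Real.pi ^ 2 * (|t| * ν j) ^ 2 := by
      have h1 : |t| * ν j = |t * ν j| := by
        rw [abs_mul, abs_of_pos (a := ν j)]
        by_contra hneg
        nlinarith
      rw [h1, sq_abs]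
      refine Real.cos_le_one_sub_mul_cos_sq ?_
      rw [← h1]
      linarith [Real.pi_gt_three]
    have hexp : Real.exp (-2) ≤ Real.exp (-σ * ν j) := by
      rw [Real.exp_le_exp]
      have hν : 0 < ν j := by
        by_contra hneg
        nlinarith
      nlinarith
    rw [hκ₀]
    have hpi := Real.pi_pos
    have h5 : 2 / Real.pi ^ 2 * (1 / 16) ^ 2 ≤ 1 - Real.cos (t * ν j) := by
      have : 2 / Real.pi ^ 2 * (1 / 16) ^ 2 ≤ 2 / Real.pi ^ 2 * (|t| * ν j) ^ 2 := by gcongr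
      linarith
    gcongr
  have := Finset.card_nsmul_le_sum _ _ _ hterm
  rw [Nat.card_Ico, nsmul_eq_mul] at this
  refine le_trans ?_ this
  have hcard : ((2 * m - m : ℕ) : ℝ) = m := by congr 1; omega
  rw [hcard, div_div, div_le_iff₀ (by positivity)]
  nlinarith

/-- Decay of the zeta function away from the real axis. -/
theorem exists_norm_exp_logZeta_le (hpos : ∀ j, 0 < ν j) (hL : 0 < L)
    (hs : Summable fun j : ℕ => |ν j - (j * L + b)|) :
    ∃ C : ℝ, 0 ≤ C ∧ ∀ σ t : ℝ, 0 < σ → σ / 2 ≤ |t| →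
      Real.exp ((logZeta ν (σ + t * Complex.I)).re - (logZeta ν σ).re) ≤ C * (t ^ 2 / (1 + t ^ 2)) := by
  obtain ⟨t₀, ht₀, κ, hκ, h⟩ := exists_sum_one_sub_cos_ge hL hs
  -- The factor t² for small t is there to cancel the t² in the denominator of the Perron kernel,
  -- leaving the integrable 1/(1 + t²). For |t| > t₀ the trivial bound 1 suffices.
  refine ⟨max ((1 + t₀ ^ 2) / t₀ ^ 2) (2 / κ ^ 2 * (1 + t₀ ^ 2)), by positivity, ?_⟩
  intro σ t hσ hσt
  have htpos : 0 < |t| := by linarith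
  have htsq : 0 < t ^ 2 := by rw [← sq_abs]; positivity
  rcases le_or_gt |t| t₀ with ht | ht
  · obtain ⟨J, hJ⟩ := h σ t hσ hσt ht
    have h1 := re_logZeta_le hpos hL hs hσ t J
    calc Real.exp ((logZeta ν (σ + t * Complex.I)).re - (logZeta ν σ).re)
        ≤ Real.exp (-(κ / |t|)) := by
          rw [Real.exp_le_exp]; linarith
      _ ≤ 2 / (κ / |t|) ^ 2 := exp_neg_le_two_div_sq (by positivity)
      _ = 2 / κ ^ 2 * t ^ 2 := by
          rw [div_pow, sq_abs]; field_simp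
      _ ≤ 2 / κ ^ 2 * (1 + t₀ ^ 2) * (t ^ 2 / (1 + t ^ 2)) := by
          have h2 : t ^ 2 ≤ t₀ ^ 2 := by rw [← sq_abs t]; gcongr
          rw [mul_assoc]
          gcongr
          rw [← mul_div_assoc, le_div_iff₀ (by positivity)]
          nlinarith
      _ ≤ _ := by
          gcongr
          exact le_max_right _ _
  · have h1 := re_logZeta_le hpos hL hs hσ t ∅
    rw [Finset.sum_empty, sub_zero] at h1
    calc Real.exp ((logZeta ν (σ + t * Complex.I)).re - (logZeta ν σ).re)
        ≤ 1 := Real.exp_le_one_iff.2 (by linarith)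
      _ ≤ (1 + t₀ ^ 2) / t₀ ^ 2 * (t ^ 2 / (1 + t ^ 2)) := by
          have h2 : t₀ ^ 2 ≤ t ^ 2 := by rw [← sq_abs t]; gcongr
          rw [div_mul_div_comm, le_div_iff₀ (by positivity)]
          nlinarith
      _ ≤ _ := by
          gcongr
          exact le_max_left _ _

theorem logZeta_ofReal_eq (hpos : ∀ j, 0 < ν j) {σ : ℝ} (hσ : 0 < σ) :
    logZeta ν σ = ((logZeta ν σ).re : ℂ) := by
  have : logZeta ν σ = ((∑' j, -Real.log (1 - Real.exp (-σ * ν j)) : ℝ) : ℂ) := by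
    rw [logZeta, Complex.ofReal_tsum]
    congr 1
    ext j
    have h : 0 ≤ 1 - Real.exp (-σ * ν j) := by
      have := Real.exp_le_one_iff.2 (by have := mul_pos hσ (hpos j); linarith : -σ * ν j ≤ 0)
      linarith
    rw [Complex.ofReal_neg, Complex.ofReal_log h]
    push_cast
    rfl
  rw [this, Complex.ofReal_re]

end Tail

/-! ### The Perron integrand near and away from the saddle point. -/

/-- The majorant of the error term in the saddle point approximation. -/
noncomputable def saddleMajorant (A y : ℝ) : ℝ := (1 + |y| + |y| ^ 3) * Real.exp (-(A / 2) * y ^ 2)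

theorem norm_exp_sub_one_le_mul_exp (z : ℂ) : ‖Complex.exp z - 1‖ ≤ ‖z‖ * Real.exp ‖z‖ := by
  have := Complex.norm_exp_sub_sum_le_norm_mul_exp z 1
  simpa using this

/-- The kernel `σ (e^{sh} - 1) / (h s²)` is close to `1` near the real axis. -/
theorem norm_kernel_sub_one_le {σ t h : ℝ} (hσ : 0 < σ) (hh : h ≠ 0) (ht : |t| ≤ σ / 2)
    (hσh : σ * |h| ≤ 1 / 2) :
    ‖(σ : ℂ) * ((Complex.exp ((σ + t * Complex.I) * h) - 1) / (h * (σ + t * Complex.I) ^ 2)) - 1‖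
      ≤ 3 / 2 * (σ * |h|) + |t| / σ := by
  set s : ℂ := σ + t * Complex.I with hs
  have hs0 : s ≠ 0 := line_ne_zero hσ t
  have hsre : s.re = σ := re_line σ t
  have hsσ : σ ≤ ‖s‖ := by rw [← hsre]; exact Complex.re_le_norm s
  have hsn : ‖s‖ ≤ 3 / 2 * σ := by
    refine (norm_add_le _ _).trans ?_
    rw [norm_mul, Complex.norm_I, Complex.norm_real, Complex.norm_real, Real.norm_of_nonneg hσ.le,
      Real.norm_eq_abs]
    linarith
  have hhc : (h : ℂ) ≠ 0 := by exact_mod_cast hh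
  have hun : ‖s * h‖ ≤ 3 / 2 * (σ * |h|) := by
    rw [norm_mul, Complex.norm_real, Real.norm_eq_abs]
    nlinarith [abs_nonneg h]
  have hu0 : 0 < ‖s * h‖ := norm_pos_iff.2 (mul_ne_zero hs0 hhc)
  have e1 : ‖(Complex.exp (s * h) - 1) / (s * h) - 1‖ ≤ 3 / 2 * (σ * |h|) := by
    have h1 : (Complex.exp (s * h) - 1) / (s * h) - 1 = (Complex.exp (s * h) - 1 - s * h) / (s * h) := by
      field_simp
    rw [h1, norm_div, div_le_iff₀ hu0]
    have := Complex.norm_exp_sub_one_sub_id_le (x := s * h) (by linarith)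
    nlinarith
  have hσs : ‖(σ : ℂ) / s‖ ≤ 1 := by
    rw [norm_div, Complex.norm_real, Real.norm_of_nonneg hσ.le, div_le_one (by linarith)]
    exact hsσ
  have e2 : ‖(σ : ℂ) / s - 1‖ ≤ |t| / σ := by
    have h1 : (σ : ℂ) / s - 1 = -(t * Complex.I) / s := by
      field_simp
      rw [hs]; ring
    rw [h1, norm_div, norm_neg, norm_mul, Complex.norm_I, Complex.norm_real, Real.norm_eq_abs, mul_one]
    gcongr
  have e3 : (σ : ℂ) * ((Complex.exp (s * h) - 1) / (h * s ^ 2)) - 1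
      = (σ / s) * ((Complex.exp (s * h) - 1) / (s * h) - 1) + (σ / s - 1) := by
    field_simp
    ring
  rw [e3]
  refine (norm_add_le _ _).trans (add_le_add ?_ e2)
  rw [norm_mul]
  calc _ ≤ 1 * (3 / 2 * (σ * |h|)) := by gcongr
    _ = _ := one_mul _

theorem norm_kernel_le {σ t h : ℝ} (hσ : 0 < σ) (hh : h ≠ 0) (ht : t ≠ 0) (hσh : σ * |h| ≤ 1 / 2) :
    ‖(σ : ℂ) * ((Complex.exp ((σ + t * Complex.I) * h) - 1) / (h * (σ + t * Complex.I) ^ 2))‖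
      ≤ 4 * σ / (|h| * t ^ 2) := by
  have h1 : ‖Complex.exp ((σ + t * Complex.I) * h) - 1‖ ≤ 4 := by
    refine (norm_sub_le _ _).trans ?_
    rw [norm_exp_line, norm_one]
    have h2 : σ * h ≤ 1 := by nlinarith [le_abs_self h]
    have := Real.exp_le_exp.2 h2
    have := Real.exp_one_lt_d9
    linarith
  have hpos : 0 < |h| := abs_pos.2 hh
  have ht2 : 0 < t ^ 2 := by positivity
  rw [norm_mul, norm_div, norm_mul, norm_pow, norm_sq_line, Complex.norm_real, Complex.norm_real,
    Real.norm_of_nonneg hσ.le, Real.norm_eq_abs]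
  calc _ ≤ σ * (4 / (|h| * t ^ 2)) := by
        gcongr
        nlinarith [sq_nonneg σ]
    _ = _ := by ring

theorem norm_log_line_sub_le {σ t : ℝ} (hσ : 0 < σ) (ht : |t| ≤ σ / 2) :
    ‖Complex.log (σ + t * Complex.I) - Complex.log σ‖ ≤ 3 / 2 * (|t| / σ) := by
  have hσc : (σ : ℂ) ≠ 0 := by exact_mod_cast hσ.ne'
  have hz : ‖(t : ℂ) / σ * Complex.I‖ = |t| / σ := by
    rw [norm_mul, norm_div, Complex.norm_I, Complex.norm_real, Complex.norm_real,
      Real.norm_of_nonneg hσ.le, Real.norm_eq_abs, mul_one]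
  have h2 : |t| / σ ≤ 1 / 2 := by rw [div_le_iff₀ hσ]; linarith
  have h1 : (σ : ℂ) + t * Complex.I = (σ : ℝ) * (1 + t / σ * Complex.I) := by field_simp
  have h3 : (1 : ℂ) + t / σ * Complex.I ≠ 0 := by
    intro h
    rw [h, mul_zero] at h1
    exact line_ne_zero hσ t h1
  rw [h1, Complex.log_ofReal_mul hσ h3, Complex.ofReal_log hσ.le, add_sub_cancel_left]
  refine (Complex.norm_log_one_add_half_le_self ?_).trans (le_of_eq ?_)
  · rw [hz]; exact h2
  · rw [hz]

/-- Finite geometric expansion of A/s about σ: the remainder is exactly iAt³/(σ³s). The linear term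
is cancelled by e^(itX) with X = A/σ², and the quadratic one is the Gaussian exponent. -/
theorem norm_saddle_remainder_le {A σ t : ℝ} (hA : 0 < A) (hσ : 0 < σ) :
    ‖(A : ℂ) / (σ + t * Complex.I) - A / σ + t * Complex.I * (A / σ ^ 2 : ℝ) + (A / σ ^ 3 * t ^ 2 : ℝ)‖
      ≤ A * |t| ^ 3 / σ ^ 4 := by
  set s : ℂ := σ + t * Complex.I with hs
  have hs0 : s ≠ 0 := line_ne_zero hσ t
  have hsσ : σ ≤ ‖s‖ := by
    have : s.re = σ := re_line σ t
    rw [← this]; exact Complex.re_le_norm s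
  have hσc : (σ : ℂ) ≠ 0 := by exact_mod_cast hσ.ne'
  have h1 : (A : ℂ) / s - A / σ + t * Complex.I * (A / σ ^ 2 : ℝ) + (A / σ ^ 3 * t ^ 2 : ℝ)
      = (A * t ^ 3 / σ ^ 3 : ℝ) * Complex.I / s := by
    push_cast
    field_simp
    have hI := Complex.I_sq
    linear_combination (exp := 1) (A * σ * t ^ 2 : ℂ) * hI
  rw [h1, norm_div, norm_mul, Complex.norm_I, mul_one, Complex.norm_real, Real.norm_eq_abs, abs_div,
    abs_mul, abs_pow, abs_of_pos hA, abs_of_pos (pow_pos hσ 3), div_div]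
  have h4 : σ ^ 4 = σ ^ 3 * σ := by ring
  rw [h4]
  gcongr

section Saddle

variable {ν : ℕ → ℝ} {L b : ℝ}

/-- The normalized Perron integrand at height `t`, with `σ = w ^ 10`, `X = A / σ ^ 2`. -/
noncomputable def saddleIntegrand (ν : ℕ → ℝ) (A σ h t : ℝ) : ℂ :=
  Complex.exp (logZeta ν (σ + t * Complex.I) - logZeta ν σ + t * Complex.I * (A / σ ^ 2 : ℝ))
    * ((σ : ℂ) * ((Complex.exp ((σ + t * Complex.I) * h) - 1) / (h * (σ + t * Complex.I) ^ 2)))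

/-- Here t = w^15 y and σ = w^10, so |t|/σ = |y| w^5. In the range |y| w^5 ≤ 1/2 the cubic part of R
is at most half of the Gaussian exponent, which is why the majorant decays with A/2 instead of A. -/
theorem norm_central_le {A w y a D : ℝ} (hA : 0 < A) (ha : 0 ≤ a) (hD : 0 ≤ D)
    {R k : ℂ} (hw0 : 0 < w) (hw : w ≤ 1 / 2) (hy : |y| * w ^ 5 ≤ 1 / 2)
    (hR : ‖R‖ ≤ A * |y| ^ 3 * w ^ 5 + a * (|y| * w ^ 5) + D * w ^ 10)
    (hk : ‖k - 1‖ ≤ 3 / 2 * w ^ 2 + |y| * w ^ 5) :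
    ‖Complex.exp (-(A * y ^ 2 : ℝ) + R) * k - Real.exp (-(A * y ^ 2))‖
      ≤ (3 * (A + a + D) * Real.exp (a + D) + 5 / 2) * w ^ 2 * saddleMajorant A y := by
  set Y := |y| with hY
  have hY0 : 0 ≤ Y := abs_nonneg y
  have hyY : y ^ 2 = Y ^ 2 := (sq_abs y).symm
  have hw5 : w ^ 5 ≤ w ^ 2 := pow_le_pow_of_le_one hw0.le (by linarith) (by norm_num)
  have hw10 : w ^ 10 ≤ w ^ 2 := pow_le_pow_of_le_one hw0.le (by linarith) (by norm_num)
  have hw2 : w ^ 2 ≤ 1 / 4 := by nlinarith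
  have hw2p : 0 < w ^ 2 := by positivity
  have hw10' : w ^ 10 ≤ 1 := by linarith
  have hR1 : ‖R‖ ≤ A * y ^ 2 / 2 + (a + D) := by
    refine hR.trans ?_
    have h1 : A * Y ^ 3 * w ^ 5 = A * Y ^ 2 * (Y * w ^ 5) := by ring
    have h2 : A * Y ^ 2 * (Y * w ^ 5) ≤ A * Y ^ 2 * (1 / 2) := by gcongr
    have h3 : a * (Y * w ^ 5) ≤ a * (1 / 2) := by gcongr
    have h4 : D * w ^ 10 ≤ D * 1 := by gcongr
    rw [h1, hyY]
    linarith
  have hR2 : ‖R‖ ≤ (A + a + D) * w ^ 2 * (1 + Y + Y ^ 3) := by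
    refine hR.trans ?_
    have h1 : A * Y ^ 3 * w ^ 5 ≤ A * Y ^ 3 * w ^ 2 := by gcongr
    have h2 : a * (Y * w ^ 5) ≤ a * (Y * w ^ 2) := by gcongr
    have h3 : D * w ^ 10 ≤ D * w ^ 2 := by gcongr
    have h4 : 0 ≤ A * w ^ 2 * (1 + Y) := by positivity
    have h5 : 0 ≤ a * w ^ 2 * (1 + Y ^ 3) := by positivity
    have h6 : 0 ≤ D * w ^ 2 * (Y + Y ^ 3) := by positivity
    linarith
  have hk1 : ‖k‖ ≤ 3 := by
    have := norm_le_norm_add_norm_sub 1 k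
    rw [norm_one, norm_sub_rev] at this
    linarith
  set P := Real.exp (-(A / 2) * y ^ 2) with hP
  have hP0 : 0 < P := Real.exp_pos _
  have hexp1 : Real.exp (-(A * y ^ 2)) * Real.exp ‖R‖ ≤ Real.exp (a + D) * P := by
    rw [hP, ← Real.exp_add, ← Real.exp_add, Real.exp_le_exp]
    linarith
  have hexp2 : Real.exp (-(A * y ^ 2)) ≤ P := by
    rw [hP, Real.exp_le_exp]
    have : 0 ≤ A * y ^ 2 := by positivity
    linarith
  have e1 : ‖Complex.exp (-(A * y ^ 2 : ℝ) + R) - Real.exp (-(A * y ^ 2))‖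
      ≤ (A + a + D) * w ^ 2 * (1 + Y + Y ^ 3) * (Real.exp (a + D) * P) := by
    have h1 : Complex.exp (-(A * y ^ 2 : ℝ) + R) - Real.exp (-(A * y ^ 2))
        = Real.exp (-(A * y ^ 2)) * (Complex.exp R - 1) := by
      rw [Complex.exp_add, mul_sub, mul_one]
      push_cast
      rfl
    rw [h1, norm_mul, Complex.norm_real, Real.norm_of_nonneg (Real.exp_pos _).le]
    calc _ ≤ Real.exp (-(A * y ^ 2)) * (‖R‖ * Real.exp ‖R‖) := by
          gcongr
          exact norm_exp_sub_one_le_mul_exp R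
      _ = ‖R‖ * (Real.exp (-(A * y ^ 2)) * Real.exp ‖R‖) := by ring
      _ ≤ _ := by gcongr
  have e2 : ‖((Real.exp (-(A * y ^ 2)) : ℝ) : ℂ) * (k - 1)‖ ≤ P * (5 / 2 * w ^ 2 * (1 + Y + Y ^ 3)) := by
    rw [norm_mul, Complex.norm_real, Real.norm_of_nonneg (Real.exp_pos _).le]
    have h1 : ‖k - 1‖ ≤ 5 / 2 * w ^ 2 * (1 + Y + Y ^ 3) := by
      refine hk.trans ?_
      have h2 : Y * w ^ 5 ≤ Y * w ^ 2 := by gcongr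
      have h3 : 0 ≤ w ^ 2 * (1 + 3 / 2 * Y + 5 / 2 * Y ^ 3) := by positivity
      linarith
    gcongr
  have e3 : Complex.exp (-(A * y ^ 2 : ℝ) + R) * k - Real.exp (-(A * y ^ 2))
      = (Complex.exp (-(A * y ^ 2 : ℝ) + R) - Real.exp (-(A * y ^ 2))) * k
        + ((Real.exp (-(A * y ^ 2)) : ℝ) : ℂ) * (k - 1) := by ring
  rw [e3]
  refine (norm_add_le _ _).trans ?_
  rw [norm_mul, saddleMajorant]
  calc _ ≤ (A + a + D) * w ^ 2 * (1 + Y + Y ^ 3) * (Real.exp (a + D) * P) * 3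
        + P * (5 / 2 * w ^ 2 * (1 + Y + Y ^ 3)) := by gcongr
    _ = _ := by ring

/-- The cut is at |t| = σ/2, the edge of the sector. With |h| = w^(-8) the kernel error is σ|h| =
w², while the outer part is of order σ/|h| = w^18, still small against the Gaussian mass of order
w^15. -/
theorem exists_norm_saddleIntegrand_sub_le (hpos : ∀ j, 0 < ν j) (hL : 0 < L)
    (hs : Summable fun j : ℕ => |ν j - (j * L + b)|) {A : ℝ} (hA : A = Real.pi ^ 2 / (6 * L)) :
    ∃ C : ℝ, 0 ≤ C ∧ ∀ w h t : ℝ, 0 < w → w ≤ 1 / 2 → |h| = 1 / w ^ 8 →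
      ‖saddleIntegrand ν A (w ^ 10) h t - Real.exp (-(A * (t / w ^ 15) ^ 2))‖
        ≤ C * (w ^ 2 * saddleMajorant A (t / w ^ 15) + w ^ 18 * (1 / (1 + t ^ 2))) := by
  have hA0 : 0 < A := by rw [hA]; have := Real.pi_pos; positivity
  obtain ⟨c₀, C₁, hC₁, hG⟩ := exists_norm_logZeta_sub_le hpos hL hs
  rw [← hA] at hG
  obtain ⟨C₂, hC₂, hT⟩ := exists_norm_exp_logZeta_le hpos hL hs
  set β : ℝ := 1 / 2 - b / L with hβ
  set a : ℝ := 3 / 2 * |β| with ha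
  have ha0 : 0 ≤ a := by positivity
  set D : ℝ := 5 / 2 * C₁ with hD
  have hD0 : 0 ≤ D := by positivity
  set K : ℝ := 3 * (A + a + D) * Real.exp (a + D) + 5 / 2 with hK
  have hK0 : 0 ≤ K := by positivity
  refine ⟨K + 4 * C₂ + 2, by positivity, ?_⟩
  intro w h t hw0 hw hh
  set σ := w ^ 10 with hσ
  have hσ0 : 0 < σ := by positivity
  have hσ1 : σ ≤ 1 := pow_le_one₀ hw0.le (by linarith)
  have hh0 : h ≠ 0 := fun h0 => by
    rw [h0, abs_zero] at hh
    have : 0 < 1 / w ^ 8 := by positivity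
    linarith
  have hσh : σ * |h| = w ^ 2 := by rw [hh, hσ]; field_simp
  have hw2 : w ^ 2 ≤ 1 / 4 := by nlinarith
  set y := t / w ^ 15 with hy
  have hyabs : |y| = |t| / w ^ 15 := by rw [hy, abs_div, abs_of_pos (by positivity : (0:ℝ) < w ^ 15)]
  have hyw : |y| * w ^ 5 = |t| / σ := by rw [hyabs, hσ]; field_simp
  have hmaj : 0 ≤ saddleMajorant A y := by unfold saddleMajorant; positivity
  have hlast : 0 ≤ w ^ 18 * (1 / (1 + t ^ 2)) := by positivity
  rcases le_or_gt |t| (σ / 2) with ht | ht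
  · set s : ℂ := σ + t * Complex.I with hsdef
    have hyw2 : |y| * w ^ 5 ≤ 1 / 2 := by
      rw [hyw, div_le_iff₀ hσ0]; linarith
    have hsec : s ∈ sector := by
      rw [mem_sector, hsdef]
      simp only [Complex.add_re, Complex.add_im, Complex.ofReal_re, Complex.ofReal_im,
        Complex.mul_re, Complex.mul_im, Complex.I_re, Complex.I_im, mul_zero, mul_one, sub_zero,
        zero_add, add_zero]
      exact ⟨hσ0, ht⟩
    have hσsec : (σ : ℂ) ∈ sector := by
      rw [mem_sector]
      simp only [Complex.ofReal_re, Complex.ofReal_im, abs_zero]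
      exact ⟨hσ0, by linarith⟩
    have hsre : s.re = σ := re_line σ t
    have g1 := hG s hsec (by rw [hsre]; exact hσ1)
    have g2 := hG σ hσsec (by rw [Complex.ofReal_re]; exact hσ1)
    have hsn : ‖s‖ ≤ 3 / 2 * σ := by rw [← hsre]; exact norm_le_of_mem_sector hsec
    have hσn : ‖(σ : ℂ)‖ = σ := by rw [Complex.norm_real, Real.norm_of_nonneg hσ0.le]
    rw [hσn] at g2
    set e1 := logZeta ν s - ((A : ℝ) / s - (β : ℝ) * Complex.log s + c₀)
    set e2 := logZeta ν σ - ((A : ℝ) / σ - (β : ℝ) * Complex.log σ + c₀)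
    set R : ℂ := ((A : ℂ) / s - A / σ + t * Complex.I * (A / σ ^ 2 : ℝ) + (A / σ ^ 3 * t ^ 2 : ℝ))
      - β * (Complex.log s - Complex.log σ) + (e1 - e2) with hR
    have hRn : ‖R‖ ≤ A * |y| ^ 3 * w ^ 5 + a * (|y| * w ^ 5) + D * w ^ 10 := by
      have r1 := norm_saddle_remainder_le (t := t) hA0 hσ0
      have r2 := norm_log_line_sub_le hσ0 ht
      have r3 : A * |t| ^ 3 / σ ^ 4 = A * |y| ^ 3 * w ^ 5 := by
        rw [hyabs, hσ]; field_simp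
      rw [r3] at r1
      rw [← hyw] at r2
      rw [hR]
      refine (norm_add_le _ _).trans (add_le_add ((norm_sub_le _ _).trans (add_le_add r1 ?_)) ?_)
      · rw [norm_mul, Complex.norm_real, Real.norm_eq_abs, ha]
        have := mul_le_mul_of_nonneg_left r2 (abs_nonneg β)
        linarith
      · refine (norm_sub_le _ _).trans ?_
        have : C₁ * ‖s‖ ≤ C₁ * (3 / 2 * σ) := by gcongr
        rw [hD, ← hσ]
        linarith
    have hexp : logZeta ν s - logZeta ν σ + t * Complex.I * (A / σ ^ 2 : ℝ) = -(A * y ^ 2 : ℝ) + R := by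
      have h1 : A * y ^ 2 = A / σ ^ 3 * t ^ 2 := by rw [hy, hσ]; field_simp
      rw [h1, hR]
      ring
    have hk := norm_kernel_sub_one_le (t := t) hσ0 hh0 ht (by rw [hσh]; linarith)
    rw [hσh, ← hyw] at hk
    have := norm_central_le hA0 ha0 hD0 hw0 hw hyw2 hRn hk
    rw [saddleIntegrand, hexp]
    rw [← hK] at this
    refine this.trans ?_
    have h1 : 0 ≤ (4 * C₂ + 2) * (w ^ 2 * saddleMajorant A y) := by positivity
    have h2 : 0 ≤ (K + 4 * C₂ + 2) * (w ^ 18 * (1 / (1 + t ^ 2))) := by positivity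
    linarith
  · have htpos : 0 < |t| := by linarith
    have ht0 : t ≠ 0 := abs_pos.1 htpos
    have e1 : ‖saddleIntegrand ν A σ h t‖ ≤ 4 * C₂ * (w ^ 18 * (1 / (1 + t ^ 2))) := by
      rw [saddleIntegrand, norm_mul, Complex.norm_exp]
      have h1 : (logZeta ν (σ + t * Complex.I) - logZeta ν σ + t * Complex.I * (A / σ ^ 2 : ℝ)).re
          = (logZeta ν (σ + t * Complex.I)).re - (logZeta ν σ).re := by
        rw [Complex.add_re, Complex.sub_re, Complex.re_mul_ofReal]
        simp
      rw [h1]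
      have h2 := hT σ t hσ0 ht.le
      have h3 := norm_kernel_le hσ0 hh0 ht0 (by rw [hσh]; linarith)
      calc _ ≤ C₂ * (t ^ 2 / (1 + t ^ 2)) * (4 * σ / (|h| * t ^ 2)) := by gcongr
        _ = _ := by
          rw [hh, hσ]
          field_simp
    -- Outside the central range |y| w^5 ≥ 1/2, so w² times the polynomial factor of the majorant is
    -- bounded below and absorbs the Gaussian that is being subtracted.
    have e2 : Real.exp (-(A * y ^ 2)) ≤ 2 * (w ^ 2 * saddleMajorant A y) := by
      have h1 : 1 / 2 ≤ |y| * w ^ 5 := by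
        rw [hyw, le_div_iff₀ hσ0]; linarith
      have hw5 : w ^ 5 ≤ w ^ 2 := pow_le_pow_of_le_one hw0.le (by linarith) (by norm_num)
      have h2 : 1 ≤ 2 * w ^ 2 * (1 + |y| + |y| ^ 3) := by
        have h3 : |y| * w ^ 5 ≤ |y| * w ^ 2 := by gcongr
        have h4 : 0 ≤ w ^ 2 * (1 + |y| ^ 3) := by positivity
        linarith
      have h5 : Real.exp (-(A * y ^ 2)) ≤ Real.exp (-(A / 2) * y ^ 2) := by
        rw [Real.exp_le_exp]
        have : 0 ≤ A * y ^ 2 := by positivity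
        linarith
      rw [saddleMajorant]
      have := Real.exp_pos (-(A / 2) * y ^ 2)
      nlinarith
    refine (norm_sub_le _ _).trans ?_
    rw [Complex.norm_real, Real.norm_of_nonneg (Real.exp_pos _).le]
    have h1 : 0 ≤ (K + 4 * C₂) * (w ^ 2 * saddleMajorant A y) := by positivity
    have h2 : 0 ≤ (K + 2) * (w ^ 18 * (1 / (1 + t ^ 2))) := by positivity
    linarith

end Saddle

theorem integrable_saddleMajorant {A : ℝ} (hA : 0 < A) : Integrable (saddleMajorant A) := by
  have hA2 : 0 < A / 2 := half_pos hA
  have h0 := integrable_exp_neg_mul_sq hA2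
  have h1 := (integrable_rpow_mul_exp_neg_mul_sq hA2 (s := ((1 : ℕ) : ℝ)) (by norm_num)).norm
  have h3 := (integrable_rpow_mul_exp_neg_mul_sq hA2 (s := ((3 : ℕ) : ℝ)) (by norm_num)).norm
  refine ((h0.add h1).add h3).congr (Eventually.of_forall fun y => ?_)
  simp only [Pi.add_apply, Real.rpow_natCast, norm_mul, norm_pow, Real.norm_eq_abs, Real.abs_exp,
    saddleMajorant]
  ring

section Saddle

variable {ν : ℕ → ℝ} {L b : ℝ}

theorem exists_norm_integral_saddleIntegrand_sub_le (hpos : ∀ j, 0 < ν j) (hL : 0 < L)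
    (hs : Summable fun j : ℕ => |ν j - (j * L + b)|) {A : ℝ} (hA : A = Real.pi ^ 2 / (6 * L)) :
    ∃ C : ℝ, 0 ≤ C ∧ ∀ w h : ℝ, 0 < w → w ≤ 1 / 2 → |h| = 1 / w ^ 8 →
      Integrable (saddleIntegrand ν A (w ^ 10) h) →
      ‖(∫ t, saddleIntegrand ν A (w ^ 10) h t) - (w ^ 15 * √(Real.pi / A) : ℝ)‖ ≤ C * w ^ 17 := by
  have hA0 : 0 < A := by rw [hA]; have := Real.pi_pos; positivity
  obtain ⟨C, hC, hpt⟩ := exists_norm_saddleIntegrand_sub_le hpos hL hs hA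
  set I := ∫ y, saddleMajorant A y with hI
  have hI0 : 0 ≤ I := integral_nonneg fun y => by simp only [Pi.zero_apply]; unfold saddleMajorant; positivity
  refine ⟨C * (I + Real.pi), by have := Real.pi_pos; positivity, ?_⟩
  intro w h hw0 hw hh hint
  have hw15 : (0 : ℝ) < w ^ 15 := by positivity
  have hgi : Integrable fun t : ℝ => Real.exp (-(A * (t / w ^ 15) ^ 2)) := by
    have := (integrable_exp_neg_mul_sq hA0).comp_div hw15.ne'
    refine this.congr (Eventually.of_forall fun t => ?_)
    simp only [neg_mul]
  have hgv : ∫ t : ℝ, Real.exp (-(A * (t / w ^ 15) ^ 2)) = w ^ 15 * √(Real.pi / A) := by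
    have := Measure.integral_comp_div (fun y : ℝ => Real.exp (-A * y ^ 2)) (w ^ 15)
    rw [integral_gaussian, abs_of_pos hw15, smul_eq_mul] at this
    rw [← this]
    simp only [neg_mul]
  have hmi : Integrable fun t : ℝ => saddleMajorant A (t / w ^ 15) :=
    (integrable_saddleMajorant hA0).comp_div hw15.ne'
  have hmv : ∫ t : ℝ, saddleMajorant A (t / w ^ 15) = w ^ 15 * I := by
    rw [Measure.integral_comp_div, abs_of_pos hw15, smul_eq_mul]
  have hqi : Integrable fun t : ℝ => 1 / (1 + t ^ 2) := by
    simpa only [one_div] using integrable_inv_one_add_sq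
  have hqv : ∫ t : ℝ, 1 / (1 + t ^ 2) = Real.pi := by
    simpa only [one_div] using integral_univ_inv_one_add_sq
  have hgi' : Integrable fun t : ℝ => ((Real.exp (-(A * (t / w ^ 15) ^ 2)) : ℝ) : ℂ) := hgi.ofReal
  rw [← hgv, ← integral_complex_ofReal, ← integral_sub hint hgi']
  have hbi : Integrable fun t : ℝ => C * (w ^ 2 * saddleMajorant A (t / w ^ 15) + w ^ 18 * (1 / (1 + t ^ 2))) :=
    ((hmi.const_mul _).add (hqi.const_mul _)).const_mul _
  refine (norm_integral_le_of_norm_le hbi (Eventually.of_forall fun t => hpt w h t hw0 hw hh)).trans ?_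
  rw [integral_const_mul, integral_add (hmi.const_mul _) (hqi.const_mul _), integral_const_mul,
    integral_const_mul, hmv, hqv, mul_assoc]
  have hw18 : w ^ 18 ≤ w ^ 17 := pow_le_pow_of_le_one hw0.le (by linarith) (by norm_num)
  have := mul_le_mul_of_nonneg_right hw18 Real.pi_pos.le
  refine mul_le_mul_of_nonneg_left ?_ hC
  linarith

/-! ### From the Perron integral to the counting function. -/

/-- The number of elements of weight at most `X` in the free commutative monoid with generators
of weights `ν_j`. -/
noncomputable def weightCount (ν : ℕ → ℝ) (X : ℝ) : ℕ :=
  {e : ℕ →₀ ℕ | (e.sum fun j k => k * ν j) ≤ X}.ncard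

theorem exists_abs_weightCount_sub_le (hpos : ∀ j, 0 < ν j) (hL : 0 < L)
    (hs : Summable fun j : ℕ => |ν j - (j * L + b)|) {A : ℝ} (hA : A = Real.pi ^ 2 / (6 * L)) :
    ∃ C : ℝ, 0 ≤ C ∧ ∀ w : ℝ, 0 < w → w ≤ 1 / 2 →
      |weightCount ν (A / (w ^ 10) ^ 2)
        - Real.exp ((logZeta ν ((w ^ 10 : ℝ) : ℂ)).re + A / w ^ 10) / (2 * Real.pi * w ^ 10)
          * (w ^ 15 * √(Real.pi / A))|
      ≤ Real.exp ((logZeta ν ((w ^ 10 : ℝ) : ℂ)).re + A / w ^ 10) / (2 * Real.pi * w ^ 10)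
          * (C * w ^ 17) := by
  obtain ⟨C, hC, hI⟩ := exists_norm_integral_saddleIntegrand_sub_le hpos hL hs hA
  refine ⟨C, hC, ?_⟩
  intro w hw0 hw
  set σ := w ^ 10 with hσ
  have hσ0 : 0 < σ := by positivity
  set X := A / σ ^ 2 with hX
  set G := (logZeta ν (σ : ℂ)).re with hG
  set Λ : (ℕ →₀ ℕ) → ℝ := fun e => e.sum fun j k => k * ν j with hΛ
  have hsum : Summable fun e => Real.exp (-σ * Λ e) := by
    have h1 := (hasSum_exp_neg_weight hpos hL hs (s := (σ : ℂ)) (by simpa using hσ0)).summable.norm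
    refine h1.congr fun e => ?_
    rw [norm_exp_neg_mul, Complex.ofReal_re]
  have hD : ∀ t : ℝ, ∑' e, Complex.exp (-((σ : ℂ) + t * Complex.I) * Λ e)
      = Complex.exp (logZeta ν (σ + t * Complex.I)) := fun t =>
    (hasSum_exp_neg_weight hpos hL hs (s := (σ : ℂ) + t * Complex.I) (by rw [re_line]; exact hσ0)).tsum_eq
  set E := Real.exp (G + A / σ) / (2 * Real.pi * σ) with hE
  have hpi := Real.pi_pos
  have hE0 : 0 < E := by positivity
  have key : ∀ h : ℝ, |h| = 1 / w ^ 8 →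
      |(∑' e, (max (X + h - Λ e) 0 - max (X - Λ e) 0)) / h - E * (w ^ 15 * √(Real.pi / A))|
        ≤ E * (C * w ^ 17) := by
    intro h hh
    obtain ⟨i1, e1⟩ := integral_dirichlet_mul_kernel hσ0 hsum X h
    simp_rw [hD] at i1 e1
    set T := (∑' e, (max (X + h - Λ e) 0 - max (X - Λ e) 0)) / h
    -- Dividing by the value at the real point s = σ normalizes the integrand; this uses that
    -- `logZeta` is real there.
    have hrel : ∀ t : ℝ, saddleIntegrand ν A σ h t = ((Real.exp (-(G + A / σ)) * σ : ℝ) : ℂ)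
        * (Complex.exp (logZeta ν (σ + t * Complex.I)) * Complex.exp (((σ : ℂ) + t * Complex.I) * X)
        * ((Complex.exp (((σ : ℂ) + t * Complex.I) * h) - 1) / (h * ((σ : ℂ) + t * Complex.I) ^ 2))) := by
      intro t
      have h1 : Complex.exp (logZeta ν (σ + t * Complex.I) - logZeta ν σ + t * Complex.I * (A / σ ^ 2 : ℝ))
          = ((Real.exp (-(G + A / σ)) : ℝ) : ℂ) * (Complex.exp (logZeta ν (σ + t * Complex.I))
            * Complex.exp (((σ : ℂ) + t * Complex.I) * X)) := by
        rw [Complex.ofReal_exp, ← Complex.exp_add, ← Complex.exp_add, logZeta_ofReal_eq hpos hσ0, hX]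
        congr 1
        have h2 : (σ : ℂ) * (A / σ ^ 2 : ℝ) = A / σ := by
          have : (σ : ℂ) ≠ 0 := by exact_mod_cast hσ0.ne'
          push_cast
          field_simp
        rw [add_mul, h2]
        push_cast
        ring
      rw [saddleIntegrand, h1]
      push_cast
      ring
    have hint : Integrable (saddleIntegrand ν A σ h) :=
      (i1.const_mul ((Real.exp (-(G + A / σ)) * σ : ℝ) : ℂ)).congr
        (Eventually.of_forall fun t => (hrel t).symm)
    have h3 := hI w h hw0 hw hh hint
    rw [← hσ] at h3
    have h4 : ∫ t, saddleIntegrand ν A σ h t = ((T / E : ℝ) : ℂ) := by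
      simp_rw [hrel]
      rw [integral_const_mul, e1, ← Complex.ofReal_mul]
      congr 1
      rw [hE, Real.exp_neg]
      have := Real.exp_pos (G + A / σ)
      field_simp
    rw [h4, ← Complex.ofReal_sub, Complex.norm_real, Real.norm_eq_abs] at h3
    have h5 : T - E * (w ^ 15 * √(Real.pi / A)) = E * (T / E - w ^ 15 * √(Real.pi / A)) := by
      field_simp
    rw [h5, abs_mul, abs_of_pos hE0]
    gcongr
  have hH : 0 < 1 / w ^ 8 := by positivity
  -- The same estimate for h = w^(-8) and h = -w^(-8) encloses the count.
  have k1 := abs_le.1 (key (1 / w ^ 8) (abs_of_pos hH))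
  have k2 := abs_le.1 (key (-(1 / w ^ 8)) (by rw [abs_neg, abs_of_pos hH]))
  have u1 := ncard_le_tsum_div hσ0 hsum X hH
  have u2 := tsum_div_le_ncard hσ0 hsum X (neg_lt_zero.2 hH)
  have hN : (weightCount ν X : ℝ) = ({e | Λ e ≤ X}.ncard : ℝ) := rfl
  rw [abs_le, hN]
  constructor <;> linarith [k1.1, k1.2, k2.1, k2.2]

/-- Asymptotics for the number of partitions into parts from an almost arithmetic progression. -/
theorem weightCount_asymptotic (hpos : ∀ j, 0 < ν j) (hL : 0 < L)
    (hs : Summable fun j : ℕ => |ν j - (j * L + b)|) :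
    ∃ k₀ : ℝ, 0 < k₀ ∧ ∃ C : ℝ, ∀ᶠ X : ℝ in atTop,
      |weightCount ν X - k₀ * X ^ (-(b / (2 * L))) * Real.exp (Real.pi * √(2 * X / (3 * L)))|
        ≤ C * (1 / X ^ (1 / 10 : ℝ))
          * (k₀ * X ^ (-(b / (2 * L))) * Real.exp (Real.pi * √(2 * X / (3 * L)))) := by
  obtain ⟨A, hA⟩ : ∃ A, A = Real.pi ^ 2 / (6 * L) := ⟨_, rfl⟩
  have hpi := Real.pi_pos
  have hA0 : 0 < A := by rw [hA]; positivity
  obtain ⟨C, hC, hN⟩ := exists_abs_weightCount_sub_le hpos hL hs hA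
  obtain ⟨c₀, C₁, hC₁, hG⟩ := exists_norm_logZeta_sub_le hpos hL hs
  rw [← hA] at hG
  set K := Real.exp c₀.re / (2 * Real.pi) * √(Real.pi / A) with hK
  have hq : 0 < √(Real.pi / A) := Real.sqrt_pos.2 (by positivity)
  have hK0 : 0 < K := by positivity
  set C₂ := C / √(Real.pi / A) with hC₂
  have hC₂0 : 0 ≤ C₂ := by positivity
  set C₃ := C₁ * Real.exp C₁ + Real.exp C₁ * C₂ with hC₃
  have hC₃0 : 0 ≤ C₃ := by positivity
  -- the estimate in terms of the saddle point
  have main : ∀ w : ℝ, 0 < w → w ≤ 1 / 2 →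
      |weightCount ν (A / (w ^ 10) ^ 2) - K * (w ^ 10) ^ (b / L) * Real.exp (2 * A / w ^ 10)|
        ≤ C₃ * w ^ 2 * (K * (w ^ 10) ^ (b / L) * Real.exp (2 * A / w ^ 10)) := by
    intro w hw0 hw
    have h1 := hN w hw0 hw
    set σ := w ^ 10 with hσ
    have hσ0 : 0 < σ := by positivity
    have hσ1 : σ ≤ 1 := pow_le_one₀ hw0.le (by linarith)
    have hσw : σ ≤ w ^ 2 := pow_le_pow_of_le_one hw0.le (by linarith) (by norm_num)
    have hσsec : (σ : ℂ) ∈ sector := by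
      rw [mem_sector]
      simp only [Complex.ofReal_re, Complex.ofReal_im, abs_zero]
      exact ⟨hσ0, by linarith⟩
    have h2 := hG σ hσsec (by rw [Complex.ofReal_re]; exact hσ1)
    rw [Complex.norm_real, Real.norm_of_nonneg hσ0.le] at h2
    have h3 := (Complex.abs_re_le_norm _).trans h2
    set δ := (logZeta ν (σ : ℂ)).re - (A / σ - (1 / 2 - b / L) * Real.log σ + c₀.re) with hδ
    have h4 : (logZeta ν σ - ((A : ℝ) / σ - (1 / 2 - b / L : ℝ) * Complex.log σ + c₀)).re = δ := by
      rw [hδ, ← Complex.ofReal_log hσ0.le, ← Complex.ofReal_div, ← Complex.ofReal_mul]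
      simp only [Complex.sub_re, Complex.add_re, Complex.ofReal_re]
    rw [h4] at h3
    set M := K * σ ^ (b / L) * Real.exp (2 * A / σ) with hM
    have hM0 : 0 < M := by positivity
    -- Powers of σ: -(1/2 - b/L) from `logZeta`, -1 from the kernel and 3/2 from the Gaussian width
    -- add up to b/L.
    have h5 : Real.exp ((logZeta ν (σ : ℂ)).re + A / σ) / (2 * Real.pi * σ) * (w ^ 15 * √(Real.pi / A))
        = M * Real.exp δ := by
      have e1 : (logZeta ν (σ : ℂ)).re + A / σ = c₀.re + 2 * A / σ + δ + (b / L - 1 / 2) * Real.log σ := by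
        rw [hδ]; ring
      have e2 : w ^ 15 = σ ^ (3 / 2 : ℝ) := by
        rw [hσ, ← Real.rpow_natCast w 10, ← Real.rpow_mul hw0.le, ← Real.rpow_natCast w 15]
        norm_num
      have e3 : Real.exp ((b / L - 1 / 2) * Real.log σ) = σ ^ (b / L - 1 / 2) := by
        rw [Real.rpow_def_of_pos hσ0, mul_comm]
      have e4 : σ ^ (b / L - 1 / 2) * σ ^ (3 / 2 : ℝ) = σ ^ (b / L) * σ := by
        rw [← Real.rpow_add hσ0, ← Real.rpow_add_one hσ0.ne']
        congr 1; ring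
      rw [e1, Real.exp_add, Real.exp_add, Real.exp_add, e3, hM, hK, e2]
      rw [show Real.exp c₀.re * Real.exp (2 * A / σ) * Real.exp δ * σ ^ (b / L - 1 / 2)
        / (2 * Real.pi * σ) * (σ ^ (3 / 2 : ℝ) * √(Real.pi / A))
        = Real.exp c₀.re * Real.exp (2 * A / σ) * Real.exp δ / (2 * Real.pi * σ) * √(Real.pi / A)
          * (σ ^ (b / L - 1 / 2) * σ ^ (3 / 2 : ℝ)) by ring, e4]
      field_simp
    have h6 : Real.exp ((logZeta ν (σ : ℂ)).re + A / σ) / (2 * Real.pi * σ) * (C * w ^ 17)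
        = M * Real.exp δ * (C₂ * w ^ 2) := by
      rw [← h5, hC₂]
      field_simp
    rw [h5, h6] at h1
    have hδ1 : |δ| ≤ C₁ := h3.trans (by nlinarith)
    have hδ2 : |Real.exp δ - 1| ≤ C₁ * Real.exp C₁ * w ^ 2 := by
      have e1 := norm_exp_sub_one_le_mul_exp (δ : ℂ)
      have e2 : Complex.exp (δ : ℂ) - 1 = ((Real.exp δ - 1 : ℝ) : ℂ) := by push_cast; rfl
      rw [e2, Complex.norm_real, Complex.norm_real, Real.norm_eq_abs, Real.norm_eq_abs] at e1
      refine e1.trans ?_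
      calc |δ| * Real.exp |δ| ≤ (C₁ * w ^ 2) * Real.exp C₁ := by
            gcongr
            exact h3.trans (by gcongr)
        _ = _ := by ring
    have hδ3 : Real.exp δ ≤ Real.exp C₁ := Real.exp_le_exp.2 ((le_abs_self δ).trans hδ1)
    have h7 : |M * Real.exp δ - M| ≤ M * (C₁ * Real.exp C₁ * w ^ 2) := by
      rw [show M * Real.exp δ - M = M * (Real.exp δ - 1) by ring, abs_mul, abs_of_pos hM0]
      gcongr
    have h8 : M * Real.exp δ * (C₂ * w ^ 2) ≤ M * Real.exp C₁ * (C₂ * w ^ 2) := by gcongr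
    refine (abs_sub_le _ (M * Real.exp δ) _).trans ?_
    rw [hC₃]
    linarith
  refine ⟨K * A ^ (b / (2 * L)), by positivity, C₃ * A ^ (1 / 10 : ℝ), ?_⟩
  filter_upwards [eventually_ge_atTop (A * 2 ^ 20), eventually_gt_atTop 0] with X hX hX0
  -- This places σ = w^10 at the saddle point √(A/X). The relative error w² is then (A/X)^(1/10).
  set w := (A / X) ^ (1 / 20 : ℝ) with hw
  have hAX : 0 < A / X := by positivity
  have hw0 : 0 < w := by positivity
  have hwle : w ≤ 1 / 2 := by
    have h1 : A / X ≤ (1 / 2) ^ (20 : ℕ) := by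
      rw [div_le_iff₀ hX0]
      have : (1 / 2 : ℝ) ^ 20 * (A * 2 ^ 20) = A := by ring
      nlinarith
    have h2 := Real.rpow_le_rpow hAX.le h1 (by norm_num : (0 : ℝ) ≤ 1 / 20)
    rw [← Real.rpow_natCast, ← Real.rpow_mul (by norm_num)] at h2
    norm_num at h2 ⊢
    rw [hw]
    norm_num
    exact h2
  have hσ : w ^ 10 = (A / X) ^ (1 / 2 : ℝ) := by
    rw [hw, ← Real.rpow_natCast, ← Real.rpow_mul hAX.le]; norm_num
  have hw2 : w ^ 2 = (A / X) ^ (1 / 10 : ℝ) := by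
    rw [hw, ← Real.rpow_natCast, ← Real.rpow_mul hAX.le]; norm_num
  have hsq : (w ^ 10) ^ 2 = A / X := by
    rw [hσ, ← Real.rpow_natCast, ← Real.rpow_mul hAX.le]; norm_num
  have hXe : A / (w ^ 10) ^ 2 = X := by
    rw [hsq]; field_simp
  have hpow : (w ^ 10) ^ (b / L) = A ^ (b / (2 * L)) * X ^ (-(b / (2 * L))) := by
    rw [hσ, ← Real.rpow_mul hAX.le, Real.rpow_neg hX0.le, ← div_eq_mul_inv, ← Real.div_rpow hA0.le hX0.le]
    congr 1
    field_simp
  have hexp : 2 * A / w ^ 10 = Real.pi * √(2 * X / (3 * L)) := by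
    have h1 : (2 * A / w ^ 10) ^ 2 = (Real.pi * √(2 * X / (3 * L))) ^ 2 := by
      rw [div_pow, hsq, mul_pow Real.pi, Real.sq_sqrt (by positivity), mul_pow]
      rw [show (2 : ℝ) ^ 2 * A ^ 2 / (A / X) = 4 * A * X by field_simp; ring, hA]
      field_simp
      ring
    exact (pow_left_inj₀ (by positivity) (by positivity) two_ne_zero).1 h1
  have h := main w hw0 hwle
  rw [hXe, hpow, hexp, hw2, Real.div_rpow hA0.le hX0.le] at h
  convert h using 1
  · congr 2; ring
  · ring

end Saddle

/-! ### Identities for integer Lucas sequences. -/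

/-- The Lucas sequence of the first kind with integer parameters `P`, `Q`. -/
def lucasInt (P Q : ℤ) : ℕ → ℤ
  | 0 => 0
  | 1 => 1
  | n + 2 => P * lucasInt P Q (n + 1) - Q * lucasInt P Q n

theorem lucasInt_zero (P Q : ℤ) : lucasInt P Q 0 = 0 := rfl
theorem lucasInt_one (P Q : ℤ) : lucasInt P Q 1 = 1 := rfl
theorem lucasInt_add_two (P Q : ℤ) (n : ℕ) :
    lucasInt P Q (n + 2) = P * lucasInt P Q (n + 1) - Q * lucasInt P Q n := rfl

/-- Binet's formula in a commutative ring. -/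
theorem sub_mul_lucasInt {R : Type*} [CommRing R] {P Q : ℤ} {α β : R} (h1 : α + β = P) (h2 : α * β = Q)
    (n : ℕ) : (α - β) * lucasInt P Q n = α ^ n - β ^ n := by
  induction n using Nat.twoStepInduction with
  | zero => simp [lucasInt_zero]
  | one => simp [lucasInt_one]
  | more n ih1 ih2 =>
    rw [lucasInt_add_two]
    push_cast
    rw [← h1, ← h2]
    linear_combination (α + β) * ih2 - α * β * ih1

theorem lucasInt_add (P Q : ℤ) (m n : ℕ) :
    lucasInt P Q (m + n + 1) = lucasInt P Q (m + 1) * lucasInt P Q (n + 1)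
      - Q * lucasInt P Q m * lucasInt P Q n := by
  induction n using Nat.twoStepInduction with
  | zero => simp [lucasInt_zero, lucasInt_one]
  | one =>
    rw [lucasInt_add_two, lucasInt_add_two, lucasInt_one, lucasInt_zero]
    ring
  | more n ih1 ih2 =>
    rw [show m + (n + 2) + 1 = (m + n + 1) + 2 by ring, lucasInt_add_two,
      show m + n + 1 + 1 = m + (n + 1) + 1 by ring, ih2, ih1, lucasInt_add_two P Q (n + 1),
      lucasInt_add_two P Q n]
    ring

/-- The Lucas sequence of the second kind. -/
def lucasCompanion (P Q : ℤ) (n : ℕ) : ℤ := 2 * lucasInt P Q (n + 1) - P * lucasInt P Q n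

theorem lucasInt_norm (P Q : ℤ) (n : ℕ) :
    lucasInt P Q (n + 1) ^ 2 - P * lucasInt P Q (n + 1) * lucasInt P Q n + Q * lucasInt P Q n ^ 2
      = Q ^ n := by
  induction n with
  | zero => simp [lucasInt_zero, lucasInt_one]
  | succ n ih =>
    rw [lucasInt_add_two, pow_succ Q, ← ih]
    ring

/-- Along steps of length w the sequence obeys a Lucas recurrence with parameters V_w and Q^w. Hence
U_{kw}/U_w is again a Lucas number (`lucasInt_mul`), and its divisors can be studied through that
recurrence. -/
theorem lucasInt_add_mul (P Q : ℤ) (w n : ℕ) :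
    lucasInt P Q (n + 2 * w) = lucasCompanion P Q w * lucasInt P Q (n + w) - Q ^ w * lucasInt P Q n := by
  rcases w with _ | w
  · simp [lucasCompanion, lucasInt_zero, lucasInt_one]; ring
  rcases n with _ | n
  · have h := lucasInt_add P Q (w + 1) w
    rw [show w + 1 + w + 1 = 0 + 2 * (w + 1) by ring] at h
    rw [h, lucasInt_zero, zero_add, lucasCompanion, lucasInt_add_two]
    ring
  · have h1 := lucasInt_add P Q (n + (w + 1)) (w + 1)
    have h2 := lucasInt_add P Q n (w + 1)
    have h3 := lucasInt_add P Q (n + (w + 1)) w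
    have h4 := lucasInt_add P Q n w
    have h5 := lucasInt_norm P Q w
    rw [show n + 1 + 2 * (w + 1) = n + (w + 1) + (w + 1) + 1 by ring, h1,
      show n + 1 + (w + 1) = n + (w + 1) + 1 by ring, h2,
      show n + (w + 1) = n + w + 1 by ring, h4, lucasCompanion, ← lucasInt_norm P Q (w + 1), lucasInt_add_two]
    ring

theorem lucasCompanion_two_mul (P Q : ℤ) (w : ℕ) :
    lucasCompanion P Q (2 * w) = lucasCompanion P Q w ^ 2 - 2 * Q ^ w := by
  rcases w with _ | w
  · simp [lucasCompanion, lucasInt_zero, lucasInt_one]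
  · have h1 := lucasInt_add P Q (w + 1) (w + 1)
    have h2 := lucasInt_add P Q (w + 1) w
    rw [lucasCompanion, lucasCompanion, show 2 * (w + 1) + 1 = w + 1 + (w + 1) + 1 by ring, h1,
      show 2 * (w + 1) = w + 1 + w + 1 by ring, h2, ← lucasInt_norm P Q (w + 1), lucasInt_add_two P Q w]
    ring

theorem lucasInt_mul (P Q : ℤ) (w k : ℕ) :
    lucasInt P Q (k * w) = lucasInt P Q w * lucasInt (lucasCompanion P Q w) (Q ^ w) k := by
  induction k using Nat.twoStepInduction with
  | zero => simp [lucasInt_zero]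
  | one => simp [lucasInt_one]
  | more k ih1 ih2 =>
    rw [lucasInt_add_two, show (k + 2) * w = k * w + 2 * w by ring, lucasInt_add_mul,
      show k * w + w = (k + 1) * w by ring, ih1, ih2]
    ring

/-- Modulo m the characteristic polynomial is (X - κ)², so U_k behaves like kκ^(k-1). The first
congruence is multiplied by κ to avoid the exponent k - 1 and to carry the induction. -/
theorem lucasInt_modEq {m V W κ : ℤ} (hV : V ≡ 2 * κ [ZMOD m]) (hW : W ≡ κ ^ 2 [ZMOD m]) (k : ℕ) :
    lucasInt V W k * κ ≡ k * κ ^ k [ZMOD m] ∧ lucasInt V W (k + 1) ≡ (k + 1) * κ ^ k [ZMOD m] := by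
  induction k with
  | zero => simp [lucasInt_zero, lucasInt_one, Int.ModEq.refl]
  | succ k ih =>
    constructor
    · have := ih.2.mul_right κ
      convert this using 1
      push_cast
      ring
    · rw [lucasInt_add_two]
      have h1 : V * lucasInt V W (k + 1) ≡ 2 * κ * ((k + 1) * κ ^ k) [ZMOD m] := hV.mul ih.2
      have h2 : W * lucasInt V W k ≡ κ ^ 2 * lucasInt V W k [ZMOD m] := hW.mul_right _
      have h3 : κ ^ 2 * lucasInt V W k ≡ κ * (k * κ ^ k) [ZMOD m] := by
        have := ih.1.mul_left κ
        convert this using 1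
        ring
      have := h1.sub (h2.trans h3)
      convert this using 1
      push_cast
      ring

/-! ### Primes dividing Lucas numbers. -/

section Prime

variable {P Q : ℤ} {q : ℕ}

/-- Modulo a prime dividing Q the sequence is U_{k+1} ≡ P^k, and P is coprime to Q. -/
theorem not_dvd_of_dvd_lucasInt (hPQ : IsCoprime P Q) (hq : q.Prime) {n : ℕ} (hn : 1 ≤ n)
    (h : (q : ℤ) ∣ lucasInt P Q n) : ¬ (q : ℤ) ∣ Q := by
  intro hQ
  have hqp : Prime (q : ℤ) := Nat.prime_iff_prime_int.1 hq
  have hmod : ∀ k : ℕ, lucasInt P Q (k + 1) ≡ P ^ k [ZMOD q] := by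
    intro k
    induction k with
    | zero => simp [lucasInt_one, Int.ModEq.refl]
    | succ k ih =>
      rw [lucasInt_add_two]
      have h1 := (ih.mul_left P).sub ((Int.modEq_zero_iff_dvd.2 hQ).mul_right (lucasInt P Q k))
      convert h1 using 1
      ring
  obtain ⟨k, rfl⟩ := Nat.exists_eq_add_of_le' hn
  have h2 := (Int.modEq_zero_iff_dvd.1 ((hmod k).symm.trans (Int.modEq_zero_iff_dvd.2 h)))
  have h3 := hqp.dvd_of_dvd_pow h2
  exact hqp.not_isUnit (hPQ.isUnit_of_dvd' h3 hQ)

theorem not_dvd_lucasInt_succ (hq : q.Prime) (hQ : ¬ (q : ℤ) ∣ Q) {n : ℕ}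
    (h : (q : ℤ) ∣ lucasInt P Q n) : ¬ (q : ℤ) ∣ lucasInt P Q (n + 1) := by
  have hqp : Prime (q : ℤ) := Nat.prime_iff_prime_int.1 hq
  intro h1
  have h2 := lucasInt_norm P Q n
  have h3 : (q : ℤ) ∣ Q ^ n := by
    rw [← h2]
    refine dvd_add (dvd_sub (Dvd.dvd.pow h1 two_ne_zero) ?_) ((Dvd.dvd.pow h two_ne_zero).mul_left _)
    exact h.mul_left _
  exact hQ (hqp.dvd_of_dvd_pow h3)

theorem dvd_lucasInt_sub (hq : q.Prime) (hQ : ¬ (q : ℤ) ∣ Q) {m n : ℕ} (hm : (q : ℤ) ∣ lucasInt P Q m)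
    (hn : (q : ℤ) ∣ lucasInt P Q (m + n)) : (q : ℤ) ∣ lucasInt P Q n := by
  have hqp : Prime (q : ℤ) := Nat.prime_iff_prime_int.1 hq
  rcases n with _ | n
  · simp [lucasInt_zero]
  · rw [← add_assoc, lucasInt_add] at hn
    have h1 : (q : ℤ) ∣ lucasInt P Q (m + 1) * lucasInt P Q (n + 1) := by
      have := dvd_add hn (((hm.mul_left Q).mul_right (lucasInt P Q n)))
      simpa using this
    exact (hqp.dvd_or_dvd h1).resolve_left (not_dvd_lucasInt_succ hq hQ hm)

theorem lucasInt_dvd_mul (P Q : ℤ) (w k : ℕ) : lucasInt P Q w ∣ lucasInt P Q (k * w) :=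
  ⟨_, lucasInt_mul P Q w k⟩

/-- Frobenius fixes or swaps the roots α, β of X² - PX + Q, so α^n = β^n for n = q - 1 or n = q + 1,
and Binet's formula applies. For a double root, U_n = nα^(n-1) vanishes at n = q. -/
theorem exists_dvd_lucasInt_of_isAlgClosed (K : Type*) [Field K] [IsAlgClosed K] [CharP K q]
    (hq : q.Prime) (P : ℤ) (hQ : ¬ (q : ℤ) ∣ Q) :
    ∃ r : ℕ, 1 ≤ r ∧ r ≤ q + 1 ∧ (q : ℤ) ∣ lucasInt P Q r := by
  have : Fact q.Prime := ⟨hq⟩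
  have hcast : ∀ z : ℤ, ((z : ℤ) : K) = 0 ↔ (q : ℤ) ∣ z := fun z => CharP.intCast_eq_zero_iff K q z
  obtain ⟨α, hα⟩ : ∃ α : K, α ^ 2 - P * α + Q = 0 := by
    have hdeg : (Polynomial.X ^ 2 - Polynomial.C (P : K) * Polynomial.X + Polynomial.C (Q : K)).degree ≠ 0 := by
      have : (Polynomial.X ^ 2 - Polynomial.C (P : K) * Polynomial.X + Polynomial.C (Q : K)).degree = 2 := by
        compute_degree!
      rw [this]; decide
    obtain ⟨α, h⟩ := IsAlgClosed.exists_root _ hdeg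
    exact ⟨α, by simpa [Polynomial.IsRoot] using h⟩
  set β : K := P - α with hβ
  have h1 : α + β = P := by rw [hβ]; ring
  have h2 : α * β = Q := by rw [hβ]; linear_combination -hα
  have hfrob : (α ^ q - α) * (α ^ q - β) = 0 := by
    have h3 : frobenius K q (α ^ 2 - P * α + Q) = 0 := by rw [hα, map_zero]
    simp only [map_add, map_sub, map_mul, map_pow, map_intCast] at h3
    rw [frobenius_def] at h3
    have h4 : (α ^ q - α) * (α ^ q - β) = (α ^ q) ^ 2 - (α + β) * α ^ q + α * β := by ring
    rw [h4, h1, h2]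
    exact h3
  have hbinet := fun n => sub_mul_lucasInt h1 h2 n
  by_cases hab : α = β
  · refine ⟨q, hq.one_lt.le, by omega, (hcast _).1 ?_⟩
    have h5 : ∀ n : ℕ, ((lucasInt P Q (n + 1) : ℤ) : K) = (n + 1) * α ^ n := by
      intro n
      induction n using Nat.twoStepInduction with
      | zero => simp [lucasInt_one]
      | one =>
        rw [lucasInt_add_two, lucasInt_one, lucasInt_zero]
        push_cast
        rw [← h1, ← hab]
        ring
      | more n ih1 ih2 =>
        rw [lucasInt_add_two]
        push_cast
        rw [ih1, ih2, ← h1, ← h2, ← hab]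
        push_cast
        ring
    obtain ⟨k, hk⟩ := Nat.exists_eq_add_of_le' hq.one_lt.le
    have h6 := h5 k
    rw [← hk] at h6
    have h7 : ((k : K) + 1) = ((q : ℕ) : K) := by rw [← Nat.cast_succ, Nat.succ_eq_add_one, ← hk]
    rw [h6, h7, CharP.cast_eq_zero, zero_mul]
  · have hne : α - β ≠ 0 := sub_ne_zero.2 hab
    have hzero : ∀ n, α ^ n = β ^ n → (q : ℤ) ∣ lucasInt P Q n := fun n hn => by
      have := hbinet n
      rw [hn, sub_self] at this
      exact (hcast _).1 ((mul_eq_zero.1 this).resolve_left hne)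
    have hQ0 : (Q : K) ≠ 0 := fun h => hQ ((hcast _).1 h)
    have hα0 : α ≠ 0 := fun h => hQ0 (by rw [← h2, h, zero_mul])
    have hβ0 : β ≠ 0 := fun h => hQ0 (by rw [← h2, h, mul_zero])
    have hsum : α ^ q + β ^ q = P := by
      have : frobenius K q (α + β) = P := by rw [h1, map_intCast]
      rwa [map_add, frobenius_def, frobenius_def] at this
    rcases mul_eq_zero.1 hfrob with h | h
    · have ha : α ^ q = α := sub_eq_zero.1 h
      have hb : β ^ q = β := by
        rw [ha, ← h1] at hsum
        exact add_left_cancel hsum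
      obtain ⟨k, hk⟩ := Nat.exists_eq_add_of_le' hq.one_lt.le
      refine ⟨k, ?_, by omega, hzero _ ?_⟩
      · have := hq.two_le; omega
      · rw [hk, pow_succ] at ha hb
        rw [mul_eq_right₀ hα0] at ha
        rw [mul_eq_right₀ hβ0] at hb
        rw [ha, hb]
    · have ha : α ^ q = β := sub_eq_zero.1 h
      have hb : β ^ q = α := by
        rw [ha, ← h1, add_comm α β] at hsum
        exact add_left_cancel hsum
      refine ⟨q + 1, by omega, le_rfl, hzero _ ?_⟩
      rw [pow_succ, pow_succ, ha, hb, mul_comm]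

/-- Every prime not dividing `Q` has a rank of apparition, at most `q + 1`. -/
theorem exists_dvd_lucasInt (hq : q.Prime) (P : ℤ) (hQ : ¬ (q : ℤ) ∣ Q) :
    ∃ r : ℕ, 1 ≤ r ∧ r ≤ q + 1 ∧ (q : ℤ) ∣ lucasInt P Q r := by
  have : Fact q.Prime := ⟨hq⟩
  have : CharP (AlgebraicClosure (ZMod q)) q := charP_of_injective_algebraMap
    (algebraMap (ZMod q) (AlgebraicClosure (ZMod q))).injective q
  exact exists_dvd_lucasInt_of_isAlgClosed (AlgebraicClosure (ZMod q)) hq P hQ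

/-- The quotient `U_{lw} / U_w` is divisible by a divisor `q` of `U_w` only if `q = l`. -/
theorem eq_of_dvd_lucasInt_quot (hq : q.Prime) (hQ : ¬ (q : ℤ) ∣ Q) {w l : ℕ} (hl : l.Prime)
    (hw : (q : ℤ) ∣ lucasInt P Q w)
    (h : (q : ℤ) ∣ lucasInt (lucasCompanion P Q w) (Q ^ w) l) : q = l := by
  have hqp : Prime (q : ℤ) := Nat.prime_iff_prime_int.1 hq
  set κ := lucasInt P Q (w + 1) with hκ
  have hw0 := Int.modEq_zero_iff_dvd.2 hw
  -- Since q divides U_w, the recurrence for U_{kw}/U_w has the double root κ = U_{w+1} modulo q, so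
  -- the quotient is lκ^(l-1) with κ prime to q.
  have hV : lucasCompanion P Q w ≡ 2 * κ [ZMOD q] := by
    rw [lucasCompanion, ← hκ]
    have := (Int.ModEq.refl (2 * κ)).sub (hw0.mul_left P)
    simpa using this
  have hW : Q ^ w ≡ κ ^ 2 [ZMOD q] := by
    rw [← lucasInt_norm, ← hκ]
    have := ((Int.ModEq.refl (κ ^ 2)).sub (hw0.mul_left (P * κ))).add ((hw0.pow 2).mul_left Q)
    simpa using this
  obtain ⟨k, rfl⟩ := Nat.exists_eq_add_of_le' hl.one_lt.le
  have h1 := (lucasInt_modEq hV hW k).2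
  have h2 := Int.modEq_zero_iff_dvd.1 (h1.symm.trans (Int.modEq_zero_iff_dvd.2 h))
  rcases hqp.dvd_or_dvd h2 with h3 | h3
  · have h4 : q ∣ k + 1 := by exact_mod_cast h3
    exact (Nat.prime_dvd_prime_iff_eq hq hl).1 h4
  · exact absurd (hqp.dvd_of_dvd_pow h3) (not_dvd_lucasInt_succ hq hQ hw)

/-- The discriminant V_w² - 4Q^w equals (P² - 4Q)U_w², which q² divides. As q is odd, κ = V_w/2 is a
double root modulo q², and the quotient is qκ^(q-1) with κ prime to q. -/
theorem not_sq_dvd_lucasInt_quot_of_odd (hq : q.Prime) (hq2 : q ≠ 2) (hQ : ¬ (q : ℤ) ∣ Q) {w : ℕ}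
    (hw : (q : ℤ) ∣ lucasInt P Q w) :
    ¬ (q : ℤ) ^ 2 ∣ lucasInt (lucasCompanion P Q w) (Q ^ w) q := by
  have hqp : Prime (q : ℤ) := Nat.prime_iff_prime_int.1 hq
  have hodd : Odd q := hq.odd_of_ne_two hq2
  have hcop : IsCoprime (2 : ℤ) ((q : ℤ) ^ 2) := by
    have : Nat.Coprime 2 (q ^ 2) := (Nat.coprime_two_left.2 hodd).pow_right 2
    exact_mod_cast Nat.isCoprime_iff_coprime.2 this
  obtain ⟨x, y, hxy⟩ := id hcop
  set V := lucasCompanion P Q w with hVdef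
  set κ := x * V with hκ
  have hV : V ≡ 2 * κ [ZMOD (q : ℤ) ^ 2] := by
    rw [Int.modEq_iff_dvd]
    refine ⟨-(y * V), ?_⟩
    rw [hκ]
    linear_combination V * hxy
  have hdisc : V ^ 2 ≡ 4 * Q ^ w [ZMOD (q : ℤ) ^ 2] := by
    rw [Int.modEq_iff_dvd, ← lucasInt_norm P Q w, hVdef, lucasCompanion]
    obtain ⟨u, hu⟩ := hw
    refine ⟨(4 * Q - P ^ 2) * u ^ 2, ?_⟩
    rw [hu]
    ring
  have hW : Q ^ w ≡ κ ^ 2 [ZMOD (q : ℤ) ^ 2] := by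
    have h4 : 4 * Q ^ w ≡ 4 * κ ^ 2 [ZMOD (q : ℤ) ^ 2] := by
      refine hdisc.symm.trans ?_
      have := hV.pow 2
      rwa [mul_pow, show (2 : ℤ) ^ 2 = 4 by norm_num] at this
    rw [Int.modEq_iff_dvd] at h4 ⊢
    have h5 : (q : ℤ) ^ 2 ∣ 2 * (2 * (κ ^ 2 - Q ^ w)) := by
      convert h4 using 1
      ring
    exact hcop.symm.dvd_of_dvd_mul_left (hcop.symm.dvd_of_dvd_mul_left h5)
  intro h
  obtain ⟨k, hk⟩ := Nat.exists_eq_add_of_le' hq.one_lt.le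
  have h1 := (lucasInt_modEq hV hW k).2
  rw [← hk] at h1
  have h2 := Int.modEq_zero_iff_dvd.1 (h1.symm.trans (Int.modEq_zero_iff_dvd.2 h))
  have h3 : (k : ℤ) + 1 = q := by rw [hk]; push_cast; ring
  rw [h3, sq] at h2
  have h4 := hqp.dvd_of_dvd_pow (Int.dvd_of_mul_dvd_mul_left (by exact_mod_cast hq.ne_zero) h2)
  have h5 : (q : ℤ) ∣ Q ^ w := by
    have h6 : (q : ℤ) ∣ κ ^ 2 - Q ^ w := (Dvd.intro _ (sq (q : ℤ)).symm).trans (Int.modEq_iff_dvd.1 hW)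
    have := dvd_sub (Dvd.dvd.pow h4 two_ne_zero) h6
    simpa using this
  exact hQ (hqp.dvd_of_dvd_pow h5)

/-- The quotient is V_{2w} = V_w² - 2Q^w with Q odd, so it is odd or congruent to 2 modulo 4. The
even index is essential: V_w itself may be divisible by 4. -/
theorem not_four_dvd_lucasInt_quot (hQ : ¬ (2 : ℤ) ∣ Q) (w : ℕ) :
    ¬ (4 : ℤ) ∣ lucasInt (lucasCompanion P Q (2 * w)) (Q ^ (2 * w)) 2 := by
  rw [lucasInt_add_two, lucasInt_one, lucasInt_zero, lucasCompanion_two_mul]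
  have hodd : Odd (Q ^ w) := by
    refine Odd.pow ?_
    rwa [← Int.not_even_iff_odd, even_iff_two_dvd]
  obtain ⟨u, hu⟩ := hodd
  rw [hu]
  rcases Int.even_or_odd (lucasCompanion P Q w) with ⟨v, hv⟩ | ⟨v, hv⟩
  · rw [hv]
    intro ⟨z, hz⟩
    have : (v + v) ^ 2 = 4 * v ^ 2 := by ring
    omega
  · rw [hv]
    intro ⟨z, hz⟩
    have : (2 * v + 1) ^ 2 = 4 * (v ^ 2 + v) + 1 := by ring
    omega

end Prime

/-! ### Lower bounds for cyclotomic values. -/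

/-- The homogeneous cyclotomic form `y ^ φ(d) Φ_d(x / y)`. -/
noncomputable def homCyclotomic (d : ℕ) (x y : ℝ) : ℝ :=
  y ^ d.totient * (Polynomial.cyclotomic d ℝ).eval (x / y)

theorem prod_homCyclotomic {n : ℕ} (hn : 0 < n) (x : ℝ) {y : ℝ} (hy : y ≠ 0) :
    ∏ d ∈ n.divisors, homCyclotomic d x y = x ^ n - y ^ n := by
  simp only [homCyclotomic]
  rw [Finset.prod_mul_distrib, Finset.prod_pow_eq_pow_sum, Nat.sum_totient, ← Polynomial.eval_prod,
    Polynomial.prod_cyclotomic_eq_X_pow_sub_one hn]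
  simp only [Polynomial.eval_sub, Polynomial.eval_pow, Polynomial.eval_X, Polynomial.eval_one]
  rw [mul_sub, div_pow]
  field_simp

theorem homCyclotomic_one (x : ℝ) {y : ℝ} (hy : y ≠ 0) : homCyclotomic 1 x y = x - y := by
  simp [homCyclotomic]
  field_simp

theorem isIntegral_homCyclotomic (d : ℕ) {x y : ℝ} (hy0 : y ≠ 0) (hx : IsIntegral ℤ x)
    (hy : IsIntegral ℤ y) : IsIntegral ℤ (homCyclotomic d x y) := by
  have h : homCyclotomic d x y = ∑ i ∈ Finset.range (d.totient + 1),
      ((Polynomial.cyclotomic d ℤ).coeff i : ℝ) * (x ^ i * y ^ (d.totient - i)) := by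
    rw [homCyclotomic, Polynomial.eval_eq_sum_range, Polynomial.natDegree_cyclotomic, Finset.mul_sum]
    refine Finset.sum_congr rfl fun i hi => ?_
    have hi' : i ≤ d.totient := by rw [Finset.mem_range] at hi; omega
    obtain ⟨k, hk⟩ := Nat.exists_eq_add_of_le hi'
    rw [← Polynomial.map_cyclotomic_int d ℝ, Polynomial.coeff_map, hk, Nat.add_sub_cancel_left, div_pow,
      pow_add]
    simp only [eq_intCast]
    field_simp
  rw [h]
  refine IsIntegral.sum _ fun i _ => IsIntegral.mul ?_ ((hx.pow i).mul (hy.pow _))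
  exact isIntegral_algebraMap (R := ℤ) (A := ℝ)

theorem abs_homCyclotomic (d : ℕ) {x y : ℝ} (hy : y ≠ 0) (hd : 0 < d) :
    |homCyclotomic d x y| = ∏ ζ ∈ primitiveRoots d ℂ, ‖(x : ℂ) - ζ * y‖ := by
  have hyc : (y : ℂ) ≠ 0 := by exact_mod_cast hy
  have hprim := Complex.isPrimitiveRoot_exp d hd.ne'
  have h1 : ((homCyclotomic d x y : ℝ) : ℂ) = (y : ℂ) ^ d.totient * (Polynomial.cyclotomic d ℂ).eval ((x : ℂ) / y) := by
    rw [homCyclotomic]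
    push_cast
    congr 1
    rw [← Polynomial.map_cyclotomic d Complex.ofRealHom, Polynomial.eval_map,
      show ((x : ℂ) / y) = Complex.ofRealHom (x / y) by simp, Polynomial.eval₂_at_apply]
    rfl
  rw [← Real.norm_eq_abs, ← Complex.norm_real, h1, Polynomial.cyclotomic_eq_prod_X_sub_primitiveRoots hprim,
    Polynomial.eval_prod, ← hprim.card_primitiveRoots, ← Finset.prod_const, ← Finset.prod_mul_distrib,
    norm_prod]
  refine Finset.prod_congr rfl fun ζ _ => ?_
  congr 1
  simp only [Polynomial.eval_sub, Polynomial.eval_X, Polynomial.eval_C]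
  field_simp

theorem norm_sub_root_mul_sq {ζ : ℂ} (hζ : ‖ζ‖ = 1) (x y : ℝ) :
    ‖(x : ℂ) - ζ * y‖ ^ 2 = x ^ 2 + y ^ 2 - 2 * (x * y) * ζ.re := by
  have h : ζ.re ^ 2 + ζ.im ^ 2 = 1 := by
    have := Complex.sq_norm ζ
    rw [hζ, Complex.normSq_apply] at this
    linarith
  rw [Complex.sq_norm, Complex.normSq_apply]
  simp
  linear_combination y ^ 2 * h

/-- |x - ζy|² depends on ζ only through its real part c, so the forms can be compared factor by
factor over the primitive roots. -/
theorem abs_homCyclotomic_le {d : ℕ} (hd : 0 < d) {x y a b : ℝ} (hy : y ≠ 0) (hb : b ≠ 0)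
    (h : ∀ c : ℝ, |c| ≤ 1 → a ^ 2 + b ^ 2 - 2 * (a * b) * c ≤ x ^ 2 + y ^ 2 - 2 * (x * y) * c) :
    |homCyclotomic d a b| ≤ |homCyclotomic d x y| := by
  rw [abs_homCyclotomic d hb hd, abs_homCyclotomic d hy hd]
  refine Finset.prod_le_prod (fun _ _ => norm_nonneg _) fun ζ hζ => ?_
  have hn : ‖ζ‖ = 1 := (isPrimitiveRoot_of_mem_primitiveRoots hζ).norm'_eq_one hd.ne'
  refine le_of_sq_le_sq ?_ (norm_nonneg _)
  rw [norm_sub_root_mul_sq hn, norm_sub_root_mul_sq hn]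
  refine h _ ?_
  rw [← hn]
  exact Complex.abs_re_le_norm ζ

theorem homCyclotomic_smul (d : ℕ) {a x : ℝ} (ha : a ≠ 0) :
    homCyclotomic d a (a * x) = a ^ d.totient * homCyclotomic d 1 x := by
  rw [homCyclotomic, homCyclotomic, mul_pow, mul_assoc]
  congr 3
  rcases eq_or_ne x 0 with rfl | hx
  · simp
  · field_simp

/-- Möbius inversion writes the value as a product of (1 - x^j)^(±1) or trivial factors over j
dividing n. Each is at least 1 - |x|^j, the inverses because 1/(1 + u) ≥ 1 - u, and the non-divisors
contribute further factors at most 1. -/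
theorem prod_one_sub_pow_le_abs_homCyclotomic {n : ℕ} (hn : 0 < n) {x : ℝ} (hx0 : x ≠ 0) (hx : |x| < 1) :
    ∏ j ∈ Finset.Icc 1 n, (1 - |x| ^ j) ≤ |homCyclotomic n 1 x| := by
  have hxj : ∀ j : ℕ, 0 < j → |x| ^ j < 1 := fun j hj => pow_lt_one₀ (abs_nonneg x) hx hj.ne'
  have hne : ∀ j : ℕ, 0 < j → (1 : ℝ) - x ^ j ≠ 0 := fun j hj h => by
    have h1 := hxj j hj
    rw [← abs_pow, ← sub_eq_zero.1 h, abs_one] at h1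
    exact lt_irrefl _ h1
  have hprod : ∀ m : ℕ, 0 < m → ∏ d ∈ m.divisors, homCyclotomic d 1 x = 1 - x ^ m := fun m hm => by
    rw [prod_homCyclotomic hm 1 hx0, one_pow]
  have hHne : ∀ m : ℕ, 0 < m → homCyclotomic m 1 x ≠ 0 := fun m hm h => by
    have h1 := hprod m hm
    rw [Finset.prod_eq_zero (Nat.mem_divisors_self m hm.ne') h] at h1
    exact hne m hm h1.symm
  have hmob := (ArithmeticFunction.prod_eq_iff_prod_pow_moebius_eq_of_nonzero (f := fun d => homCyclotomic d 1 x)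
    (g := fun m => 1 - x ^ m) hHne hne).1 hprod n hn
  rw [← hmob, Finset.abs_prod]
  have hanti : ∏ i ∈ n.divisorsAntidiagonal, |(1 - x ^ i.2) ^ ArithmeticFunction.moebius i.1|
      = ∏ j ∈ n.divisors, |(1 - x ^ j) ^ ArithmeticFunction.moebius (n / j)| :=
    Nat.prod_divisorsAntidiagonal' (n := n) (fun i j => |(1 - x ^ j) ^ ArithmeticFunction.moebius i|)
  rw [hanti]
  have hsub : n.divisors ⊆ Finset.Icc 1 n := fun j hj => by
    rw [Finset.mem_Icc]
    exact ⟨Nat.pos_of_mem_divisors hj, Nat.divisor_le hj⟩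
  have hpos : ∀ j ∈ Finset.Icc 1 n, 0 ≤ 1 - |x| ^ j := fun j hj => by
    have := hxj j (Finset.mem_Icc.1 hj).1
    linarith
  calc ∏ j ∈ Finset.Icc 1 n, (1 - |x| ^ j) ≤ ∏ j ∈ n.divisors, (1 - |x| ^ j) := by
        rw [← Finset.prod_sdiff hsub]
        refine mul_le_of_le_one_left (Finset.prod_nonneg fun j hj => hpos j (hsub hj)) ?_
        refine Finset.prod_le_one (fun j hj => hpos j (Finset.mem_sdiff.1 hj).1) fun j _ => ?_
        have : 0 ≤ |x| ^ j := by positivity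
        linarith
    _ ≤ _ := by
        refine Finset.prod_le_prod (fun j hj => hpos j (hsub hj)) fun j hj => ?_
        have hj0 := Nat.pos_of_mem_divisors hj
        have h1 := hxj j hj0
        have h0 : 0 ≤ |x| ^ j := by positivity
        have hxy : |x ^ j| = |x| ^ j := abs_pow x j
        have h2 := abs_le.1 hxy.le
        have h3 : 0 < 1 - x ^ j := by linarith
        rcases ArithmeticFunction.moebius_eq_or (n / j) with h | h | h
        · rw [h, zpow_zero, abs_one]; linarith
        · rw [h, zpow_one, abs_of_pos h3]; linarith
        · rw [h, zpow_neg_one, abs_of_pos (inv_pos.2 h3), ← one_div, le_div_iff₀ h3]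
          nlinarith

theorem prod_one_sub_pow_ge {y : ℝ} (hy0 : 0 ≤ y) (hy : y ≤ 382 / 1000) {n : ℕ} (hn : 4 ≤ n) :
    46 / 100 ≤ ∏ j ∈ Finset.Icc 1 n, (1 - y ^ j) := by
  obtain ⟨z, hz⟩ : ∃ z : ℝ, z = 382 / 1000 := ⟨_, rfl⟩
  rw [← hz] at hy
  have hz0 : 0 ≤ z := by rw [hz]; norm_num
  have hz1 : z ≤ 1 := by rw [hz]; norm_num
  -- The extra z^n is the slack that keeps the induction going; at n = 4 the product still exceeds
  -- 0.46 by that much.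
  have key : 46 / 100 + z ^ n ≤ ∏ j ∈ Finset.Icc 1 n, (1 - z ^ j) := by
    induction n, hn using Nat.le_induction with
    | base =>
      rw [show Finset.Icc 1 4 = {1, 2, 3, 4} by decide, hz]
      norm_num
    | succ n hn ih =>
      rw [Finset.prod_Icc_succ_top (by omega)]
      have h1 : z ^ n ≤ z ^ 4 := pow_le_pow_of_le_one hz0 hz1 hn
      have h2 : z ^ 4 ≤ 1 / 10 := by rw [hz]; norm_num
      have h3 : 0 ≤ z ^ n := by positivity
      have h4 : z ^ (n + 1) = z ^ n * (382 / 1000) := by rw [pow_succ, ← hz]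
      rw [h4]
      have h5 : 0 ≤ 1 - z ^ n * (382 / 1000) := by linarith
      have := mul_le_mul_of_nonneg_right ih h5
      nlinarith
  have hzn : 0 ≤ z ^ n := by positivity
  have hle : 46 / 100 ≤ ∏ j ∈ Finset.Icc 1 n, (1 - z ^ j) := by linarith
  refine hle.trans ?_
  refine Finset.prod_le_prod (fun j hj => ?_) fun j _ => ?_
  · have : z ^ j ≤ 1 := pow_le_one₀ hz0 hz1
    linarith
  · have : y ^ j ≤ z ^ j := by gcongr
    linarith

theorem goldenRatio_pow_gt {m : ℕ} (hm : 6 ≤ m) : (m : ℝ) + 1 < 46 / 100 * Real.goldenRatio ^ m := by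
  have hg : 1.618 < Real.goldenRatio := by
    rw [Real.goldenRatio]
    have : (2.236 : ℝ) < √5 := Real.lt_sqrt_of_sq_lt (by norm_num)
    linarith
  induction m, hm using Nat.le_induction with
  | base =>
    have : (1.618 : ℝ) ^ 6 ≤ Real.goldenRatio ^ 6 := by gcongr
    norm_num at this ⊢
    linarith
  | succ n hn ih =>
    rw [pow_succ]
    have hn' : (6 : ℝ) ≤ n := by exact_mod_cast hn
    push_cast
    nlinarith

/-- Lower bound for the cyclotomic factors of a real Lucas sequence. -/
theorem totient_add_one_lt_abs_homCyclotomic {n : ℕ} (hn : 4 ≤ n) (htot : 6 ≤ n.totient) {x y : ℝ}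
    {P Q : ℤ} (hsum : x + y = P) (hprod : x * y = Q) (hP : P ≠ 0) (hQ : Q ≠ 0) (hxy : x ≠ y) :
    (n.totient : ℝ) + 1 < |homCyclotomic n x y| := by
  have hy : y ≠ 0 := fun h => hQ (by rw [h, mul_zero] at hprod; exact_mod_cast hprod.symm)
  set a := Real.goldenRatio with ha
  have ha0 : 0 < a := Real.goldenRatio_pos
  have ha2 : a ^ 2 = a + 1 := Real.goldenRatio_sq
  have hainv : a * (a - 1) = 1 := by linear_combination ha2
  have hxle : a⁻¹ ^ 2 ≤ 382 / 1000 := by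
    have h1 : a⁻¹ = a - 1 := (eq_inv_of_mul_eq_one_right hainv).symm
    have h2 : (1.618 : ℝ) < a := by
      rw [ha, Real.goldenRatio]
      have : (2.236 : ℝ) < √5 := Real.lt_sqrt_of_sq_lt (by norm_num)
      linarith
    rw [h1]
    nlinarith
  -- The extremal pairs are (a, ε/a) with a the golden ratio: a² + 1/a² = 3 and the product is ε.
  -- The integrality bounds P² ≥ 1 for Q < 0 and P² - 4Q ≥ 1 for Q > 0 reduce to ε = -1 and ε = 1.
  have key : ∀ ε : ℝ, |ε| = 1 → (∀ c : ℝ, |c| ≤ 1 → 3 - 2 * ε * c ≤ x ^ 2 + y ^ 2 - 2 * (x * y) * c) →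
      (n.totient : ℝ) + 1 < |homCyclotomic n x y| := by
    intro ε hε h
    have hε2 : ε ^ 2 = 1 := by rw [← sq_abs, hε, one_pow]
    have hε0 : ε ≠ 0 := fun h0 => by rw [h0, abs_zero] at hε; exact zero_ne_one hε
    have hb : a * (ε * a⁻¹ ^ 2) ≠ 0 := by positivity
    have hab : a * (a * (ε * a⁻¹ ^ 2)) = ε := by field_simp
    have hsq : (a * (ε * a⁻¹ ^ 2)) ^ 2 = (a - 1) ^ 2 := by
      have h1 : a - 1 = a⁻¹ := (eq_inv_of_mul_eq_one_right hainv)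
      rw [h1, mul_pow, mul_pow, hε2]
      field_simp
    have h1 := abs_homCyclotomic_le (d := n) (by omega) hy hb (fun c hc => by
      refine le_trans (le_of_eq ?_) (h c hc)
      rw [hab, hsq]
      linear_combination 2 * ha2)
    rw [homCyclotomic_smul n ha0.ne', abs_mul, abs_of_pos (pow_pos ha0 _)] at h1
    have hx1 : |ε * a⁻¹ ^ 2| = a⁻¹ ^ 2 := by
      rw [abs_mul, hε, one_mul, abs_of_pos (by positivity)]
    have h2 := prod_one_sub_pow_le_abs_homCyclotomic (n := n) (by omega) (x := ε * a⁻¹ ^ 2) (by positivity)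
      (by rw [hx1]; linarith)
    rw [hx1] at h2
    have h3 := prod_one_sub_pow_ge (y := a⁻¹ ^ 2) (by positivity) hxle hn
    have h4 := goldenRatio_pow_gt htot
    have h5 : (0 : ℝ) < a ^ n.totient := by positivity
    have h6 := h3.trans h2
    nlinarith
  rcases lt_or_gt_of_ne hQ with hneg | hpos
  · refine key (-1) (by norm_num) fun c hc => ?_
    have hc' := abs_le.1 hc
    have h1 : (Q : ℝ) ≤ -1 := by exact_mod_cast Int.le_sub_one_of_lt hneg
    have h2 : (1 : ℝ) ≤ (P : ℝ) ^ 2 := by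
      have : 0 < P ^ 2 := by positivity
      exact_mod_cast this
    have h3 : x ^ 2 + y ^ 2 = (P : ℝ) ^ 2 - 2 * Q := by rw [← hsum, ← hprod]; ring
    rw [h3, hprod]
    nlinarith
  · refine key 1 (by norm_num) fun c hc => ?_
    have hc' := abs_le.1 hc
    have h1 : (1 : ℝ) ≤ (Q : ℝ) := by exact_mod_cast hpos
    have h2 : (1 : ℝ) ≤ (P : ℝ) ^ 2 - 4 * Q := by
      have h4 : (0 : ℝ) < (P : ℝ) ^ 2 - 4 * Q := by
        rw [← hsum, ← hprod, show (x + y) ^ 2 - 4 * (x * y) = (x - y) ^ 2 by ring]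
        have := sub_ne_zero.2 hxy
        positivity
      have h5 : 0 < P ^ 2 - 4 * Q := by exact_mod_cast h4
      exact_mod_cast h5
    have h3 : x ^ 2 + y ^ 2 = (P : ℝ) ^ 2 - 2 * Q := by rw [← hsum, ← hprod]; ring
    rw [h3, hprod]
    nlinarith

/-- A totient below 6 excludes the divisors 16, 9, 25 and every prime from 7 on, so n divides 120;
the remaining cases are checked. -/
theorem six_le_totient {n : ℕ} (hn : 13 ≤ n) : 6 ≤ n.totient := by
  by_contra hlt
  have hn0 : 0 < n := by omega
  have hdvd : ∀ m, m ∣ n → m.totient < 6 := fun m hm => by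
    have := Nat.le_of_dvd (Nat.totient_pos.2 hn0) (Nat.totient_dvd_of_dvd hm)
    omega
  have h16 : ¬ 16 ∣ n := fun h => by have := hdvd _ h; revert this; decide
  have h9 : ¬ 9 ∣ n := fun h => by have := hdvd _ h; revert this; decide
  have h25 : ¬ 25 ∣ n := fun h => by have := hdvd _ h; revert this; decide
  have hp : ∀ p : ℕ, p.Prime → p ∣ n → p ≤ 6 := fun p hp h => by
    have := hdvd _ h
    rw [Nat.totient_prime hp] at this
    omega
  have h120 : n ∣ 120 := by
    rw [← Nat.factorization_le_iff_dvd hn0.ne' (by norm_num), Finsupp.le_iff]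
    intro p hpn
    have hpp := Nat.prime_of_mem_primeFactors hpn
    have hpd := Nat.dvd_of_mem_primeFactors hpn
    have hle := hp p hpp hpd
    rw [← hpp.pow_dvd_iff_le_factorization (by norm_num)]
    have hcontra : ∀ k, ¬ p ^ (k + 1) ∣ n → n.factorization p ≤ k := fun k hk => by
      by_contra h
      exact hk ((hpp.pow_dvd_iff_le_factorization hn0.ne').2 (by omega))
    have h2 := hpp.two_le
    interval_cases p
    · exact (pow_dvd_pow 2 (hcontra 3 h16)).trans (by norm_num)
    · exact (pow_dvd_pow 3 (hcontra 1 h9)).trans (by norm_num)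
    · exact absurd hpp (by norm_num)
    · exact (pow_dvd_pow 5 (hcontra 1 h25)).trans (by norm_num)
    · exact absurd hpp (by norm_num)
  have hmem : n ∈ Nat.divisors 120 := Nat.mem_divisors.2 ⟨h120, by norm_num⟩
  have hall : ∀ m ∈ Nat.divisors 120, 13 ≤ m → 6 ≤ m.totient := by decide
  exact hlt (hall n hmem hn)

/-! ### Carmichael's theorem on primitive divisors. -/

theorem lucas_eq_lucasInt {φ φ' : ℝ} {P Q : ℤ} (hsum : φ + φ' = P) (hprod : φ * φ' = Q) (hne : φ ≠ φ')
    (n : ℕ) : lucas φ φ' n = lucasInt P Q n := by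
  rw [lucas, ← sub_mul_lucasInt hsum hprod n, mul_div_cancel_left₀ _ (sub_ne_zero.2 hne)]

theorem intDvd_intCast {p : ℕ} {z : ℤ} : IntDvd p (z : ℝ) ↔ (p : ℤ) ∣ z := by
  refine exists_congr fun k => ?_
  constructor <;> intro h
  · exact_mod_cast h
  · exact_mod_cast h

theorem isPrimitiveDivisor_iff {φ φ' : ℝ} {P Q : ℤ} (hsum : φ + φ' = P) (hprod : φ * φ' = Q)
    (hne : φ ≠ φ') {n p : ℕ} : IsPrimitiveDivisor φ φ' n p ↔
      p.Prime ∧ (p : ℤ) ∣ lucasInt P Q n ∧ ∀ i, 1 ≤ i → i < n → ¬ (p : ℤ) ∣ lucasInt P Q i := by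
  refine and_congr_right fun hp => ?_
  simp only [lucas_eq_lucasInt hsum hprod hne]
  rw [← Int.cast_prod, intDvd_intCast, intDvd_intCast,
    (Nat.prime_iff_prime_int.1 hp).dvd_finsetProd_iff]
  simp [Finset.mem_Ico]

theorem exists_intCast_of_isIntegral_of_rat {x : ℝ} (hx : IsIntegral ℤ x) {q : ℚ} (hq : x = q) :
    ∃ z : ℤ, (z : ℝ) = x := by
  have h1 : IsIntegral ℤ q := by
    refine (isIntegral_algebraMap_iff (R := ℤ) (A := ℚ) (B := ℝ) (algebraMap ℚ ℝ).injective).1 ?_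
    rwa [eq_ratCast, ← hq]
  obtain ⟨z, hz⟩ := IsIntegrallyClosed.isIntegral_iff.1 h1
  refine ⟨z, ?_⟩
  rw [hq, ← hz]
  simp

/-- The Lucas sequence factors over `ℤ` into cyclotomic parts. -/
theorem exists_int_homCyclotomic {φ φ' : ℝ} {P Q : ℤ} (hsum : φ + φ' = P) (hprod : φ * φ' = Q)
    (hQ : Q ≠ 0) (hne : φ ≠ φ') (hU : ∀ n, 1 ≤ n → lucasInt P Q n ≠ 0) :
    ∃ h : ℕ → ℤ, (∀ d, 2 ≤ d → (h d : ℝ) = homCyclotomic d φ φ') ∧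
      ∀ n, 1 ≤ n → ∏ d ∈ n.divisors.erase 1, h d = lucasInt P Q n := by
  have hy0 : φ' ≠ 0 := fun h => hQ (by rw [h, mul_zero] at hprod; exact_mod_cast hprod.symm)
  have hroot : ∀ x y : ℝ, x + y = P → x * y = Q → IsIntegral ℤ x := fun x y h1 h2 => by
    refine ⟨Polynomial.X ^ 2 - (Polynomial.C P * Polynomial.X - Polynomial.C Q), ?_, ?_⟩
    · refine Polynomial.monic_X_pow_sub (n := 2) (lt_of_le_of_lt (Polynomial.degree_sub_le _ _) ?_)
      refine max_lt ?_ (lt_of_le_of_lt Polynomial.degree_C_le (by norm_num))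
      exact lt_of_le_of_lt (Polynomial.degree_C_mul_X_le P) (by norm_num)
    · simp only [Polynomial.eval₂_sub, Polynomial.eval₂_pow, Polynomial.eval₂_X, Polynomial.eval₂_mul,
        Polynomial.eval₂_C]
      simp only [eq_intCast]
      rw [← h1, ← h2]
      ring
  have hfac : ∀ n, 1 ≤ n → ∏ d ∈ n.divisors.erase 1, homCyclotomic d φ φ' = lucasInt P Q n := fun n hn => by
    have h1 := prod_homCyclotomic hn φ hy0
    rw [← Finset.mul_prod_erase _ _ (Nat.one_mem_divisors.2 (by omega)), homCyclotomic_one φ hy0,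
      ← sub_mul_lucasInt hsum hprod n] at h1
    exact mul_left_cancel₀ (sub_ne_zero.2 hne) h1
  -- Rationality comes by induction on d, dividing U_d by the factors of the smaller divisors.
  -- Together with integrality over ℤ it makes each cyclotomic value an integer.
  have hrat : ∀ d, 2 ≤ d → ∃ q : ℚ, homCyclotomic d φ φ' = q := by
    intro d
    induction d using Nat.strong_induction_on with
    | _ d ih =>
      intro hd
      have h1 := hfac d (by omega)
      have hmem : d ∈ d.divisors.erase 1 := by simp; omega
      rw [← Finset.mul_prod_erase _ _ hmem] at h1
      have h2 : ∃ q : ℚ, ∏ e ∈ (d.divisors.erase 1).erase d, homCyclotomic e φ φ' = q := by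
        have h3 : ∀ e ∈ (d.divisors.erase 1).erase d, ∃ q : ℚ, homCyclotomic e φ φ' = q := fun e he => by
          simp only [Finset.mem_erase, Nat.mem_divisors] at he
          have h4 := Nat.le_of_dvd (by omega) he.2.2.1
          have h5 := Nat.pos_of_dvd_of_pos he.2.2.1 (by omega)
          exact ih e (by omega) (by omega)
        choose! f hf using h3
        refine ⟨∏ e ∈ (d.divisors.erase 1).erase d, f e, ?_⟩
        rw [Rat.cast_prod]
        exact Finset.prod_congr rfl hf
      obtain ⟨q, hq⟩ := h2
      rw [hq] at h1
      have hq0 : (q : ℝ) ≠ 0 := fun h0 => by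
        rw [h0, mul_zero] at h1
        exact hU d (by omega) (by exact_mod_cast h1.symm)
      refine ⟨lucasInt P Q d / q, ?_⟩
      push_cast
      rw [← h1, mul_div_cancel_right₀ _ hq0]
  have hint : ∀ d, 2 ≤ d → ∃ z : ℤ, (z : ℝ) = homCyclotomic d φ φ' := fun d hd => by
    obtain ⟨q, hq⟩ := hrat d hd
    refine exists_intCast_of_isIntegral_of_rat (isIntegral_homCyclotomic d hy0 (hroot φ φ' hsum hprod)
      (hroot φ' φ (by rw [add_comm, hsum]) (by rw [mul_comm, hprod]))) hq
  choose! h hh using hint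
  refine ⟨h, hh, fun n hn => ?_⟩
  have h1 := hfac n hn
  have h2 : ((∏ d ∈ n.divisors.erase 1, h d : ℤ) : ℝ) = lucasInt P Q n := by
    rw [← h1, Int.cast_prod]
    refine Finset.prod_congr rfl fun d hd => hh d ?_
    rw [Finset.mem_erase] at hd
    have := Nat.pos_of_mem_divisors hd.2
    omega
  exact_mod_cast h2

/-- The index kw is a divisor of kw that does not divide w, so its factor survives when U_w is
cancelled from U_{kw}. -/
theorem dvd_lucasInt_quot_of_prod_eq {P Q : ℤ} (hU : ∀ n, 1 ≤ n → lucasInt P Q n ≠ 0) {h : ℕ → ℤ}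
    (hfac : ∀ n, 1 ≤ n → ∏ d ∈ n.divisors.erase 1, h d = lucasInt P Q n) {k w : ℕ} (hk : 2 ≤ k)
    (hw : 1 ≤ w) : h (k * w) ∣ lucasInt (lucasCompanion P Q w) (Q ^ w) k := by
  have hlt : w < k * w := by nlinarith
  have hnot : k * w ∉ w.divisors.erase 1 := fun hm => by
    have := Nat.divisor_le (Finset.mem_of_mem_erase hm)
    omega
  have hsub : insert (k * w) (w.divisors.erase 1) ⊆ (k * w).divisors.erase 1 := by
    intro d hd
    rw [Finset.mem_insert] at hd
    rcases hd with rfl | hd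
    · simp; omega
    · rw [Finset.mem_erase] at hd ⊢
      exact ⟨hd.1, Nat.divisors_subset_of_dvd (by omega) (Dvd.intro_left k rfl) hd.2⟩
  have h1 := Finset.prod_dvd_prod_of_subset _ _ h hsub
  rw [Finset.prod_insert hnot, hfac w hw, hfac (k * w) (by omega), lucasInt_mul, mul_comm] at h1
  exact (mul_dvd_mul_iff_left (hU w hw)).1 h1

theorem exists_rank {P Q : ℤ} {q : ℕ} (hq : q.Prime) (hQ : ¬ (q : ℤ) ∣ Q) :
    ∃ r, 1 ≤ r ∧ r ≤ q + 1 ∧ (q : ℤ) ∣ lucasInt P Q r ∧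
      ∀ n, 1 ≤ n → (q : ℤ) ∣ lucasInt P Q n → r ∣ n := by
  classical
  have hex := exists_dvd_lucasInt hq P hQ
  have hex' : ∃ r, 1 ≤ r ∧ (q : ℤ) ∣ lucasInt P Q r := hex.imp fun r hr => ⟨hr.1, hr.2.2⟩
  obtain ⟨s, hs1, hs2, hs3⟩ := hex
  obtain ⟨hr1, hr2⟩ := Nat.find_spec hex'
  refine ⟨Nat.find hex', hr1, (Nat.find_min' hex' ⟨hs1, hs3⟩).trans hs2, hr2, fun n _ hn => ?_⟩
  by_contra hnd
  set r := Nat.find hex'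
  have h1 : 1 ≤ n % r := Nat.one_le_iff_ne_zero.2 fun h0 => hnd (Nat.dvd_of_mod_eq_zero h0)
  have h2 : (q : ℤ) ∣ lucasInt P Q (n % r) := by
    refine dvd_lucasInt_sub hq hQ (m := n / r * r) (hr2.trans (lucasInt_dvd_mul P Q r _)) ?_
    rwa [mul_comm, Nat.div_add_mod]
  exact Nat.find_min hex' (Nat.mod_lt n hr1) ⟨h1, h2⟩

/-- An index `n ≥ 13` whose cyclotomic part `H` exceeds `φ(n) + 1` has a primitive prime divisor. -/
theorem exists_primitive_prime {P Q : ℤ} (hPQ : IsCoprime P Q) {n : ℕ} (hn : 13 ≤ n) {H : ℤ}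
    (hH : ∀ k w, 2 ≤ k → 1 ≤ w → k * w = n → H ∣ lucasInt (lucasCompanion P Q w) (Q ^ w) k)
    (hlarge : n.totient + 1 < H.natAbs) :
    ∃ q : ℕ, q.Prime ∧ (q : ℤ) ∣ lucasInt P Q n ∧ ∀ i, 1 ≤ i → i < n → ¬ (q : ℤ) ∣ lucasInt P Q i := by
  by_contra! hcon
  have hHU : H ∣ lucasInt P Q n := by
    have h1 := lucasInt_mul P Q 1 n
    rw [mul_one, lucasInt_one, one_mul] at h1
    rw [h1]
    exact hH n 1 (by omega) le_rfl (mul_one n)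
  have key : ∀ q : ℕ, q.Prime → (q : ℤ) ∣ H → ¬ (q : ℤ) ∣ Q ∧
      ∃ r k, 1 ≤ r ∧ r ≤ q + 1 ∧ n = r * q ^ (k + 1) ∧ (q : ℤ) ∣ lucasInt P Q r := by
    intro q hq hqH
    have hqn := hqH.trans hHU
    have hqQ := not_dvd_of_dvd_lucasInt hPQ hq (by omega) hqn
    obtain ⟨i, hi1, hin, hqi⟩ := hcon q hq hqn
    obtain ⟨r, hr1, hrq, hr, hrmin⟩ := exists_rank (P := P) hq hqQ
    have hri := Nat.le_of_dvd (by omega) (hrmin i hi1 hqi)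
    obtain ⟨m, hm⟩ := hrmin n (by omega) hqn
    have hm0 : m ≠ 0 := by rintro rfl; omega
    -- If a prime l divides n/r, then q divides U_{n/l} and also, through H, the quotient
    -- U_n/U_{n/l}; this forces l = q. Hence n/r is a power of q.
    have huniq : ∀ {l : ℕ}, l.Prime → l ∣ m → l = q := fun {l} hl hlm => by
      obtain ⟨t, rfl⟩ := hlm
      have ht : 1 ≤ t := Nat.one_le_iff_ne_zero.2 fun h0 => hm0 (by simp [h0])
      have hw : (q : ℤ) ∣ lucasInt P Q (t * r) := hr.trans (lucasInt_dvd_mul P Q r t)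
      refine (eq_of_dvd_lucasInt_quot hq hqQ hl hw (hqH.trans (hH l (t * r) hl.two_le ?_ ?_))).symm
      · exact Nat.mul_pos ht hr1
      · rw [hm]; ring
    have hpow := Nat.eq_prime_pow_of_unique_prime_dvd hm0 huniq
    obtain ⟨k, hk⟩ : ∃ k, m = q ^ k := ⟨_, hpow⟩
    rcases k with _ | k
    · rw [hk, pow_zero, mul_one] at hm
      omega
    · exact ⟨hqQ, r, k, hr1, hrq, by rw [hm, hk], hr⟩
  have hsq : ∀ q : ℕ, q.Prime → ¬ (q : ℤ) ^ 2 ∣ H := by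
    intro q hq hsq
    obtain ⟨hqQ, r, k, hr1, hrq, hnr, hr⟩ := key q hq ((dvd_pow_self _ two_ne_zero).trans hsq)
    have hq1 := hq.pos
    by_cases hq2 : q = 2
    · subst hq2
      rcases k with _ | k
      · omega
      · refine not_four_dvd_lucasInt_quot (P := P) hqQ (r * 2 ^ k) ?_
        refine Dvd.dvd.trans (by exact_mod_cast hsq) (hH 2 (2 * (r * 2 ^ k)) le_rfl ?_ ?_)
        · exact Nat.mul_pos two_pos (Nat.mul_pos hr1 (pow_pos two_pos k))
        · rw [hnr]; ring
    · refine not_sq_dvd_lucasInt_quot_of_odd hq hq2 hqQ (w := q ^ k * r)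
        (hr.trans (lucasInt_dvd_mul P Q r _)) (hsq.trans (hH q (q ^ k * r) hq.two_le ?_ ?_))
      · exact Nat.mul_pos (pow_pos hq1 k) hr1
      · rw [hnr]; ring
  have hlt : ∀ q₁ q₂ : ℕ, q₁.Prime → q₂.Prime → (q₁ : ℤ) ∣ H → (q₂ : ℤ) ∣ H → ¬ q₁ < q₂ := by
    intro q₁ q₂ h1 h2 hd1 hd2 hlt
    obtain ⟨-, r₁, k₁, hr1, hrq1, hn1, -⟩ := key q₁ h1 hd1
    obtain ⟨-, r₂, k₂, hr2, hrq2, hn2, -⟩ := key q₂ h2 hd2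
    have hdr : q₂ ∣ r₁ := by
      have h3 : q₂ ∣ r₁ * q₁ ^ (k₁ + 1) := by
        rw [← hn1, hn2]
        exact Dvd.dvd.mul_left (dvd_pow_self _ (by omega)) _
      refine (h2.dvd_mul.1 h3).resolve_right fun h4 => ?_
      exact hlt.ne' ((Nat.prime_dvd_prime_iff_eq h2 h1).1 (h2.dvd_of_dvd_pow h4))
    have hle := Nat.le_of_dvd (by omega) hdr
    -- The larger prime divides r₁ ≤ q₁ + 1, so the two primes are consecutive integers, namely 2
    -- and 3, and r₁ = 3.
    have hq₂ : q₂ = q₁ + 1 := by omega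
    have hq₁ : q₁ = 2 := by
      by_contra hne
      have hodd := h1.odd_of_ne_two hne
      have h3 := h2.eq_two_or_odd'
      rw [hq₂] at h3
      rcases h3 with h3 | h3
      · have := h1.two_le
        omega
      · exact (Nat.not_even_iff_odd.2 h3) hodd.add_one
    subst hq₁
    have hr₁ : r₁ = 3 := by omega
    subst hq₂ hr₁
    -- If n = 3r₂ with r₂ ≤ 4, then n ≤ 12, against n ≥ 13; otherwise 9 divides n = 3·2^(k₁+1).
    rcases k₂ with _ | k₂
    · omega
    · have h3 : 3 ∣ 2 ^ (k₁ + 1) := by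
        refine ⟨r₂ * 3 ^ k₂, ?_⟩
        have h4 : 3 * 2 ^ (k₁ + 1) = r₂ * 3 ^ (k₂ + 1 + 1) := by
          rw [← hn1]; exact hn2
        refine Nat.eq_of_mul_eq_mul_left three_pos (h4.trans ?_)
        ring
      exact absurd (Nat.prime_three.dvd_of_dvd_pow h3) (by norm_num)
  have hne1 : H.natAbs ≠ 1 := by omega
  obtain ⟨q, hq, hqd⟩ := Nat.exists_prime_and_dvd hne1
  have hqH : (q : ℤ) ∣ H := Int.natCast_dvd.2 hqd
  have hpow := Nat.eq_prime_pow_of_unique_prime_dvd (n := H.natAbs) (p := q) (by omega)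
    fun {l} hl hld => by
      have hlH : (l : ℤ) ∣ H := Int.natCast_dvd.2 hld
      have h1 := hlt l q hl hq hlH hqH
      have h2 := hlt q l hq hl hqH hlH
      omega
  obtain ⟨j, hj⟩ : ∃ j, H.natAbs = q ^ j := ⟨_, hpow⟩
  have hj1 : j ≤ 1 := by
    by_contra hj2
    refine hsq q hq ?_
    rw [← Nat.cast_pow, Int.natCast_dvd, hj]
    exact pow_dvd_pow q (by omega)
  have hHq : H.natAbs ≤ q := by
    rw [hj]
    exact (Nat.pow_le_pow_right hq.pos hj1).trans (pow_one q).le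
  obtain ⟨-, r, k, -, -, hnr, -⟩ := key q hq hqH
  have hqn : q ∣ n := by
    rw [hnr]
    exact Dvd.dvd.mul_left (dvd_pow_self _ (by omega)) _
  -- Since q divides n, q - 1 is at most the totient of n, so |H| ≤ q contradicts the size
  -- assumption.
  have h1 := Nat.le_of_dvd (Nat.totient_pos.2 (by omega)) (Nat.totient_dvd_of_dvd hqn)
  rw [Nat.totient_prime hq] at h1
  omega

/-- Carmichael's theorem for real Lucas sequences. -/
theorem exists_isPrimitiveDivisor {φ φ' : ℝ} {P Q : ℤ} (hsum : φ + φ' = P) (hprod : φ * φ' = Q)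
    (hP : P ≠ 0) (hQ : Q ≠ 0) (hPQ : IsCoprime P Q) (hne : φ ≠ φ')
    (hU : ∀ n, 1 ≤ n → lucasInt P Q n ≠ 0) {n : ℕ} (hn : 13 ≤ n) :
    ∃ p, IsPrimitiveDivisor φ φ' n p := by
  obtain ⟨h, hh, hfac⟩ := exists_int_homCyclotomic hsum hprod hQ hne hU
  have hbig := totient_add_one_lt_abs_homCyclotomic (by omega) (six_le_totient hn) hsum hprod hP hQ hne
  rw [← hh n (by omega), ← Int.cast_abs, ← Int.natCast_natAbs] at hbig
  simp only [isPrimitiveDivisor_iff hsum hprod hne]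
  refine exists_primitive_prime hPQ hn (H := h n) (fun k w hk hw hkw => ?_) (by exact_mod_cast hbig)
  rw [← hkw]
  exact dvd_lucasInt_quot_of_prod_eq hU hfac hk hw

/-! ### Freeness of the monoid and its weights. -/

/-- Natural numbers `w j` with primes `p j ∣ w j` not dividing the earlier terms are
multiplicatively independent. -/
theorem eq_of_prod_pow_eq {w p : ℕ → ℕ} (hp : ∀ j, (p j).Prime) (hw : ∀ j, 0 < w j)
    (hd : ∀ j, p j ∣ w j) (hnd : ∀ i j, i < j → ¬ p j ∣ w i) (e e' : ℕ → ℕ) (N : ℕ)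
    (h : ∏ i ∈ Finset.range N, w i ^ e i = ∏ i ∈ Finset.range N, w i ^ e' i) :
    ∀ i < N, e i = e' i := by
  induction N with
  | zero => intro i hi; omega
  | succ N ih =>
    have hno : ∀ f : ℕ → ℕ, ¬ p N ∣ ∏ i ∈ Finset.range N, w i ^ f i := fun f hdvd => by
      obtain ⟨i, hi, hi'⟩ := ((hp N).prime.dvd_finsetProd_iff _).1 hdvd
      exact hnd i N (Finset.mem_range.1 hi) ((hp N).dvd_of_dvd_pow hi')
    -- The last exponent is determined first: after cancelling the common power of `w N`, a surplus
    -- on one side would make `p N` divide a product of earlier terms.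
    have hlt : ∀ f g : ℕ → ℕ, ∏ i ∈ Finset.range (N + 1), w i ^ f i
        = ∏ i ∈ Finset.range (N + 1), w i ^ g i → ¬ f N < g N := fun f g hfg hl => by
      obtain ⟨k, hk⟩ := Nat.exists_eq_add_of_lt hl
      rw [Finset.prod_range_succ, Finset.prod_range_succ, hk, add_assoc, pow_add, mul_left_comm,
        mul_comm _ (w N ^ f N)] at hfg
      have h1 := Nat.eq_of_mul_eq_mul_left (pow_pos (hw N) _) hfg
      refine hno f ?_
      rw [h1]
      exact Dvd.dvd.mul_left ((hd N).trans (dvd_pow_self _ (by omega))) _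
    have hN : e N = e' N := le_antisymm (not_lt.1 (hlt e' e h.symm)) (not_lt.1 (hlt e e' h))
    rw [Finset.prod_range_succ, Finset.prod_range_succ, hN] at h
    have h1 := ih (Nat.eq_of_mul_eq_mul_right (pow_pos (hw N) _) h)
    intro i hi
    rcases Nat.lt_succ_iff_lt_or_eq.1 hi with h2 | rfl
    · exact h1 i h2
    · exact hN

theorem ncard_closure_range_eq_weightCount {w p : ℕ → ℕ} (hp : ∀ j, (p j).Prime) (hw : ∀ j, 0 < w j)
    (hd : ∀ j, p j ∣ w j) (hnd : ∀ i j, i < j → ¬ p j ∣ w i) {x : ℝ} (hx : 0 < x) :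
    {m : ℕ | m ∈ Submonoid.closure (Set.range w) ∧ 1 ≤ m ∧ (m : ℝ) ≤ x}.ncard
      = weightCount (fun j => Real.log (w j)) (Real.log x) := by
  set f : (ℕ →₀ ℕ) → ℕ := fun e => e.prod fun j k => w j ^ k with hf
  have hpos : ∀ e, 0 < f e := fun e => Finset.prod_pos fun j _ => pow_pos (hw j) _
  have hlog : ∀ e, Real.log (f e) = e.sum fun j k => (k : ℝ) * Real.log (w j) := fun e => by
    simp only [hf, Finsupp.prod, Finsupp.sum]
    push_cast
    rw [Real.log_prod fun j _ => pow_ne_zero _ (by exact_mod_cast (hw j).ne')]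
    simp
  have hinj : Function.Injective f := fun e e' h => by
    obtain ⟨N, hN⟩ : ∃ N, e.support ∪ e'.support ⊆ Finset.range N :=
      ⟨_, Finset.subset_range_sup_succ _⟩
    have h1 : f e = ∏ i ∈ Finset.range N, w i ^ e i :=
      Finsupp.prod_of_support_subset _ (Finset.union_subset_left hN) _ fun i _ => pow_zero _
    have h2 : f e' = ∏ i ∈ Finset.range N, w i ^ e' i :=
      Finsupp.prod_of_support_subset _ (Finset.union_subset_right hN) _ fun i _ => pow_zero _
    rw [h1, h2] at h
    have h3 := eq_of_prod_pow_eq hp hw hd hnd e e' N h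
    ext i
    by_cases hi : i < N
    · exact h3 i hi
    · have h4 : ∀ g : ℕ →₀ ℕ, g.support ⊆ Finset.range N → g i = 0 := fun g hg =>
        Finsupp.notMem_support_iff.1 fun hm => hi (Finset.mem_range.1 (hg hm))
      rw [h4 e (Finset.union_subset_left hN), h4 e' (Finset.union_subset_right hN)]
  rw [weightCount, ← Set.ncard_image_of_injective _ hinj]
  congr 1
  ext m
  simp only [Set.mem_ofPred_eq, Set.mem_image, Submonoid.mem_closure_range_iff]
  constructor
  · rintro ⟨⟨e, rfl⟩, -, hm⟩
    refine ⟨e, ?_, rfl⟩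
    rw [← hlog]
    exact Real.log_le_log (by exact_mod_cast hpos e) hm
  · rintro ⟨e, he, rfl⟩
    refine ⟨⟨e, rfl⟩, hpos e, ?_⟩
    rw [← hlog] at he
    exact (Real.log_le_log_iff (by exact_mod_cast hpos e) hx).1 he

theorem nth_count_add {p : ℕ → Prop} [DecidablePred p] {N : ℕ} (h : ∀ n, N ≤ n → p n) (m : ℕ) :
    Nat.nth p (Nat.count p N + m) = N + m := by
  have h1 : Nat.count p (N + m) = Nat.count p N + m := by
    induction m with
    | zero => rfl
    | succ m ih => rw [← add_assoc, Nat.count_succ, ih, if_pos (h _ (by omega)), add_assoc]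
  rw [← h1, Nat.nth_count (h _ (by omega))]

/-- Indices are counted on the left and values on the right. They agree because a primitive divisor
of the later of two equal values would also divide the earlier one. -/
theorem count_isPrimitive_eq_ncard {φ φ' : ℝ} {P Q : ℤ} (hsum : φ + φ' = P) (hprod : φ * φ' = Q)
    (hne : φ ≠ φ') (hU : ∀ n, 1 ≤ n → 0 < lucasInt P Q n)
    [DecidablePred fun n => 1 ≤ n ∧ ∃ p, IsPrimitiveDivisor φ φ' n p] :
    Nat.count (fun n => 1 ≤ n ∧ ∃ p, IsPrimitiveDivisor φ φ' n p) 13 = (lucasSet₀ φ φ').ncard := by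
  rw [Nat.count_eq_card_filter_range, ← Set.ncard_coe_finset]
  have himg : lucasSet₀ φ φ' = (fun n => (lucasInt P Q n).toNat) ''
      ((Finset.range 13).filter fun n => 1 ≤ n ∧ ∃ p, IsPrimitiveDivisor φ φ' n p : Finset ℕ) := by
    ext m
    simp only [lucasSet₀, Set.mem_ofPred_eq, Set.mem_image, Finset.coe_filter, Finset.mem_range,
      lucas_eq_lucasInt hsum hprod hne]
    constructor
    · rintro ⟨n, h1, h2, h3, h4⟩
      refine ⟨n, ⟨by omega, h1, h4⟩, ?_⟩
      have h5 : (m : ℤ) = lucasInt P Q n := by exact_mod_cast h3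
      omega
    · rintro ⟨n, ⟨h1, h2, h3⟩, rfl⟩
      refine ⟨n, h2, by omega, ?_, h3⟩
      rw [← Int.cast_natCast, Int.toNat_of_nonneg (hU n h2).le]
  rw [himg]
  refine (Set.InjOn.ncard_image ?_).symm
  have hlt : ∀ a b, 1 ≤ a → (∃ p, IsPrimitiveDivisor φ φ' b p) →
      lucasInt P Q a = lucasInt P Q b → ¬ a < b := by
    rintro a b ha ⟨p, hp⟩ hab hl
    obtain ⟨-, h1, h2⟩ := (isPrimitiveDivisor_iff hsum hprod hne).1 hp
    exact h2 a ha hl (by rwa [hab])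
  intro a ha b hb hab
  simp only [Finset.coe_filter, Set.mem_ofPred_eq] at ha hb
  have h1 := hU a ha.2.1
  have h2 := hU b hb.2.1
  have h3 : lucasInt P Q a = lucasInt P Q b := by
    simp only at hab
    omega
  exact le_antisymm (not_lt.1 (hlt b a hb.2.1 ha.2.2 h3.symm)) (not_lt.1 (hlt a b ha.2.1 hb.2.2 h3))

theorem log_lucas {φ φ' : ℝ} (hφ : |φ'| < φ) {n : ℕ} (hn : 1 ≤ n) :
    Real.log (lucas φ φ' n) = n * Real.log φ - Real.log (φ - φ') + Real.log (1 + -(φ' / φ) ^ n) := by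
  have h0 : 0 < φ := (abs_nonneg _).trans_lt hφ
  have hlt := (abs_lt.1 hφ).2
  have h1 : φ' ^ n < φ ^ n := (le_abs_self _).trans_lt (by
    rw [abs_pow]
    exact pow_lt_pow_left₀ hφ (abs_nonneg _) (by omega))
  have h2 : φ ^ n - φ' ^ n = φ ^ n * (1 + -(φ' / φ) ^ n) := by
    rw [div_pow]
    field_simp
    ring
  have h3 : 0 < 1 + -(φ' / φ) ^ n := by
    have h4 : 0 < φ ^ n := by positivity
    rw [← mul_pos_iff_of_pos_left h4, ← h2]
    linarith
  rw [lucas, h2, Real.log_div (by positivity) (by linarith), Real.log_mul (by positivity) h3.ne',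
    Real.log_pow]
  ring

/-- The counting function of the Lucas monoid is that of an almost arithmetic weight sequence. -/
theorem exists_weights {φ φ' : ℝ} {P Q : ℤ} (hsum : φ + φ' = P) (hprod : φ * φ' = Q)
    (hP : P ≠ 0) (hQ : Q ≠ 0) (hPQ : IsCoprime P Q) (hφ : |φ'| < φ) :
    ∃ ν : ℕ → ℝ, (∀ j, 0 < ν j) ∧
      (Summable fun j : ℕ => |ν j - (j * Real.log φ +
        ((13 - ((lucasSet₀ φ φ').ncard : ℝ)) * Real.log φ - Real.log (φ - φ')))|) ∧
      ∀ x : ℝ, 0 < x → count φ φ' x = weightCount ν (Real.log x) := by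
  classical
  have h0 : 0 < φ := (abs_nonneg _).trans_lt hφ
  have hlt := (abs_lt.1 hφ).2
  have hne : φ ≠ φ' := hlt.ne'
  have hU : ∀ n, 1 ≤ n → 0 < lucasInt P Q n := fun n hn => by
    have h1 : φ' ^ n < φ ^ n := (le_abs_self _).trans_lt (by
      rw [abs_pow]
      exact pow_lt_pow_left₀ hφ (abs_nonneg _) (by omega))
    have h2 : (0 : ℝ) < lucasInt P Q n := by
      rw [← lucas_eq_lucasInt hsum hprod hne]
      exact div_pos (by linarith) (by linarith)
    exact_mod_cast h2
  set pr : ℕ → Prop := fun n => 1 ≤ n ∧ ∃ p, IsPrimitiveDivisor φ φ' n p with hpr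
  have hlarge : ∀ n, 13 ≤ n → pr n := fun n hn =>
    ⟨by omega, exists_isPrimitiveDivisor hsum hprod hP hQ hPQ hne (fun n hn => (hU n hn).ne') hn⟩
  have hinf : (Set.ofPred pr).Infinite :=
    (Set.Ici_infinite 13).mono fun n hn => hlarge n hn
  have hmem : ∀ j, pr (Nat.nth pr j) := Nat.nth_mem_of_infinite hinf
  have hmono := Nat.nth_strictMono hinf
  have hcard : Nat.count pr 13 = (lucasSet₀ φ φ').ncard := count_isPrimitive_eq_ncard hsum hprod hne hU
  obtain ⟨w, hw⟩ : ∃ w : ℕ → ℕ, ∀ j, (w j : ℤ) = lucasInt P Q (Nat.nth pr j) :=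
    ⟨fun j => (lucasInt P Q (Nat.nth pr j)).toNat, fun j => Int.toNat_of_nonneg (hU _ (hmem j).1).le⟩
  have hwr : ∀ j, (w j : ℝ) = lucas φ φ' (Nat.nth pr j) := fun j => by
    rw [lucas_eq_lucasInt hsum hprod hne, ← hw, Int.cast_natCast]
  have hwpos : ∀ j, 0 < w j := fun j => by
    have := hU _ (hmem j).1
    rw [← hw] at this
    exact_mod_cast this
  choose p hp using fun j => (hmem j).2
  simp only [isPrimitiveDivisor_iff hsum hprod hne] at hp
  have hd : ∀ j, p j ∣ w j := fun j => by
    have := (hp j).2.1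
    rw [← hw] at this
    exact_mod_cast this
  have hnd : ∀ i j, i < j → ¬ p j ∣ w i := fun i j hij h => by
    refine (hp j).2.2 _ (hmem i).1 (hmono hij) ?_
    rw [← hw]
    exact_mod_cast h
  have hrange : lucasSet φ φ' = Set.range w := by
    ext m
    constructor
    · rintro ⟨n, hn, hm, hpn⟩
      refine ⟨Nat.count pr n, ?_⟩
      have h1 : Nat.nth pr (Nat.count pr n) = n := Nat.nth_count (p := pr) ⟨hn, hpn⟩
      have h2 := hwr (Nat.count pr n)
      rw [h1, ← hm] at h2
      exact_mod_cast h2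
    · rintro ⟨j, rfl⟩
      exact ⟨_, (hmem j).1, hwr j, (hmem j).2⟩
  refine ⟨fun j => Real.log (w j), fun j => ?_, ?_, fun x hx => ?_⟩
  · have h2 : 2 ≤ w j := (hp j).1.two_le.trans (Nat.le_of_dvd (hwpos j) (hd j))
    exact Real.log_pos (by exact_mod_cast h2)
  -- From position |F₀| on, the generator at position |F₀| + m has index 13 + m; this shift produces
  -- (13 - |F₀|) log φ in b. The deviation is then log(1 - (φ'/φ)^(13+m)), which decays
  -- geometrically.
  · rw [← summable_nat_add_iff (Nat.count pr 13)]
    have hρ : |φ' / φ| < 1 := by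
      rw [abs_div, abs_of_pos h0, div_lt_one h0]
      exact hφ
    have h1 : Summable fun m : ℕ => -(φ' / φ) ^ (m + 13) :=
      ((summable_nat_add_iff 13).2 (summable_geometric_of_abs_lt_one hρ)).neg
    refine (Real.summable_log_one_add_of_summable h1).abs.congr fun m => ?_
    congr 1
    beta_reduce
    rw [hwr, add_comm m (Nat.count pr 13), nth_count_add hlarge, log_lucas hφ (by omega), add_comm 13 m, hcard]
    push_cast
    ring
  · rw [count, lucasMonoid, hrange]
    exact ncard_closure_range_eq_weightCount (fun j => (hp j).1) hwpos hd hnd hx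

end LucasMonoid

/-! ### The counting theorem. -/

theorem theorem1 (φ φ' : ℝ) (P Q : ℤ) (hsum : φ + φ' = (P : ℝ)) (hprod : φ * φ' = (Q : ℝ))
    (hP : P ≠ 0) (hQ : Q ≠ 0) (hPQ : IsCoprime P Q) (hφ : |φ'| < φ) :
    ∃ k₀ : ℝ, 0 < k₀ ∧ ∃ E : ℝ → ℝ,
      E =O[Filter.atTop] (fun x : ℝ => 1 / Real.log x ^ (1 / 10 : ℝ)) ∧
      ∀ᶠ x : ℝ in Filter.atTop,
        (LucasMonoid.count φ φ' x : ℝ) =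
          k₀ * Real.log x ^ ((((LucasMonoid.lucasSet₀ φ φ').ncard : ℝ) - 13) / 2
              + Real.log (φ - φ') / (2 * Real.log φ))
            * Real.exp (Real.pi * Real.sqrt (2 * Real.log x / (3 * Real.log φ)))
            * (1 + E x) := by
  have h0 : 0 < φ := (abs_nonneg _).trans_lt hφ
  -- As |φφ'| = |Q| ≥ 1 and |φ'| < φ, the larger root exceeds 1, so L = log φ is positive.
  have h1 : 1 < φ := by
    have h2 : (1 : ℝ) ≤ |(Q : ℝ)| := by exact_mod_cast Int.one_le_abs hQ
    rw [← hprod, abs_mul, abs_of_pos h0] at h2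
    by_contra h3
    nlinarith [abs_nonneg φ']
  have hL : 0 < Real.log φ := Real.log_pos h1
  obtain ⟨ν, hν, hs, hcount⟩ := LucasMonoid.exists_weights hsum hprod hP hQ hPQ hφ
  obtain ⟨k₀, hk₀, C, hC⟩ := LucasMonoid.weightCount_asymptotic hν hL hs
  have hexp : -(((13 - ((LucasMonoid.lucasSet₀ φ φ').ncard : ℝ)) * Real.log φ - Real.log (φ - φ'))
      / (2 * Real.log φ)) = (((LucasMonoid.lucasSet₀ φ φ').ncard : ℝ) - 13) / 2
        + Real.log (φ - φ') / (2 * Real.log φ) := by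
    field_simp
    ring
  rw [hexp] at hC
  have hC' := Real.tendsto_log_atTop.eventually hC
  have hlog := Real.tendsto_log_atTop.eventually (Filter.eventually_gt_atTop 0)
  set M : ℝ → ℝ := fun x => k₀ * Real.log x ^ ((((LucasMonoid.lucasSet₀ φ φ').ncard : ℝ) - 13) / 2
    + Real.log (φ - φ') / (2 * Real.log φ))
      * Real.exp (Real.pi * Real.sqrt (2 * Real.log x / (3 * Real.log φ))) with hM
  have hMpos : ∀ x, 0 < Real.log x → 0 < M x := fun x hx => by
    simp only [hM]
    positivity
  refine ⟨k₀, hk₀, fun x => LucasMonoid.count φ φ' x / M x - 1, ?_, ?_⟩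
  · refine Asymptotics.IsBigO.of_bound C ?_
    filter_upwards [hC', hlog, Filter.eventually_gt_atTop 0] with x hx hx0 hxpos
    have hMx := hMpos x hx0
    rw [← hcount x hxpos] at hx
    rw [Real.norm_eq_abs, Real.norm_eq_abs, abs_of_nonneg (by positivity : 0 ≤ 1 / Real.log x ^ (1 / 10 : ℝ)),
      show LucasMonoid.count φ φ' x / M x - 1 = (LucasMonoid.count φ φ' x - M x) / M x by
        field_simp, abs_div, abs_of_pos hMx, div_le_iff₀ hMx]
    exact hx
  · filter_upwards [hlog] with x hx0
    have hMx := hMpos x hx0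
    change (LucasMonoid.count φ φ' x : ℝ) = M x * _
    field_simp
    ring
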